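/- **Setting.** Let $n\ge 1$, $f:\mathbb R^n\to\mathbb R$, and consider $\min f(x)$ subject to $x\ge 0$. For $x>0$ put $X=\operatorname{diag}(x)$, $\bar x_i=\min(x_i,1)$, $\bar X=\operatorname{diag}(\bar x)$. Fix $\epsilon_g\in(0,1)$, $\epsilon_H=\epsilon_g^{1/2}$, $\mu=\epsilon_g/4$, parameters $\theta,\zeta_r,\bar\zeta,\eta\in(0,1)$, $\beta\in[\epsilon_g^{1/2},1)$, $\hat M\ge 0$ (with $\hat M=0$ if no bound on $\|\nabla^2 f\|$ is provided), $c_\mu=\bar\zeta\mu$, and $x^0>0$. Let $\phi_\mu(x)=f(x)-\mu\sum_i\log x_i$. Norms are Euclidean unless indicated. The conditions (epsKKT) are $$x>0,\quad \nabla f(x)\ge-\epsilon_g e,\quad \|\bar X\nabla f(x)\|_\infty\le\epsilon_g,\quad \bar X\nabla^2 f(x)\bar X\succeq-\epsilon_H I .$$ **Algorithm** (log-barrier Newton-CG). Iteration $k=0,1,\dots$ at $x=x^k$: * If $[\nabla f(x)]_i\le-\epsilon_g$ for some $i$ or $\|\bar X\nabla f(x)\|_\infty>\epsilon_g$, call Capped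 CG with $H=\bar X\nabla^2\phi_\mu(x)\bar X$, $g=\bar X\nabla\phi_\mu(x)$, $\epsilon=\epsilon_H$ and initial bound $M=\hat M+\mu$. If it returns $\hat d$ of type NC, set $d=-\operatorname{sgn}(g^\top\hat d)\min\{|\hat d^\top H\hat d|/\|\hat d\|^3,\ \beta/\|X^{-1}\bar X\hat d\|_\infty\}\hat d$; if of type SOL, set $d=\min\{1,\beta/\|X^{-1}\bar X\hat d\|_\infty\}\hat d$. * Otherwise call the minimum eigenvalue oracle for $\bar X\nabla^2 f(x)\bar X$. It either issues a certificate that $\lambda_{\min}\ge-\epsilon_H$, upon which the algorithm terminates at $x$, or returns $v$ with $\|v\|=1$ and $v^\top\bar X\nabla^2f(x)\bar Xv\le-\epsilon_H/2$, and then $d=-\operatorname{sgn}(v^\top\bar X\nabla\phi_\mu(x))\min\{|v^\top\bar X\nabla^2\phi_\mu(x)\bar Xv|,\ \beta/\|X^{-1}\bar Xv\|_\infty\}v$. * Set $x^{k+1}=x+\alpha\bar Xd$ with $\alpha=\theta^j$, where $j\ge0$ is the smallest integer such that $\phi_\mu(x+\alpha\bar Xd)<\phi_\mu(x)-\frac\eta6\alpha^3\|d\|^3$.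 Here $\operatorname{sgn}$ takes values in $\{-1,1\}$ (either one at $0$). *Capped CG* with $\bar H=H+2\epsilon I$, and at all times $\kappa=(M+2\epsilon)/\epsilon$, $\hat\zeta_r=\zeta_r/(3\kappa)$, $\tau=\sqrt\kappa/(\sqrt\kappa+1)$, $T=4\kappa^4/(1-\sqrt\tau)^2$ for the current $M$: start with $y^0=0$, $r^0=g$, $p^0=-g$; return $p^0$ (NC) if $(p^0)^\top\bar Hp^0<\epsilon\|p^0\|^2$; otherwise raise $M$ to at least $\|Hp^0\|/\|p^0\|$. For $j=1,2,\dots$ compute the standard conjugate gradient iterates $y^j,r^j,p^j$ for $\bar Hy=-g$ and raise $M$ where necessary so that $\|Hu\|\le M\|u\|$ for $u=p^j,y^j,r^j$. Then, in this order: return $y^j$ (NC) if $(y^j)^\top\bar Hy^j<\epsilon\|y^j\|^2$; return $y^j$ (SOL) if $\|r^j\|\le\hat\zeta_r\|r^0\|$ and $\|r^j\|_\infty\le c_\mu$; return $p^j$ (NC) if $(p^j)^\top\bar Hp^j<\epsilon\|p^j\|^2$; if $\|r^j\|>\sqrt T\tau^{j/2}\|r^0\|$, compute $y^{j+1}$,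 find $i\in\{0,\dots,j-1\}$ with $w=y^{j+1}-y^i$ satisfying $w^\top\bar Hw<\epsilon\|w\|^2$, and return $w$ (NC). *Cost.* Each iteration costs one gradient evaluation plus the Hessian-vector products of Capped CG (reaching index $j$ costs $j+1$ products, and $j$ more if $y^i$ has to be regenerated) or those of the oracle. **Assumptions.** (1) In every run, $f$ is twice continuously differentiable with Lipschitz gradient (constant $L_g$) and Hessian (constant $L_H>0$) on an open set containing the iterates and the segments from each iterate to its trial points. (2) $f\ge f_{\rm low}$ on $\{x>0\}$. (3) $\|\nabla f(x^k)\|\le U_g$ and $\|\nabla^2 f(x^k)\|\le U_H$ at all iterates, with $U_g,U_H>0$. (4) For some $\delta\in[0,1)$ and $\mathcal C_{\rm meo}\ge 0$: whenever the oracle is called, conditionally on the history of the run, with probability at least $1-\delta$ it uses at most $N_{\rm meo}=\min\{n,1+\lceil\mathcal C_{\rm meo}\epsilon_H^{-1/2}\rceil\}$ Hessian-vector products and any certificate that it issues is correct. (5) The values of $M$ used or calculated in the calls of Capped CG are at most $U_H+\mu$. **Constants.** Let $$c_d=\min\Big\{\tfrac{1-\bar\zeta}9,\big(\tfrac3{2L_H}\big)^{1/2},\tfrac1{2(L_H+9/2+\zeta_r)}\Big\},\qquad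 c_{\rm sol}=\min\Big\{c_d,\tfrac{6(1-\beta)^2\theta^2}{(L_H+\eta)(1-\beta)^2+(2-\beta)}\Big\},$$ $$c_{\rm nc}=\min\Big\{1,\tfrac{3(1-\beta)^2\theta}{(L_H+\eta)(1-\beta)^2+(2-\beta)}\Big\},\qquad c_{\rm all}=\min\{c_{\rm sol},c_{\rm nc}\},\qquad \omega_2=\max\Big\{\tfrac{96\sqrt n}{\eta c_{\rm all}^2},\|x^0\|_\infty\Big\},$$ $$\bar K_2=\left\lceil\frac{1536\big(f(x^0)-f_{\rm low}+\mu n(\log\omega_2-\min_i\log x^0_i)\big)}{\eta c_{\rm all}^3}\,\epsilon_g^{-3/2}\right\rceil+2 .$$ Let $J$ be the smallest integer with $\sqrt T\tau^{J/2}\|r^0\|\le\min\{\hat\zeta_r\|r^0\|,c_\mu\}$, where $\hat\zeta_r,\tau,T$ are formed with $M=U_H+\mu$, $\epsilon=\epsilon_H$, for the initial residual $r^0$ of every call of Capped CG in the run ($J=0$ if there is none). Let $\bar J$ be the smallest integer with the same property for $\|r^0\|$ replaced by $U_g+\mu\sqrt n$. **Claim.** (a) Every run terminates, within $\bar K_2$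 iterations, at a point satisfying the first three conditions of (epsKKT), and $J\le\bar J$. With probability at least $(1-\delta)^{\bar K_2}$ this point satisfies (epsKKT) and the run uses at most $$\max\{2\min\{n,J\}+2,\ N_{\rm meo}\}\cdot\bar K_2$$ Hessian-vector products and gradient evaluations in total. With probability at most $1-(1-\delta)^{\bar K_2}$ the algorithm terminates incorrectly, at a point violating only the fourth condition. The operation bound holds in every run, correct or not, in which no call of the oracle uses more than $N_{\rm meo}$ products. (b) Let $n$ and $\epsilon_g$ vary, with the parameters $\theta,\zeta_r,\bar\zeta,\beta,\eta$ and $L_H,U_g,U_H$ fixed, $f(x^0)-f_{\rm low}$ bounded, all entries of $x^0$ in a fixed compact interval in $(0,\infty)$, and $\mathcal C_{\rm meo}$ at most logarithmic in $n$, $1/\epsilon_g$, $1/\delta$. Then, uniformly, the operation bound is $\tilde{\mathcal O}(\epsilon_g^{-7/4}+n\epsilon_g^{-3/4})$ (the estimate of interest for large $n$), and it is $\tilde{\mathcal O}(n\epsilon_g^{-3/2})$ if $n$ is small in the sense that $n\le J$. Here $\tilde{\mathcal O}$ omits powers of $1+\log n+\log(1/\epsilon_g)+\log(1/\delta)$ (the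 last term being dropped if $\delta=0$). -/

import Mathlib

open MeasureTheory ProbabilityTheory
open scoped RealInnerProductSpace

noncomputable section

namespace LogBarrier

/-- Points of `ℝⁿ` with the Euclidean norm. -/
abbrev Vec (n : ℕ) := EuclideanSpace ℝ (Fin n)

/-! ### Scaling by diagonal matrices, gradient and Hessian -/

/-- The product `diag(u) v`. -/
def diagMul {n : ℕ} (u v : Vec n) : Vec n := WithLp.toLp 2 fun i => u i * v i

/-- The norm `‖v‖_∞`. -/
def supNorm {n : ℕ} (v : Vec n) : ℝ := ‖WithLp.ofLp v‖

/-- The vector `x̄ = min(x, e)`, so that `X̄ v = diagMul (xbar x) v`. -/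
def xbar {n : ℕ} (x : Vec n) : Vec n := WithLp.toLp 2 fun i => min (x i) 1

/-- The vector `X⁻¹ X̄ v`. -/
def relScale {n : ℕ} (x v : Vec n) : Vec n := WithLp.toLp 2 fun i => xbar x i / x i * v i

/-- The Hessian `∇²f(x)`, as the derivative of the gradient. -/
def hess {n : ℕ} (f : Vec n → ℝ) (x : Vec n) : Vec n →L[ℝ] Vec n := fderiv ℝ (gradient f) x

/-- The map `v ↦ X̄ A X̄ v`. -/
def scaled {n : ℕ} (x : Vec n) (A : Vec n → Vec n) (v : Vec n) : Vec n :=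
  diagMul (xbar x) (A (diagMul (xbar x) v))

/-- The log-barrier function `φ_μ(x) = f(x) - μ ∑ log xᵢ`. -/
def barrier {n : ℕ} (f : Vec n → ℝ) (μ : ℝ) (x : Vec n) : ℝ := f x - μ * ∑ i, Real.log (x i)

/-- The gradient of the log-barrier function, `∇f(x) - μ X⁻¹ e`. -/
def barrierGrad {n : ℕ} (f : Vec n → ℝ) (μ : ℝ) (x : Vec n) : Vec n :=
  WithLp.toLp 2 fun i => gradient f x i - μ / x i

/-- The Hessian of the log-barrier function, `v ↦ (∇²f(x) + μ X⁻²) v`. -/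
def barrierHess {n : ℕ} (f : Vec n → ℝ) (μ : ℝ) (x v : Vec n) : Vec n :=
  WithLp.toLp 2 fun i => hess f x v i + μ / x i ^ 2 * v i

/-- The scaled gradient `X̄ ∇φ_μ(x)`. -/
def scaledGrad {n : ℕ} (f : Vec n → ℝ) (μ : ℝ) (x : Vec n) : Vec n :=
  diagMul (xbar x) (barrierGrad f μ x)

/-- The scaled Hessian `X̄ ∇²φ_μ(x) X̄`. -/
def scaledHess {n : ℕ} (f : Vec n → ℝ) (μ : ℝ) (x : Vec n) : Vec n → Vec n :=
  scaled x (barrierHess f μ x)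

/-! ### Approximate optimality conditions -/

/-- `x > 0`, `∇f(x) ≥ -ε_g e` and `‖X̄ ∇f(x)‖_∞ ≤ ε_g`. -/
def FirstOrder {n : ℕ} (f : Vec n → ℝ) (εg : ℝ) (x : Vec n) : Prop :=
  (∀ i, 0 < x i) ∧ (∀ i, -εg ≤ gradient f x i) ∧
    supNorm (diagMul (xbar x) (gradient f x)) ≤ εg

/-- `X̄ ∇²f(x) X̄ ⪰ -ε_H I`. -/
def SecondOrder {n : ℕ} (f : Vec n → ℝ) (εH : ℝ) (x : Vec n) : Prop :=
  ∀ v : Vec n, -εH * ‖v‖ ^ 2 ≤ ⟪v, scaled x (hess f x) v⟫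

/-! ### Capped conjugate gradient

The matrix `H` enters only through the products `v ↦ H v`. -/

/-- The product `H̄ v` with `H̄ = H + 2 ε I`. -/
def damped {n : ℕ} (H : Vec n → Vec n) (ε : ℝ) (v : Vec n) : Vec n := H v + (2 * ε) • v

/-- `vᵀ H̄ v < ε ‖v‖²`. -/
def LowCurv {n : ℕ} (H : Vec n → Vec n) (ε : ℝ) (v : Vec n) : Prop :=
  ⟪v, damped H ε v⟫ < ε * ‖v‖ ^ 2

/-- `κ = (M + 2 ε) / ε`. -/
def cgKappa (M ε : ℝ) : ℝ := (M + 2 * ε) / ε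

/-- `ζ̂_r = ζ_r / (3 κ)`. -/
def cgZeta (M ε ζr : ℝ) : ℝ := ζr / (3 * cgKappa M ε)

/-- `τ = √κ / (√κ + 1)`. -/
def cgTau (M ε : ℝ) : ℝ := √(cgKappa M ε) / (√(cgKappa M ε) + 1)

/-- `T = 4 κ⁴ / (1 - √τ)²`. -/
def cgT (M ε : ℝ) : ℝ := 4 * cgKappa M ε ^ 4 / (1 - √(cgTau M ε)) ^ 2

/-- The iterate `y^j`, residual `r^j`, search direction `p^j` and current bound `M`. -/
structure CGState (n : ℕ) where
  y : Vec n
  r : Vec n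
  p : Vec n
  M : ℝ

/-- The state at `j = 0`, where `M` is raised to `‖H p⁰‖ / ‖p⁰‖` if it is smaller. -/
def cgInit {n : ℕ} (H : Vec n → Vec n) (g : Vec n) (M₀ : ℝ) : CGState n where
  y := 0
  r := g
  p := -g
  M := max M₀ (‖H (-g)‖ / ‖-g‖)

/-- One conjugate gradient step, after which `M` is raised, where necessary, so that
`‖H v‖ ≤ M ‖v‖` for each of the new vectors `v = p, y, r`. -/
def cgNext {n : ℕ} (H : Vec n → Vec n) (ε : ℝ) (s : CGState n) : CGState n :=
  let α := ⟪s.r, s.r⟫ / ⟪s.p, damped H ε s.p⟫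
  let y := s.y + α • s.p
  let r := s.r + α • damped H ε s.p
  let p := -r + (‖r‖ ^ 2 / ‖s.r‖ ^ 2) • s.p
  ⟨y, r, p, max (max s.M (‖H p‖ / ‖p‖)) (max (‖H y‖ / ‖y‖) (‖H r‖ / ‖r‖))⟩

/-- The state at index `j` of the main loop. -/
def cgState {n : ℕ} (H : Vec n → Vec n) (ε : ℝ) (g : Vec n) (M₀ : ℝ) : ℕ → CGState n
  | 0 => cgInit H g M₀
  | j + 1 => cgNext H ε (cgState H ε g M₀ j)

/-- The test `‖r‖ ≤ ζ̂_r ‖r⁰‖` and `‖r‖_∞ ≤ c_μ`. -/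
def CGSolved {n : ℕ} (ε ζr c : ℝ) (g : Vec n) (s : CGState n) : Prop :=
  ‖s.r‖ ≤ cgZeta s.M ε ζr * ‖g‖ ∧ supNorm s.r ≤ c

/-- The test `‖r^j‖ > √T τ^{j/2} ‖r⁰‖`. -/
def CGSlow {n : ℕ} (ε : ℝ) (g : Vec n) (s : CGState n) (j : ℕ) : Prop :=
  √(cgT s.M ε) * cgTau s.M ε ^ ((j : ℝ) / 2) * ‖g‖ < ‖s.r‖

/-- One of the four termination tests of the main loop is satisfied at index `j`. -/
def CGStops {n : ℕ} (H : Vec n → Vec n) (ε ζr c : ℝ) (g : Vec n) (M₀ : ℝ) (j : ℕ) : Prop :=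
  let s := cgState H ε g M₀ j
  LowCurv H ε s.y ∨ CGSolved ε ζr c g s ∨ LowCurv H ε s.p ∨ CGSlow ε g s j

/-- The output of capped CG: the direction, its type (`true` for `NC`, `false` for `SOL`), the
final value of `M`, and the number of products with `H` that were used. -/
structure CGResult (n : ℕ) where
  dir : Vec n
  isNC : Bool
  M : ℝ
  products : ℕ

/-- The possible outcomes of capped CG; `none` stands for a run that breaks down or never ends.

Reaching index `j` takes the products `H p⁰, …, H p^j` (those of `H` with `y` and `r` follow from
the recurrences). The iterates are not stored: when an earlier `y^i` has to be found, the iterates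
are generated anew, which is charged with `j` further products. -/
inductive CGReturns {n : ℕ} (H : Vec n → Vec n) (ε ζr c : ℝ) (g : Vec n) (M₀ : ℝ) :
    Option (CGResult n) → Prop
  | initial (h₀ : LowCurv H ε (-g)) : CGReturns H ε ζr c g M₀ (some ⟨-g, true, M₀, 1⟩)
  | curvY {j : ℕ} (h₀ : ¬ LowCurv H ε (-g))
      (hj : IsLeast {j | 1 ≤ j ∧ CGStops H ε ζr c g M₀ j} j)
      (hy : LowCurv H ε (cgState H ε g M₀ j).y) :
      CGReturns H ε ζr c g M₀
        (some ⟨(cgState H ε g M₀ j).y, true, (cgState H ε g M₀ j).M, j + 1⟩)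
  | solved {j : ℕ} (h₀ : ¬ LowCurv H ε (-g))
      (hj : IsLeast {j | 1 ≤ j ∧ CGStops H ε ζr c g M₀ j} j)
      (hy : ¬ LowCurv H ε (cgState H ε g M₀ j).y)
      (hs : CGSolved ε ζr c g (cgState H ε g M₀ j)) :
      CGReturns H ε ζr c g M₀
        (some ⟨(cgState H ε g M₀ j).y, false, (cgState H ε g M₀ j).M, j + 1⟩)
  | curvP {j : ℕ} (h₀ : ¬ LowCurv H ε (-g))
      (hj : IsLeast {j | 1 ≤ j ∧ CGStops H ε ζr c g M₀ j} j)
      (hy : ¬ LowCurv H ε (cgState H ε g M₀ j).y)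
      (hs : ¬ CGSolved ε ζr c g (cgState H ε g M₀ j))
      (hp : LowCurv H ε (cgState H ε g M₀ j).p) :
      CGReturns H ε ζr c g M₀
        (some ⟨(cgState H ε g M₀ j).p, true, (cgState H ε g M₀ j).M, j + 1⟩)
  | slow {j i : ℕ} (h₀ : ¬ LowCurv H ε (-g))
      (hj : IsLeast {j | 1 ≤ j ∧ CGStops H ε ζr c g M₀ j} j)
      (hy : ¬ LowCurv H ε (cgState H ε g M₀ j).y)
      (hs : ¬ CGSolved ε ζr c g (cgState H ε g M₀ j))
      (hp : ¬ LowCurv H ε (cgState H ε g M₀ j).p)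
      (hi : i < j)
      (hc : LowCurv H ε ((cgState H ε g M₀ (j + 1)).y - (cgState H ε g M₀ i).y)) :
      CGReturns H ε ζr c g M₀
        (some ⟨(cgState H ε g M₀ (j + 1)).y - (cgState H ε g M₀ i).y, true,
          (cgState H ε g M₀ j).M, (j + 1) + j⟩)
  | noIndex {j : ℕ} (h₀ : ¬ LowCurv H ε (-g))
      (hj : IsLeast {j | 1 ≤ j ∧ CGStops H ε ζr c g M₀ j} j)
      (hy : ¬ LowCurv H ε (cgState H ε g M₀ j).y)
      (hs : ¬ CGSolved ε ζr c g (cgState H ε g M₀ j))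
      (hp : ¬ LowCurv H ε (cgState H ε g M₀ j).p)
      (hi : ∀ i < j, ¬ LowCurv H ε ((cgState H ε g M₀ (j + 1)).y - (cgState H ε g M₀ i).y)) :
      CGReturns H ε ζr c g M₀ none
  | endless (h₀ : ¬ LowCurv H ε (-g)) (h : ∀ j, 1 ≤ j → ¬ CGStops H ε ζr c g M₀ j) :
      CGReturns H ε ζr c g M₀ none

/-- The inequality `√T τ^{j/2} ρ ≤ min {ζ̂_r ρ, c_μ}`, where `ρ = ‖r⁰‖`. -/
def CapIneq (M ε ζr c ρ : ℝ) (j : ℕ) : Prop :=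
  √(cgT M ε) * cgTau M ε ^ ((j : ℝ) / 2) * ρ ≤ min (cgZeta M ε ζr * ρ) c

/-- The smallest `j` such that `√T τ^{j/2} ρ ≤ min {ζ̂_r ρ, c_μ}`. -/
def capJ (M ε ζr c ρ : ℝ) : ℕ := sInf {j | CapIneq M ε ζr c ρ j}

/-! ### The log-barrier Newton-CG algorithm -/

/-- The parameters of the algorithm that do not depend on the tolerance. -/
structure Params where
  θ : ℝ
  ζr : ℝ
  ζbar : ℝ
  β : ℝ
  η : ℝ

/-- All parameters lie in `(0, 1)`. -/
structure Params.Valid (p : Params) : Prop where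
  θ_mem : p.θ ∈ Set.Ioo (0 : ℝ) 1
  ζr_mem : p.ζr ∈ Set.Ioo (0 : ℝ) 1
  ζbar_mem : p.ζbar ∈ Set.Ioo (0 : ℝ) 1
  β_mem : p.β ∈ Set.Ioo (0 : ℝ) 1
  η_mem : p.η ∈ Set.Ioo (0 : ℝ) 1

/-- The state before an iteration: at the iterate `x`; terminated at `x`; or broken down, in case
capped CG did not return a direction or the line search found no step. -/
inductive Status (n : ℕ) where
  | active (x : Vec n)
  | halted (x : Vec n)
  | failed

/-- The answer of the minimum eigenvalue oracle: a direction of negative curvature or (`none`) the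
certificate, and the number of Hessian-vector products that were used. -/
structure MeoAnswer (n : ℕ) where
  dir : Option (Vec n)
  products : ℕ

/-- The condition under which an iteration at `x` calls capped CG; otherwise it calls the
oracle. -/
def NeedsCG {n : ℕ} (f : Vec n → ℝ) (εg : ℝ) (x : Vec n) : Prop :=
  (∃ i, gradient f x i ≤ -εg) ∨ εg < supNorm (diagMul (xbar x) (gradient f x))

/-- `σ = ±1` is a sign of `t`; both signs are admitted for `t = 0`. -/
def IsSign (σ t : ℝ) : Prop := (σ = 1 ∨ σ = -1) ∧ σ * t = |t|

/-- The step `d` obtained from an output of capped CG at `x`. -/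
def CGDirection {n : ℕ} (f : Vec n → ℝ) (μ β : ℝ) (x : Vec n) (r : CGResult n) (d : Vec n) :
    Prop :=
  (r.isNC = true → ∃ σ, IsSign σ ⟪scaledGrad f μ x, r.dir⟫ ∧
    d = (-σ * min (|⟪r.dir, scaledHess f μ x r.dir⟫| / ‖r.dir‖ ^ 3)
      (β / supNorm (relScale x r.dir))) • r.dir) ∧
  (r.isNC = false → d = min 1 (β / supNorm (relScale x r.dir)) • r.dir)

/-- The step `d` obtained from a direction `v` returned by the oracle at `x`. -/
def MeoDirection {n : ℕ} (f : Vec n → ℝ) (μ β : ℝ) (x v d : Vec n) : Prop :=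
  ∃ σ, IsSign σ ⟪v, scaledGrad f μ x⟫ ∧
    d = (-σ * min |⟪v, scaledHess f μ x v⟫| (β / supNorm (relScale x v))) • v

/-- The sufficient decrease condition for the step length `α`. -/
def SuffDecrease {n : ℕ} (f : Vec n → ℝ) (μ η : ℝ) (x d : Vec n) (α : ℝ) : Prop :=
  barrier f μ (x + α • diagMul (xbar x) d) < barrier f μ x - η / 6 * α ^ 3 * ‖d‖ ^ 3

/-- Backtracking from `x` along `X̄ d`, and the state to which it leads. -/
inductive LineSearch {n : ℕ} (f : Vec n → ℝ) (μ η θ : ℝ) (x d : Vec n) : Status n → Prop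
  | accept {j : ℕ} (hj : IsLeast {j : ℕ | SuffDecrease f μ η x d (θ ^ j)} j) :
      LineSearch f μ η θ x d (.active (x + θ ^ j • diagMul (xbar x) d))
  | fail (h : ∀ j : ℕ, ¬ SuffDecrease f μ η x d (θ ^ j)) : LineSearch f μ η θ x d .failed

/-- One iteration at `x`, with `ε_H = √ε_g`, `μ = ε_g / 4` and `c_μ = ζ̄ μ`. The arguments are the
result of capped CG (if called), the answer of the oracle (used only if called), the step `d` (if
one is computed) and the next state. -/
inductive Iteration {n : ℕ} (f : Vec n → ℝ) (p : Params) (εg Mhat : ℝ) (x : Vec n) :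
    Option (CGResult n) → MeoAnswer n → Option (Vec n) → Status n → Prop
  | cgBreakdown {a : MeoAnswer n} (h : NeedsCG f εg x)
      (hc : CGReturns (scaledHess f (εg / 4) x) (√εg) p.ζr (p.ζbar * (εg / 4))
        (scaledGrad f (εg / 4) x) (Mhat + εg / 4) none) :
      Iteration f p εg Mhat x none a none .failed
  | cgStep {a : MeoAnswer n} {r : CGResult n} {d : Vec n} {s : Status n} (h : NeedsCG f εg x)
      (hc : CGReturns (scaledHess f (εg / 4) x) (√εg) p.ζr (p.ζbar * (εg / 4))
        (scaledGrad f (εg / 4) x) (Mhat + εg / 4) (some r))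
      (hd : CGDirection f (εg / 4) p.β x r d)
      (hs : LineSearch f (εg / 4) p.η p.θ x d s) :
      Iteration f p εg Mhat x (some r) a (some d) s
  | certified {a : MeoAnswer n} (h : ¬ NeedsCG f εg x) (ha : a.dir = none) :
      Iteration f p εg Mhat x none a none (.halted x)
  | meoStep {a : MeoAnswer n} {v d : Vec n} {s : Status n} (h : ¬ NeedsCG f εg x)
      (ha : a.dir = some v) (hd : MeoDirection f (εg / 4) p.β x v d)
      (hs : LineSearch f (εg / 4) p.η p.θ x d s) :
      Iteration f p εg Mhat x none a (some d) s

/-- The record of a run, indexed by the iterations. -/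
structure Trace (n : ℕ) where
  status : ℕ → Status n
  cg : ℕ → Option (CGResult n)
  meo : ℕ → MeoAnswer n
  dir : ℕ → Option (Vec n)

/-- The record `t` is that of a run of the algorithm from `x₀`, with the optional input `Mhat`
(`0` if it is not provided). -/
structure IsExecution {n : ℕ} (f : Vec n → ℝ) (p : Params) (εg Mhat : ℝ) (x₀ : Vec n)
    (t : Trace n) : Prop where
  init : t.status 0 = .active x₀
  active : ∀ k x, t.status k = .active x →
    Iteration f p εg Mhat x (t.cg k) (t.meo k) (t.dir k) (t.status (k + 1))
  halted : ∀ k x, t.status k = .halted x → t.status (k + 1) = .halted x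
  failed : ∀ k, t.status k = .failed → t.status (k + 1) = .failed

open Classical in
/-- The number of gradient evaluations and Hessian-vector products in iteration `k`: one gradient,
and the products used by capped CG or by the oracle. -/
def iterOps {n : ℕ} (f : Vec n → ℝ) (εg : ℝ) (t : Trace n) (k : ℕ) : ℕ :=
  match t.status k with
  | .active x =>
      1 + if NeedsCG f εg x then (t.cg k).elim 0 CGResult.products else (t.meo k).products
  | _ => 0

/-- The number of gradient evaluations and Hessian-vector products in the iterations `k < K`. -/
def totalOps {n : ℕ} (f : Vec n → ℝ) (εg : ℝ) (t : Trace n) (K : ℕ) : ℕ :=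
  ∑ k ∈ Finset.range K, iterOps f εg t k

/-- The smallest `j` such that `√T τ^{j/2} ‖r⁰‖ ≤ min {ζ̂_r ‖r⁰‖, c_μ}`, with the given `M`, for the
initial residual `r⁰ = X̄ ∇φ_μ(x)` of every call of capped CG in the run. -/
def runJ {n : ℕ} (f : Vec n → ℝ) (εg M ε ζr c : ℝ) (t : Trace n) : ℕ :=
  sInf {j | ∀ k x, t.status k = .active x → NeedsCG f εg x →
    CapIneq M ε ζr c ‖scaledGrad f (εg / 4) x‖ j}

/-! ### Assumptions -/

/-- `f` is twice continuously differentiable, with Lipschitz gradient (constant `Lg`) and Hessian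
(constant `LH`), on an open set that contains the iterates and the segments from each iterate to
its first trial point (hence all trial points). -/
def SmoothAlong {n : ℕ} (f : Vec n → ℝ) (Lg LH : ℝ) (t : Trace n) : Prop :=
  ∃ U : Set (Vec n), IsOpen U ∧
    (∀ k x, t.status k = .active x → x ∈ U) ∧
    (∀ k x d, t.status k = .active x → t.dir k = some d →
      segment ℝ x (x + diagMul (xbar x) d) ⊆ U) ∧
    ContDiffOn ℝ 2 f U ∧
    (∀ x ∈ U, ∀ y ∈ U, ‖gradient f x - gradient f y‖ ≤ Lg * ‖x - y‖) ∧
    (∀ x ∈ U, ∀ y ∈ U, ‖hess f x - hess f y‖ ≤ LH * ‖x - y‖)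

/-- The gradients and Hessians at the iterates are bounded by `Ug` and `UH`. -/
def BoundedAlong {n : ℕ} (f : Vec n → ℝ) (Ug UH : ℝ) (t : Trace n) : Prop :=
  ∀ k x, t.status k = .active x → ‖gradient f x‖ ≤ Ug ∧ ‖hess f x‖ ≤ UH

/-- The values of `M` in all calls of capped CG are at most `B`. (`M` never decreases during a
call, so only the final value matters.) -/
def CGBoundLe {n : ℕ} (B : ℝ) (t : Trace n) : Prop :=
  ∀ k x r, t.status k = .active x → t.cg k = some r → r.M ≤ B

/-- The oracle is called in iteration `k`. -/
def MeoCalled {n : ℕ} (f : Vec n → ℝ) (εg : ℝ) (t : Trace n) (k : ℕ) : Prop :=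
  ∃ x, t.status k = .active x ∧ ¬ NeedsCG f εg x

/-- The oracle is called in iteration `k`, it uses at most `N` Hessian-vector products, and its
answer is right: if it issues the certificate, then `X̄ ∇²f(x) X̄ ⪰ -ε_H I`. -/
def MeoGood {n : ℕ} (f : Vec n → ℝ) (εg : ℝ) (N : ℕ) (t : Trace n) (k : ℕ) : Prop :=
  ∃ x, t.status k = .active x ∧ ¬ NeedsCG f εg x ∧ (t.meo k).products ≤ N ∧
    ((t.meo k).dir = none → SecondOrder f (√εg) x)

/-- The properties of the randomized oracle, where `ℱ k` stands for the history before
iteration `k`. A direction that it returns is always one of sufficient negative curvature. Given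
the history, a call answers rightly within `N` products with probability at least `1 - δ`. -/
structure MeoAssumption {n : ℕ} {Ω : Type*} {mΩ : MeasurableSpace Ω} (P : Measure Ω)
    (ℱ : Filtration ℕ mΩ) (f : Vec n → ℝ) (εg δ : ℝ) (N : ℕ) (t : Ω → Trace n) : Prop where
  curvature : ∀ ω k x v, (t ω).status k = .active x → ¬ NeedsCG f εg x →
    ((t ω).meo k).dir = some v → ‖v‖ = 1 ∧ ⟪v, scaled x (hess f x) v⟫ ≤ -(√εg / 2)
  measurable_called : ∀ k, MeasurableSet[ℱ k] {ω | MeoCalled f εg (t ω) k}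
  measurable_good : ∀ k, MeasurableSet[ℱ (k + 1)] {ω | MeoGood f εg N (t ω) k}
  prob_good : ∀ k, ∀ᵐ ω ∂P, MeoCalled f εg (t ω) k →
    1 - δ ≤ (P⟦{ω' | MeoGood f εg N (t ω') k} | ℱ k⟧) ω

/-! ### The constants of the complexity bound -/

/-- The constant `c_d`. -/
def cD (p : Params) (LH : ℝ) : ℝ :=
  min ((1 - p.ζbar) / 9) (min √(3 / (2 * LH)) (1 / (2 * (LH + 9 / 2 + p.ζr))))

/-- The constant `c_sol`. -/
def cSol (p : Params) (LH : ℝ) : ℝ :=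
  min (cD p LH)
    (6 * (1 - p.β) ^ 2 * p.θ ^ 2 / ((LH + p.η) * (1 - p.β) ^ 2 + (2 - p.β)))

/-- The constant `c_nc`. -/
def cNc (p : Params) (LH : ℝ) : ℝ :=
  min 1 (3 * (1 - p.β) ^ 2 * p.θ / ((LH + p.η) * (1 - p.β) ^ 2 + (2 - p.β)))

/-- The constant `c_all`. -/
def cAll (p : Params) (LH : ℝ) : ℝ := min (cSol p LH) (cNc p LH)

/-- The constant `ω₂`. -/
def omega2 {n : ℕ} (p : Params) (LH : ℝ) (x₀ : Vec n) : ℝ :=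
  max (96 * √n / (p.η * cAll p LH ^ 2)) (supNorm x₀)

/-- The bound `K̄₂` on the number of iterations, where `gap = f(x₀) - f_low`. -/
def Kbar2 {n : ℕ} (p : Params) (LH εg gap : ℝ) (x₀ : Vec n) : ℕ :=
  ⌈1536 * (gap + εg / 4 * n * (Real.log (omega2 p LH x₀) - ⨅ i, Real.log (x₀ i))) /
    (p.η * cAll p LH ^ 3) * εg ^ (-(3 / 2) : ℝ)⌉₊ + 2

/-- The bound `N_meo` on the number of Hessian-vector products in a call of the oracle. -/
def Nmeo (n : ℕ) (Cmeo εH : ℝ) : ℕ := min n (1 + ⌈Cmeo * εH ^ (-(1 / 2) : ℝ)⌉₊)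

/-- The bound `max {2 min {n, J} + 2, N} K`. -/
def opBound (n J N K : ℕ) : ℕ := max (2 * min n J + 2) N * K

/-- A quantity that is logarithmic in `n`, `1 / ε_g` and (for `δ > 0`) `1 / δ`. -/
def logFactor (n : ℕ) (εg δ : ℝ) : ℝ :=
  1 + Real.log n + Real.log (1 / εg) + Real.log (1 / δ)

end LogBarrier

end

/-! Measure a step by s = α‖d‖ and put a = c_all √ε_g / 4. An accepted step lowers φ_μ by more than
η s³/6. By `Iteration.outcome`, an iteration halts, or makes a long step (s ≥ a), or makes a step
from a SOL direction to a point where the oracle is called next. Oracle steps are always long, so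
two short steps are never consecutive, and G long steps account for at most 2G + 1 steps in all.

The function φ_μ need not be bounded below, since ∑ log xᵢ may grow with x. But a long step has s ≤
s³/a². If S is the sum of the cubes of the long steps, the iterates therefore grow in norm by
O(S/a²) only, and concavity of the logarithm shows that this growth absorbs at most half of the
decrease η S/6 (`potential_le`; this fixes ω₂). Hence η S/12 is at most the initial gap, and S ≥ G
a³ gives 2G + 2 ≤ K̄₂.

A short SOL step turns out to be the full, untruncated Newton step. The residual, the damping term
and the Taylor remainder are then all small multiples of μ, so ∇f at the new point is close to the
gradient of the linearised barrier term, which is of order μ after scaling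
(`not_needsCG_of_short_step`).

Capped CG cannot break down. Nonzero residuals are orthogonal, so some test succeeds by index n. If
the slow-decay test succeeds, a difference y^{j+1} - y^i of low curvature exists:
`IsCG.residual_decay` is an accelerated-gradient Lyapunov argument that uses curvature along these
differences only, not positive definiteness. If that test fails at index J, the residual is small
enough for SOL.

For the cost, let L be the maximum in the operation bound. An oracle iteration may cost L + 1, one
too many. A long step is credited with 2L, which pays for itself and for a preceding short step; the
latter costs at most L - 1 because SOL outputs never regenerate iterates
(`RunAssumptions.invariant`). The probability bound conditions on the history one iteration at a
time (`pow_le_measureReal_forall_lt`). The rates follow by multiplying bounds for J, N_meo and K̄₂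
in powers of ε_g^{-1/4}. -/

namespace LogBarrier

/-! ### Conjugate gradients -/

section ConjugateGradient

variable {E : Type*} [NormedAddCommGroup E] [InnerProductSpace ℝ E]

/-- The sequences `y`, `r`, `p` are generated by conjugate gradients for `B y = -g` from `y = 0`. -/
structure IsCG (B : E →ₗ[ℝ] E) (g : E) (y r p : ℕ → E) : Prop where
  y_zero : y 0 = 0
  r_zero : r 0 = g
  p_zero : p 0 = -g
  y_succ : ∀ k, y (k + 1) = y k + (⟪r k, r k⟫ / ⟪p k, B (p k)⟫) • p k
  r_succ : ∀ k, r (k + 1) = r k + (⟪r k, r k⟫ / ⟪p k, B (p k)⟫) • B (p k)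
  p_succ : ∀ k, p (k + 1) = -r (k + 1) + (‖r (k + 1)‖ ^ 2 / ‖r k‖ ^ 2) • p k

namespace IsCG

variable {B : E →ₗ[ℝ] E} {g : E} {y r p : ℕ → E}

theorem residual (h : IsCG B g y r p) (k : ℕ) : r k = B (y k) + g := by
  induction k with
  | zero => simp [h.y_zero, h.r_zero]
  | succ k ih => rw [h.r_succ, h.y_succ, map_add, map_smul, ih]; abel

/-- The relations must be proved together. Orthogonality of r to earlier p comes from conjugacy at
the previous index. It yields orthogonality of residuals, as each r is a combination of two p's, and
this yields conjugacy, as B (p i) is a multiple of r (i+1) - r i. Positive curvature is needed only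
along the directions used, so B may be indefinite. -/
theorem orthogonality (h : IsCG B g y r p) (hB : B.IsSymmetric) {j : ℕ}
    (hp : ∀ i < j, 0 < ⟪p i, B (p i)⟫) (hr : ∀ i < j, r i ≠ 0) :
    ∀ k ≤ j, (∀ i < k, ⟪r k, r i⟫ = 0) ∧ (∀ i < k, ⟪p k, B (p i)⟫ = 0) ∧
      (∀ i < k, ⟪r k, p i⟫ = 0) ∧ ⟪r k, p k⟫ = -‖r k‖ ^ 2 := by
  intro k
  induction k using Nat.strong_induction_on with
  | _ k IH =>
  intro hk
  cases k with
  | zero => simp [h.r_zero, h.p_zero]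
  | succ k =>
    obtain ⟨h1, h2, h3, h4⟩ := IH k (Nat.lt_succ_self k) (by omega)
    have hpk := hp k (by omega)
    have hrk : 0 < ‖r k‖ ^ 2 := by have := norm_pos_iff.2 (hr k (by omega)); positivity
    have A3 : ∀ i < k + 1, ⟪r (k + 1), p i⟫ = 0 := by
      intro i hi
      rw [h.r_succ, inner_add_left, real_inner_smul_left]
      rcases Nat.lt_succ_iff_lt_or_eq.1 hi with hi | rfl
      · rw [h3 i hi, hB, h2 i hi]; simp
      · rw [h4, real_inner_self_eq_norm_sq, real_inner_comm (p i)]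
        field_simp; ring
    have A1 : ∀ i < k + 1, ⟪r (k + 1), r i⟫ = 0 := by
      intro i hi
      cases i with
      | zero =>
        have := A3 0 hi
        rw [h.p_zero, inner_neg_right] at this
        rw [h.r_zero]; linarith
      | succ i =>
        have e : r (i + 1) = -p (i + 1) + (‖r (i + 1)‖ ^ 2 / ‖r i‖ ^ 2) • p i := by
          rw [h.p_succ i]; abel
        rw [e, inner_add_right, inner_neg_right, real_inner_smul_right, A3 _ hi,
          A3 i (by omega)]; simp
    have A2 : ∀ i < k + 1, ⟪p (k + 1), B (p i)⟫ = 0 := by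
      intro i hi
      have hpi := hp i (by omega)
      have hri : 0 < ‖r i‖ ^ 2 := by have := norm_pos_iff.2 (hr i (by omega)); positivity
      have e : B (p i) = (⟪p i, B (p i)⟫ / ‖r i‖ ^ 2) • (r (i + 1) - r i) := by
        rw [h.r_succ i, add_sub_cancel_left, smul_smul, real_inner_self_eq_norm_sq]
        rw [div_mul_div_cancel₀ hri.ne', div_self hpi.ne', one_smul]
      rcases Nat.lt_succ_iff_lt_or_eq.1 hi with hi' | rfl
      · rw [h.p_succ k, inner_add_left, inner_neg_left, real_inner_smul_left, h2 i hi', e,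
          real_inner_smul_right, inner_sub_right, A1 _ (by omega), A1 i (by omega)]; simp
      · rw [h.p_succ i, inner_add_left, inner_neg_left, real_inner_smul_left]
        nth_rw 1 [e]
        rw [real_inner_smul_right, inner_sub_right, A1 _ hi, real_inner_self_eq_norm_sq]
        field_simp; ring
    refine ⟨A1, A2, A3, ?_⟩
    rw [h.p_succ k, inner_add_right, inner_neg_right, real_inner_smul_right, A3 k (by omega),
      real_inner_self_eq_norm_sq]; simp

/-- The iterate y m is a combination of p 0, …, p (m-1), to all of which r k is orthogonal. -/
theorem inner_r_y (h : IsCG B g y r p) (hB : B.IsSymmetric) {j : ℕ}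
    (hp : ∀ i < j, 0 < ⟪p i, B (p i)⟫) (hr : ∀ i < j, r i ≠ 0) {k m : ℕ} (hk : k ≤ j)
    (hm : m ≤ k) : ⟪r k, y m⟫ = 0 := by
  induction m with
  | zero => simp [h.y_zero]
  | succ m ih =>
    rw [h.y_succ, inner_add_right, real_inner_smul_right, ih (by omega),
      (h.orthogonality hB hp hr k hk).2.2.1 m (by omega)]; simp

/-- Conjugate gradients reach a zero residual within `finrank` steps. -/
theorem exists_residual_eq_zero [FiniteDimensional ℝ E] (h : IsCG B g y r p)
    (hB : B.IsSymmetric) (hp : ∀ i < Module.finrank ℝ E, r i ≠ 0 → 0 < ⟪p i, B (p i)⟫) :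
    ∃ i ≤ Module.finrank ℝ E, r i = 0 := by
  by_contra! hr
  have ho := h.orthogonality hB (fun i hi => hp i hi (hr i hi.le)) (fun i hi => hr i hi.le)
  -- Otherwise `finrank + 1` nonzero, pairwise orthogonal residuals would exist.
  have hli : LinearIndependent ℝ (fun i : Fin (Module.finrank ℝ E + 1) => r i) := by
    apply linearIndependent_of_ne_zero_of_inner_eq_zero
    · intro i; exact hr i (by omega)
    · intro i k hik
      rcases lt_or_gt_of_ne (fun e => hik (Fin.ext e) : (i : ℕ) ≠ k) with hlt | hlt
      · change ⟪r i, r k⟫ = 0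
        rw [real_inner_comm]; exact (ho k (by omega)).1 i hlt
      · exact (ho i (by omega)).1 k hlt
  have := hli.fintype_card_le_finrank
  simp at this

set_option maxHeartbeats 800000 in
/-- If the curvature along `p i` for `i ≤ j` and along `y (j + 1) - y i` for `i < j` is at least
`ε`, then the residuals decay linearly up to index `j`. -/
theorem residual_decay (h : IsCG B g y r p) (hB : B.IsSymmetric) {j : ℕ} {ε L t : ℝ}
    (hε : 0 < ε) (hL : 0 < L) (ht0 : 0 ≤ t) (ht1 : t ≤ 1) (ht : t ^ 2 * L ≤ ε)
    (hr : ∀ i ≤ j, r i ≠ 0) (hp : ∀ i ≤ j, 0 < ⟪p i, B (p i)⟫)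
    (hrL : ∀ i ≤ j, ⟪r i, B (r i)⟫ ≤ L * ‖r i‖ ^ 2)
    (he : ∀ i ≤ j, ε * ‖y (j + 1) - y i‖ ^ 2 ≤ ⟪y (j + 1) - y i, B (y (j + 1) - y i)⟫) :
    ‖r j‖ ^ 2 ≤ 2 * (L / ε) * (1 - t) ^ j * ‖r 0‖ ^ 2 := by
  have ho := h.orthogonality hB (j := j + 1) (fun i hi => hp i (by omega))
    (fun i hi => hr i (by omega))
  have hry : ∀ k ≤ j + 1, ∀ m ≤ k, ⟪r k, y m⟫ = 0 := fun k hk m hm =>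
    h.inner_r_y hB (j := j + 1) (fun i hi => hp i (by omega)) (fun i hi => hr i (by omega)) hk hm
  set z := y (j + 1) with hz
  set e : ℕ → E := fun i => z - y i with hedef
  -- Since r (j+1) is orthogonal to e i, q i is twice the excess of the quadratic ½⟪y, B y⟫ + ⟪g, y⟫
  -- at y i over its value at z, which plays the role of the minimizer.
  set q : ℕ → ℝ := fun i => ⟪e i, B (e i)⟫ with hq
  have hBe : ∀ i, B (e i) = r (j + 1) - r i := by
    intro i; rw [h.residual, h.residual i, hedef]; simp [← hz]
  have hre : ∀ i ≤ j + 1, ⟪r i, e i⟫ = -q i := by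
    intro i hi
    have h1 : ⟪e i, r (j + 1)⟫ = 0 := by
      rw [real_inner_comm, hedef]; simp only [inner_sub_right]
      rw [hry _ le_rfl _ le_rfl, hry _ le_rfl i hi]; simp
    change _ = -⟪e i, B (e i)⟫
    rw [hBe, inner_sub_right (e i), h1, real_inner_comm (r i)]; ring
  have hrz : ∀ i ≤ j + 1, ⟪r i, z⟫ = -q i := by
    intro i hi
    rw [← hre i hi, hedef]; simp only [inner_sub_right]
    rw [hry i hi i le_rfl]; ring
  -- By conjugacy the curvature of r splits into those of p (i+1) and of a multiple of p i, both
  -- nonnegative; this transfers the bound L from residuals to search directions.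
  have hα : ∀ i ≤ j, ⟪p i, B (p i)⟫ ≤ L * ‖r i‖ ^ 2 := by
    intro i hi
    refine le_trans ?_ (hrL i hi)
    cases i with
    | zero => simp [h.p_zero, h.r_zero]
    | succ i =>
      set c := ‖r (i + 1)‖ ^ 2 / ‖r i‖ ^ 2 with hc
      have er : r (i + 1) = -p (i + 1) + c • p i := by rw [h.p_succ i]; abel
      have h0 : ⟪p (i + 1), B (p i)⟫ = 0 := (ho (i + 1) (by omega)).2.1 i (by omega)
      have h0' : ⟪p i, B (p (i + 1))⟫ = 0 := by rw [← hB, real_inner_comm]; exact h0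
      have hpi := hp i (by omega)
      have : ⟪r (i + 1), B (r (i + 1))⟫ = ⟪p (i + 1), B (p (i + 1))⟫ + c ^ 2 * ⟪p i, B (p i)⟫ := by
        rw [er]
        simp only [map_add, map_neg, map_smul, inner_add_left, inner_add_right, inner_neg_left,
          inner_neg_right, real_inner_smul_left, real_inner_smul_right, h0, h0']
        ring
      rw [this]
      nlinarith [sq_nonneg c]
  -- The exact decrease of q is ‖r i‖⁴ / ⟪p i, B (p i)⟫.
  have hdec : ∀ i ≤ j, ‖r i‖ ^ 2 ≤ L * (q i - q (i + 1)) := by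
    intro i hi
    have hpi := hp i hi
    have hri : 0 < ‖r i‖ ^ 2 := by have := norm_pos_iff.2 (hr i hi); positivity
    have hαi := hα i hi
    set c := ⟪r i, r i⟫ / ⟪p i, B (p i)⟫ with hc
    have ee : e i = e (i + 1) + c • p i := by
      simp only [hedef]; rw [h.y_succ i]; abel
    have h0 : ⟪p i, B (e (i + 1))⟫ = 0 := by
      rw [hBe, inner_sub_right, real_inner_comm, (ho (j + 1) le_rfl).2.2.1 i (by omega),
        real_inner_comm, (ho (i + 1) (by omega)).2.2.1 i (by omega)]; simp
    have h0' : ⟪e (i + 1), B (p i)⟫ = 0 := by rw [← hB, real_inner_comm]; exact h0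
    have : q i = q (i + 1) + c ^ 2 * ⟪p i, B (p i)⟫ := by
      simp only [hq]; rw [ee]
      simp only [map_add, map_smul, inner_add_left, inner_add_right, real_inner_smul_left,
        real_inner_smul_right, h0, h0']
      ring
    have hc' : c ^ 2 * ⟪p i, B (p i)⟫ = ‖r i‖ ^ 2 * ‖r i‖ ^ 2 / ⟪p i, B (p i)⟫ := by
      rw [hc, real_inner_self_eq_norm_sq]; field_simp
    rw [this, add_sub_cancel_left, hc', mul_div_assoc', le_div_iff₀ hpi]
    nlinarith
  have hq0 : ∀ i ≤ j, ε * ‖e i‖ ^ 2 ≤ q i := he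
  have hqlast : q (j + 1) = 0 := by simp [hq, hedef, hz]
  -- The auxiliary sequence of accelerated gradient descent. It is not computed by the algorithm and
  -- serves only in the Lyapunov function q i + ε‖w i - z‖², which contracts by 1 - t. As w m is
  -- built from earlier residuals and iterates, later residuals are orthogonal to it.
  let w : ℕ → E := fun i => Nat.rec 0 (fun i v => (1 - t) • v + t • y i - (t / ε) • r i) i
  have w0 : w 0 = 0 := rfl
  have ws : ∀ i, w (i + 1) = (1 - t) • w i + t • y i - (t / ε) • r i := fun i => rfl
  have hrw : ∀ m, ∀ k ≤ j + 1, m ≤ k → ⟪r k, w m⟫ = 0 := by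
    intro m
    induction m with
    | zero => intro k _ _; simp [w0]
    | succ m ih =>
      intro k hk hm
      rw [ws, inner_sub_right, inner_add_right, real_inner_smul_right, real_inner_smul_right,
        real_inner_smul_right, ih k hk (by omega), hry k hk m (by omega), (ho k hk).1 m (by omega)]
      simp
  have hV : ∀ i ≤ j, q i + ε * ‖w i - z‖ ^ 2 ≤ (1 - t) ^ i * (q 0 + ε * ‖w 0 - z‖ ^ 2) := by
    intro i
    induction i with
    | zero => intro _; simp
    | succ i ih =>
      intro hi
      have IH := ih (by omega)
      have hdi := hdec i (by omega)
      have hqi := hq0 i (by omega)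
      set u := w i - z with hu
      set v := y i - z with hv
      have hvn : ‖v‖ = ‖e i‖ := by rw [hv, norm_sub_rev]
      have hru : ⟪u, r i⟫ = q i := by
        rw [real_inner_comm, hu, inner_sub_right, hrw i i (by omega) le_rfl, hrz i (by omega)]; ring
      have hrv : ⟪v, r i⟫ = q i := by
        rw [real_inner_comm, hv, inner_sub_right, hry i (by omega) i le_rfl, hrz i (by omega)]; ring
      have ew : w (i + 1) - z = (1 - t) • u + t • v - (t / ε) • r i := by
        rw [ws, hu, hv, smul_sub, smul_sub, sub_smul, sub_smul, one_smul, one_smul]; abel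
      have hcv : ‖(1 - t) • u + t • v‖ ^ 2 ≤ (1 - t) * ‖u‖ ^ 2 + t * ‖v‖ ^ 2 := by
        rw [norm_add_sq_real, norm_smul, norm_smul, real_inner_smul_left, real_inner_smul_right,
          mul_pow, mul_pow, Real.norm_eq_abs, Real.norm_eq_abs, sq_abs, sq_abs]
        have h1 : 0 ≤ ‖u - v‖ ^ 2 := by positivity
        rw [norm_sub_sq_real] at h1
        have h2 : 0 ≤ t * (1 - t) := mul_nonneg ht0 (by linarith)
        nlinarith [mul_nonneg h2 h1]
      have hexp : ‖w (i + 1) - z‖ ^ 2 ≤ (1 - t) * ‖u‖ ^ 2 + t * ‖v‖ ^ 2 - 2 * (t / ε) * q i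
          + (t / ε) ^ 2 * ‖r i‖ ^ 2 := by
        rw [ew, norm_sub_sq_real, inner_add_left, real_inner_smul_left, real_inner_smul_left,
          real_inner_smul_right, real_inner_smul_right, hru, hrv, norm_smul (t / ε), mul_pow,
          Real.norm_eq_abs, sq_abs]
        nlinarith
      -- The condition t² L ≤ ε lets the decrease of q pay for the squared gradient step of w.
      have h3 : ε * ((t / ε) ^ 2 * ‖r i‖ ^ 2) ≤ q i - q (i + 1) := by
        have : ε * ((t / ε) ^ 2 * ‖r i‖ ^ 2) = t ^ 2 * ‖r i‖ ^ 2 / ε := by field_simp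
        rw [this, div_le_iff₀ hε]
        have hd0 : 0 ≤ q i - q (i + 1) := by
          by_contra hneg
          push Not at hneg
          nlinarith [sq_nonneg ‖r i‖]
        nlinarith [sq_nonneg t]
      have h4 : ε * (2 * (t / ε) * q i) = 2 * t * q i := by field_simp
      have h5 := mul_le_mul_of_nonneg_left hexp hε.le
      have h6 : t * (ε * ‖v‖ ^ 2) ≤ t * q i := by rw [hvn]; gcongr
      have h7 : q (i + 1) + ε * ‖w (i + 1) - z‖ ^ 2 ≤ (1 - t) * (q i + ε * ‖u‖ ^ 2) := by
        nlinarith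
      refine h7.trans ((mul_le_mul_of_nonneg_left IH (by linarith : 0 ≤ 1 - t)).trans_eq ?_)
      rw [pow_succ' (1 - t), mul_assoc]
  -- Since w 0 = y 0 = 0, the initial Lyapunov value is at most 2 q 0, and q 0 ≤ ‖r 0‖²/ε by
  -- Cauchy-Schwarz and the curvature along e 0. At the end, q (j+1) = 0 turns `hdec` into a bound
  -- for ‖r j‖².
  have hVj := hV j le_rfl
  have he0 : ‖w 0 - z‖ = ‖e 0‖ := by simp [w0, hedef, h.y_zero]
  have hq00 := hq0 0 (Nat.zero_le j)
  rw [he0] at hVj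
  have hpow : 0 ≤ (1 - t) ^ j := pow_nonneg (by linarith) j
  have hqj : q j ≤ (1 - t) ^ j * (2 * q 0) := by
    have : 0 ≤ ε * ‖w j - z‖ ^ 2 := by positivity
    nlinarith
  have hq0r : q 0 ≤ ‖r 0‖ ^ 2 / ε := by
    have h1 := hre 0 (Nat.zero_le _)
    have h2 : q 0 ≤ ‖r 0‖ * ‖e 0‖ := by
      have := abs_real_inner_le_norm (r 0) (e 0)
      rw [h1, abs_neg] at this
      exact (le_abs_self _).trans this
    rw [le_div_iff₀ hε]
    have h3 : ε * ‖e 0‖ ≤ ‖r 0‖ := by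
      rcases (norm_nonneg (e 0)).eq_or_lt with h0 | h0
      · rw [← h0]; simp
      · have : ε * ‖e 0‖ * ‖e 0‖ ≤ ‖r 0‖ * ‖e 0‖ := by
          rw [mul_assoc, ← sq]; exact hq00.trans h2
        exact le_of_mul_le_mul_right this h0
    calc q 0 * ε ≤ ‖r 0‖ * ‖e 0‖ * ε := by gcongr
      _ = ‖r 0‖ * (ε * ‖e 0‖) := by ring
      _ ≤ ‖r 0‖ * ‖r 0‖ := by gcongr
      _ = _ := by ring
  have hrj := hdec j le_rfl
  rw [hqlast, sub_zero] at hrj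
  calc ‖r j‖ ^ 2 ≤ L * ((1 - t) ^ j * (2 * q 0)) := hrj.trans (by gcongr)
    _ ≤ L * ((1 - t) ^ j * (2 * (‖r 0‖ ^ 2 / ε))) := by gcongr
    _ = _ := by field_simp

end IsCG

end ConjugateGradient

/-! ### Capped conjugate gradients -/

theorem supNorm_le_norm {n : ℕ} (v : Vec n) : supNorm v ≤ ‖v‖ :=
  (pi_norm_le_iff_of_nonneg (norm_nonneg v)).2 fun i => PiLp.norm_apply_le v i

theorem abs_le_supNorm {n : ℕ} (v : Vec n) (i : Fin n) : |v i| ≤ supNorm v :=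
  norm_le_pi_norm (WithLp.ofLp v) i

theorem supNorm_le {n : ℕ} {v : Vec n} {c : ℝ} (hc : 0 ≤ c) (h : ∀ i, |v i| ≤ c) :
    supNorm v ≤ c :=
  (pi_norm_le_iff_of_nonneg hc).2 h

theorem two_le_cgKappa {M ε : ℝ} (hM : 0 ≤ M) (hε : 0 < ε) : 2 ≤ cgKappa M ε := by
  rw [cgKappa, le_div_iff₀ hε]; linarith

theorem cgTau_pos {M ε : ℝ} (hM : 0 ≤ M) (hε : 0 < ε) : 0 < cgTau M ε := by
  have := Real.sqrt_pos.2 (lt_of_lt_of_le two_pos (two_le_cgKappa hM hε))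
  rw [cgTau]; positivity

theorem cgTau_lt_one (M ε : ℝ) : cgTau M ε < 1 := by
  have := Real.sqrt_nonneg (cgKappa M ε)
  rw [cgTau, div_lt_one (by linarith)]; linarith

theorem one_sub_cgTau (M ε : ℝ) : 1 - cgTau M ε = 1 / (√(cgKappa M ε) + 1) := by
  have := Real.sqrt_nonneg (cgKappa M ε)
  rw [cgTau]; field_simp; ring

theorem one_sub_sqrt_cgTau_pos (M ε : ℝ) : 0 < 1 - √(cgTau M ε) := by
  have : √(cgTau M ε) < 1 := by
    rw [Real.sqrt_lt' one_pos]; simpa using cgTau_lt_one M ε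
  linarith

theorem cgKappa_mono {M M' ε : ℝ} (hε : 0 < ε) (h : M ≤ M') : cgKappa M ε ≤ cgKappa M' ε := by
  unfold cgKappa; gcongr

theorem cgTau_mono {M M' ε : ℝ} (hε : 0 < ε) (h : M ≤ M') :
    cgTau M ε ≤ cgTau M' ε := by
  have h1 := Real.sqrt_le_sqrt (cgKappa_mono hε h)
  have h2 := Real.sqrt_nonneg (cgKappa M ε)
  rw [cgTau, cgTau, div_le_div_iff₀ (by linarith) (by linarith)]
  nlinarith

theorem cgT_mono {M M' ε : ℝ} (hM : 0 ≤ M) (hε : 0 < ε) (h : M ≤ M') : cgT M ε ≤ cgT M' ε := by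
  have h1 := cgKappa_mono hε h
  have h2 := two_le_cgKappa hM hε
  have h3 := Real.sqrt_le_sqrt (cgTau_mono hε h)
  have h4 := one_sub_sqrt_cgTau_pos M' ε
  unfold cgT
  gcongr

theorem cgKappa_pow_le_cgT {M ε : ℝ} (hM : 0 ≤ M) (hε : 0 < ε) :
    4 * cgKappa M ε ^ 4 ≤ cgT M ε := by
  have h1 := one_sub_sqrt_cgTau_pos M ε
  have h2 := Real.sqrt_nonneg (cgTau M ε)
  have h3 := two_le_cgKappa hM hε
  rw [cgT, le_div_iff₀ (by positivity)]
  have : (1 - √(cgTau M ε)) ^ 2 ≤ 1 := by nlinarith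
  nlinarith [pow_pos (lt_of_lt_of_le two_pos h3) 4]

theorem cgT_pos {M ε : ℝ} (hM : 0 ≤ M) (hε : 0 < ε) : 0 < cgT M ε := by
  have h3 := two_le_cgKappa hM hε
  exact lt_of_lt_of_le (by positivity) (cgKappa_pow_le_cgT hM hε)

theorem cgZeta_lt_one {M ε ζr : ℝ} (hM : 0 ≤ M) (hε : 0 < ε) (h1 : ζr < 1) :
    cgZeta M ε ζr < 1 := by
  have h3 := two_le_cgKappa hM hε
  rw [cgZeta, div_lt_one (by positivity)]; linarith

theorem cgZeta_pos {M ε ζr : ℝ} (hM : 0 ≤ M) (hε : 0 < ε) (h0 : 0 < ζr) :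
    0 < cgZeta M ε ζr := by
  have h3 := two_le_cgKappa hM hε
  rw [cgZeta]; positivity

/-- At index 0 the inequality would read √T ≤ ζ̂_r, but √T ≥ 1 > ζ̂_r. Hence J ≥ 1 as soon as capped
CG is called, which matters because the main loop starts at index 1. -/
theorem not_capIneq_zero {M ε ζr c ρ : ℝ} (hM : 0 ≤ M) (hε : 0 < ε) (h1 : ζr < 1)
    (hρ : 0 < ρ) : ¬ CapIneq M ε ζr c ρ 0 := by
  intro h
  have h2 := h.trans (min_le_left _ _)
  have h3 := two_le_cgKappa hM hε
  have h4 : 1 ≤ √(cgT M ε) := by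
    rw [Real.one_le_sqrt]
    refine le_trans ?_ (cgKappa_pow_le_cgT hM hε)
    have : (1 : ℝ) ≤ cgKappa M ε ^ 4 := one_le_pow₀ (by linarith)
    linarith
  have h5 := cgZeta_lt_one hM hε h1
  simp only [Nat.cast_zero, zero_div, Real.rpow_zero, mul_one] at h2
  have := le_of_mul_le_mul_right h2 hρ
  linarith

theorem LowCurv.ne_zero {n : ℕ} {H : Vec n → Vec n} {ε : ℝ} {v : Vec n} (h : LowCurv H ε v) :
    v ≠ 0 := by
  rintro rfl
  simp [LowCurv] at h

section CappedCG

variable {n : ℕ} (A : Vec n →ₗ[ℝ] Vec n) (ε : ℝ) (g : Vec n) (M₀ : ℝ)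

/-- The linear map `v ↦ A v + 2 ε v`. -/
noncomputable def dampedMap : Vec n →ₗ[ℝ] Vec n := A + (2 * ε) • LinearMap.id

theorem damped_eq (v : Vec n) : damped A ε v = dampedMap A ε v := rfl

theorem dampedMap_isSymmetric {A : Vec n →ₗ[ℝ] Vec n} (hA : A.IsSymmetric) :
    (dampedMap A ε).IsSymmetric := by
  intro u v
  simp only [dampedMap, LinearMap.add_apply, LinearMap.smul_apply, LinearMap.id_apply,
    inner_add_left, inner_add_right, real_inner_smul_left, real_inner_smul_right]
  rw [hA]

theorem isCG_cgState : IsCG (dampedMap A ε) g (fun k => (cgState A ε g M₀ k).y)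
    (fun k => (cgState A ε g M₀ k).r) (fun k => (cgState A ε g M₀ k).p) where
  y_zero := rfl
  r_zero := rfl
  p_zero := rfl
  y_succ _ := rfl
  r_succ _ := rfl
  p_succ _ := rfl

theorem cgState_M_mono : Monotone fun k => (cgState A ε g M₀ k).M :=
  monotone_nat_of_le_succ fun _ => (le_max_left _ _).trans (le_max_left _ _)

theorem le_cgState_M (k : ℕ) : M₀ ≤ (cgState A ε g M₀ k).M :=
  (le_max_left _ _).trans (cgState_M_mono A ε g M₀ (Nat.zero_le k))

theorem norm_map_residual_le (k : ℕ) :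
    ‖A (cgState A ε g M₀ k).r‖ ≤ (cgState A ε g M₀ k).M * ‖(cgState A ε g M₀ k).r‖ := by
  rcases eq_or_ne (cgState A ε g M₀ k).r 0 with h | h
  · rw [h]; simp
  rw [← div_le_iff₀ (norm_pos_iff.2 h)]
  cases k with
  | zero =>
    -- As r⁰ = -p⁰, the initial update of M for p⁰ also covers r⁰.
    have : ‖A (cgState A ε g M₀ 0).r‖ / ‖(cgState A ε g M₀ 0).r‖ = ‖A (-g)‖ / ‖-g‖ := by
      simp [cgState, cgInit]
    rw [this]
    exact le_max_right _ _
  | succ k => exact (le_max_right _ _).trans (le_max_right _ _)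

variable {A ε g M₀}

theorem not_lowCurv_iff {v : Vec n} :
    ¬ LowCurv A ε v ↔ ε * ‖v‖ ^ 2 ≤ ⟪v, dampedMap A ε v⟫ := not_lt

/-- The failed tests give strict positivity only if p ≠ 0. That follows from ⟪r, p⟫ = -‖r‖², which
in turn needs positivity at the earlier indices; hence the strong induction. -/
theorem curvature_pos (hA : A.IsSymmetric) (hε : 0 < ε) {j : ℕ}
    (hp : ∀ i ≤ j, ¬ LowCurv A ε (cgState A ε g M₀ i).p)
    (hr : ∀ i ≤ j, (cgState A ε g M₀ i).r ≠ 0) :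
    ∀ i ≤ j, 0 < ⟪(cgState A ε g M₀ i).p, dampedMap A ε (cgState A ε g M₀ i).p⟫ := by
  intro i
  induction i using Nat.strong_induction_on with
  | _ i IH =>
  intro hi
  have h := ((isCG_cgState A ε g M₀).orthogonality (dampedMap_isSymmetric ε hA) (j := i)
    (fun k hk => IH k hk (by omega)) (fun k hk => hr k (by omega)) i le_rfl).2.2.2
  have hne : (cgState A ε g M₀ i).p ≠ 0 := by
    intro h0
    have := norm_pos_iff.2 (hr i hi)
    simp only [h0, inner_zero_right] at h
    nlinarith
  have h1 := not_lowCurv_iff.1 (hp i hi)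
  have h2 := norm_pos_iff.2 hne
  have : 0 < ε * ‖(cgState A ε g M₀ i).p‖ ^ 2 := by positivity
  linarith

variable {ζr c : ℝ}

theorem cgSolved_of_residual_eq_zero {s : CGState n} (hM : 0 ≤ s.M) (hε : 0 < ε) (hζ : 0 < ζr)
    (hc : 0 ≤ c) (h : s.r = 0) : CGSolved ε ζr c g s := by
  have := cgZeta_pos hM hε hζ
  refine ⟨?_, ?_⟩
  · rw [h, norm_zero]; positivity
  · rw [h]; exact (supNorm_le_norm _).trans (by simpa using hc)

theorem properties_before_stop (hε : 0 < ε) (hM₀ : 0 ≤ M₀) (hζ : 0 < ζr) (hc : 0 ≤ c)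
    (hg : g ≠ 0) (h₀ : ¬ LowCurv A ε (-g)) {j : ℕ}
    (hj : ∀ i, 1 ≤ i → i < j → ¬ CGStops A ε ζr c g M₀ i) :
    (∀ i < j, (cgState A ε g M₀ i).r ≠ 0) ∧
      ∀ i < j, ¬ LowCurv A ε (cgState A ε g M₀ i).p := by
  constructor
  · intro i hi
    rcases Nat.eq_zero_or_pos i with rfl | h1
    · exact hg
    · intro h
      exact hj i h1 hi (Or.inr (Or.inl (cgSolved_of_residual_eq_zero
        (hM₀.trans (le_cgState_M A ε g M₀ i)) hε hζ hc h)))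
  · intro i hi
    rcases Nat.eq_zero_or_pos i with rfl | h1
    · exact h₀
    · exact fun h => hj i h1 hi (Or.inr (Or.inr (Or.inl h)))

/-- A zero residual passes the SOL test, so a run without a stop up to index n has nonzero residuals
and positive curvature throughout, contrary to finite termination of conjugate gradients. -/
theorem exists_cgStops (hA : A.IsSymmetric) (hε : 0 < ε) (hM₀ : 0 ≤ M₀) (hζ : 0 < ζr)
    (hc : 0 ≤ c) (hg : g ≠ 0) (h₀ : ¬ LowCurv A ε (-g)) :
    ∃ j, 1 ≤ j ∧ j ≤ n ∧ CGStops A ε ζr c g M₀ j := by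
  by_contra! hcon
  have hb := properties_before_stop (j := n + 1) hε hM₀ hζ hc hg h₀
    (fun i h1 h2 => hcon i h1 (by omega))
  have hpos := curvature_pos hA hε (j := n) (fun i hi => hb.2 i (by omega))
    (fun i hi => hb.1 i (by omega))
  obtain ⟨i, hi, h0⟩ := (isCG_cgState A ε g M₀).exists_residual_eq_zero
    (dampedMap_isSymmetric ε hA) (fun i hi _ => hpos i (by simpa using hi.le))
  rw [finrank_euclideanSpace_fin] at hi
  exact hb.1 i (by omega) h0

theorem stop_le_dim (hA : A.IsSymmetric) (hε : 0 < ε) (hM₀ : 0 ≤ M₀) (hζ : 0 < ζr)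
    (hc : 0 ≤ c) (hg : g ≠ 0) (h₀ : ¬ LowCurv A ε (-g)) {j : ℕ}
    (hj : IsLeast {j | 1 ≤ j ∧ CGStops A ε ζr c g M₀ j} j) : j ≤ n := by
  obtain ⟨i, h1, h2, h3⟩ := exists_cgStops hA hε hM₀ hζ hc hg h₀
  exact (hj.2 ⟨h1, h3⟩).trans h2

/-- If the slow test fails at J, the residual is at most √T τ^{J/2}‖g‖. Replacing the current M by a
larger one increases √T and τ and decreases ζ̂_r, so the cap inequality for the larger M makes the
SOL test succeed. -/
theorem stop_le_cap (hε : 0 < ε) (hM₀ : 0 ≤ M₀) (hζ : 0 < ζr) {j J : ℕ} {M : ℝ}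
    (hj : IsLeast {j | 1 ≤ j ∧ CGStops A ε ζr c g M₀ j} j)
    (hM : (cgState A ε g M₀ j).M ≤ M) (hJ1 : 1 ≤ J) (hJ : CapIneq M ε ζr c ‖g‖ J) : j ≤ J := by
  by_contra! hlt
  have hns : ¬ CGStops A ε ζr c g M₀ J := fun h => absurd (hj.2 ⟨hJ1, h⟩) (by omega)
  have hMJ : (cgState A ε g M₀ J).M ≤ M := (cgState_M_mono A ε g M₀ hlt.le).trans hM
  have hM0 : 0 ≤ (cgState A ε g M₀ J).M := hM₀.trans (le_cgState_M A ε g M₀ J)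
  apply hns
  by_cases hslow : CGSlow ε g (cgState A ε g M₀ J) J
  · exact Or.inr (Or.inr (Or.inr hslow))
  rw [CGSlow, not_lt] at hslow
  have h1 : ‖(cgState A ε g M₀ J).r‖ ≤ min (cgZeta M ε ζr * ‖g‖) c := by
    refine hslow.trans (le_trans ?_ hJ)
    have := Real.sqrt_le_sqrt (cgT_mono hM0 hε hMJ)
    have h3 := cgTau_mono hε hMJ
    have h4 := cgTau_pos hM0 hε
    gcongr
  refine Or.inr (Or.inl ⟨?_, (supNorm_le_norm _).trans (h1.trans (min_le_right _ _))⟩)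
  refine (h1.trans (min_le_left _ _)).trans ?_
  have h5 := cgKappa_mono hε hMJ
  have h6 := two_le_cgKappa hM0 hε
  unfold cgZeta
  gcongr

/-- If all differences had curvature at least ε, `residual_decay` with L = M + 2ε = κε and t = 1 - τ
= 1/(√κ + 1) would contradict the slow test, since 2κ ≤ T. -/
theorem exists_lowCurv_of_slow (hA : A.IsSymmetric) (hε : 0 < ε) (hM₀ : 0 ≤ M₀) {j : ℕ}
    (hr : ∀ i < j, (cgState A ε g M₀ i).r ≠ 0)
    (hp : ∀ i ≤ j, ¬ LowCurv A ε (cgState A ε g M₀ i).p)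
    (hs : CGSlow ε g (cgState A ε g M₀ j) j) :
    ∃ i < j, LowCurv A ε ((cgState A ε g M₀ (j + 1)).y - (cgState A ε g M₀ i).y) := by
  by_contra! hcon
  set M := (cgState A ε g M₀ j).M with hMdef
  have hM : 0 ≤ M := hM₀.trans (le_cgState_M A ε g M₀ j)
  have hκ := two_le_cgKappa hM hε
  have hτ := cgTau_pos hM hε
  have hT := cgT_pos hM hε
  have hrj : 0 < ‖(cgState A ε g M₀ j).r‖ := lt_of_le_of_lt (by positivity) hs
  have hr' : ∀ i ≤ j, (cgState A ε g M₀ i).r ≠ 0 := by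
    intro i hi
    rcases hi.lt_or_eq with h | rfl
    · exact hr i h
    · exact norm_pos_iff.1 hrj
  have hpos := curvature_pos hA hε hp hr'
  have hsq : √(cgKappa M ε) ^ 2 = cgKappa M ε := Real.sq_sqrt (by linarith)
  have hsq0 := Real.sqrt_nonneg (cgKappa M ε)
  have hLκ : M + 2 * ε = cgKappa M ε * ε := by rw [cgKappa]; field_simp
  have ht : (1 - cgTau M ε) ^ 2 * (M + 2 * ε) ≤ ε := by
    rw [one_sub_cgTau, hLκ, div_pow, one_pow, div_mul_eq_mul_div, one_mul, div_le_iff₀ (by positivity)]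
    nlinarith
  have key := (isCG_cgState A ε g M₀).residual_decay (dampedMap_isSymmetric ε hA) (j := j) hε
    (L := M + 2 * ε) (t := 1 - cgTau M ε) (by linarith)
    (by linarith [cgTau_lt_one M ε]) (by linarith) ht hr' hpos ?_ ?_
  · have e : M + 2 * ε = cgKappa M ε * ε := hLκ
    rw [sub_sub_cancel, e, mul_div_assoc, div_self hε.ne', mul_one] at key
    change ‖(cgState A ε g M₀ j).r‖ ^ 2 ≤ 2 * cgKappa M ε * cgTau M ε ^ j * ‖g‖ ^ 2 at key
    have h1 : (√(cgT M ε) * cgTau M ε ^ ((j : ℝ) / 2) * ‖g‖) ^ 2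
        < ‖(cgState A ε g M₀ j).r‖ ^ 2 := by
      have : 0 ≤ √(cgT M ε) * cgTau M ε ^ ((j : ℝ) / 2) * ‖g‖ := by positivity
      gcongr
      exact hs
    have h2 : (cgTau M ε ^ ((j : ℝ) / 2)) ^ 2 = cgTau M ε ^ j := by
      rw [← Real.rpow_natCast, ← Real.rpow_mul hτ.le]
      simp
    rw [mul_pow, mul_pow, Real.sq_sqrt hT.le, h2] at h1
    have h3 : 2 * cgKappa M ε ≤ cgT M ε := by
      refine le_trans ?_ (cgKappa_pow_le_cgT hM hε)
      have : cgKappa M ε ^ 1 ≤ cgKappa M ε ^ 4 := pow_le_pow_right₀ (by linarith) (by norm_num)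
      linarith
    have h4 : 2 * cgKappa M ε * cgTau M ε ^ j * ‖g‖ ^ 2 ≤ cgT M ε * cgTau M ε ^ j * ‖g‖ ^ 2 := by
      gcongr
    linarith
  · intro i hi
    have h1 := norm_map_residual_le A ε g M₀ i
    have h2 : (cgState A ε g M₀ i).M ≤ M := cgState_M_mono A ε g M₀ hi
    have h3 := real_inner_le_norm (cgState A ε g M₀ i).r (A (cgState A ε g M₀ i).r)
    simp only [dampedMap, LinearMap.add_apply, LinearMap.smul_apply, LinearMap.id_apply,
      inner_add_right, real_inner_smul_right, real_inner_self_eq_norm_sq]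
    nlinarith [norm_nonneg (cgState A ε g M₀ i).r]
  · intro i hi
    rcases hi.lt_or_eq with h | rfl
    · exact not_lowCurv_iff.1 (hcon i h)
    -- The difference y^{j+1} - y^j is not searched by the algorithm. It is a multiple of p^j, whose
    -- curvature has already been tested.
    · have hpj := not_lowCurv_iff.1 (hp i le_rfl)
      simp only [(isCG_cgState A ε g M₀).y_succ, add_sub_cancel_left, norm_smul, map_smul,
        real_inner_smul_left, real_inner_smul_right, mul_pow, Real.norm_eq_abs, sq_abs]
      have := mul_le_mul_of_nonneg_left hpj
        (sq_nonneg (⟪(cgState A ε g M₀ i).r, (cgState A ε g M₀ i).r⟫ /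
          ⟪(cgState A ε g M₀ i).p, dampedMap A ε (cgState A ε g M₀ i).p⟫))
      linarith

theorem not_cgReturns_none (hA : A.IsSymmetric) (hε : 0 < ε) (hM₀ : 0 ≤ M₀) (hζ : 0 < ζr)
    (hc : 0 ≤ c) (hg : g ≠ 0) : ¬ CGReturns A ε ζr c g M₀ none := by
  intro h
  cases h with
  | @noIndex j h₀ hj hy hs hp hi =>
    have hb := properties_before_stop (j := j) hε hM₀ hζ hc hg h₀
      (fun i h1 h2 h3 => absurd (hj.2 ⟨h1, h3⟩) (by omega))
    have hslow : CGSlow ε g (cgState A ε g M₀ j) j := by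
      rcases hj.1.2 with h | h | h | h
      · exact absurd h hy
      · exact absurd h hs
      · exact absurd h hp
      · exact h
    obtain ⟨i, hij, hc⟩ := exists_lowCurv_of_slow hA hε hM₀ hb.1
      (fun i hi => hi.lt_or_eq.elim (hb.2 i) (fun e => e ▸ hp)) hslow
    exact hi i hij hc
  | endless h₀ h =>
    obtain ⟨j, h1, _, h3⟩ := exists_cgStops (M₀ := M₀) hA hε hM₀ hζ hc hg h₀
    exact h j h1 h3

theorem CGReturns.lowCurv {H : Vec n → Vec n} {r : CGResult n}
    (h : CGReturns H ε ζr c g M₀ (some r)) (hnc : r.isNC = true) : LowCurv H ε r.dir := by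
  cases h with
  | initial h₀ => exact h₀
  | curvY h₀ hj hy => exact hy
  | solved h₀ hj hy hs => exact absurd hnc (by simp)
  | curvP h₀ hj hy hs hp => exact hp
  | slow h₀ hj hy hs hp hi hc => exact hc

theorem CGReturns.solution (hA : A.IsSymmetric) (hε : 0 < ε) (hM₀ : 0 ≤ M₀) (hζ : 0 < ζr)
    (hζ1 : ζr < 1) (hc : 0 ≤ c) (hg : g ≠ 0) {r : CGResult n}
    (h : CGReturns A ε ζr c g M₀ (some r)) (hnc : r.isNC = false) :
    r.dir ≠ 0 ∧ ε * ‖r.dir‖ ^ 2 ≤ ⟪r.dir, damped A ε r.dir⟫ ∧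
      ⟪damped A ε r.dir + g, r.dir⟫ = 0 ∧ supNorm (damped A ε r.dir + g) ≤ c := by
  cases h with
  | initial h₀ => exact absurd hnc (by simp)
  | curvY h₀ hj hy => exact absurd hnc (by simp)
  | curvP h₀ hj hy hs hp => exact absurd hnc (by simp)
  | slow h₀ hj hy hs hp hi hc => exact absurd hnc (by simp)
  | @solved j h₀ hj hy hs =>
    have hres : damped A ε (cgState A ε g M₀ j).y + g = (cgState A ε g M₀ j).r :=
      ((isCG_cgState A ε g M₀).residual j).symm
    have hb := properties_before_stop (j := j) hε hM₀ hζ hc hg h₀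
      (fun i h1 h2 h3 => absurd (hj.2 ⟨h1, h3⟩) (by omega))
    have hj1 : 1 ≤ j := hj.1.1
    have hpos := curvature_pos hA hε (j := j - 1) (fun i hi => hb.2 i (by omega))
      (fun i hi => hb.1 i (by omega))
    have hM := hM₀.trans (le_cgState_M A ε g M₀ j)
    dsimp only
    refine ⟨?_, not_lowCurv_iff.1 hy, ?_, ?_⟩
    -- For y = 0 the residual would be g itself, which fails the SOL test because ζ̂_r < 1.
    · intro h0
      have h1 := hs.1
      rw [← hres, h0, damped_eq, map_zero, zero_add] at h1
      have := cgZeta_lt_one hM hε hζ1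
      have := norm_pos_iff.2 hg
      nlinarith
    · rw [hres]
      exact (isCG_cgState A ε g M₀).inner_r_y (dampedMap_isSymmetric ε hA) (j := j)
        (fun i hi => hpos i (by omega)) hb.1 le_rfl le_rfl
    · rw [hres]; exact hs.2

/-- Only the slow exit regenerates iterates and costs 2j + 1. The sharper bound for SOL is what the
amortised operation count needs. -/
theorem CGReturns.products_le (hA : A.IsSymmetric) (hε : 0 < ε) (hM₀ : 0 ≤ M₀) (hζ : 0 < ζr)
    (hc : 0 ≤ c) (hg : g ≠ 0) {r : CGResult n} {M : ℝ} {J : ℕ} (hn : 0 < n)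
    (h : CGReturns A ε ζr c g M₀ (some r)) (hM : r.M ≤ M) (hJ1 : 1 ≤ J)
    (hJ : CapIneq M ε ζr c ‖g‖ J) :
    r.products ≤ 2 * min n J + 1 ∧ (r.isNC = false → r.products ≤ min n J + 1) := by
  have key : ¬ LowCurv A ε (-g) → ∀ j, IsLeast {j | 1 ≤ j ∧ CGStops A ε ζr c g M₀ j} j →
      (cgState A ε g M₀ j).M ≤ M → j ≤ min n J := fun h₀ j hj hMj =>
    le_min (stop_le_dim hA hε hM₀ hζ hc hg h₀ hj) (stop_le_cap hε hM₀ hζ hj hMj hJ1 hJ)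
  have h1 : 1 ≤ min n J := le_min hn hJ1
  cases h with
  | initial h₀ => constructor <;> intros <;> dsimp only <;> omega
  | curvY h₀ hj hy =>
    have := key h₀ _ hj hM
    constructor <;> intros <;> dsimp only <;> omega
  | solved h₀ hj hy hs =>
    have := key h₀ _ hj hM
    constructor <;> intros <;> dsimp only <;> omega
  | curvP h₀ hj hy hs hp =>
    have := key h₀ _ hj hM
    constructor <;> intros <;> dsimp only <;> omega
  | slow h₀ hj hy hs hp hi hc =>
    have := key h₀ _ hj hM
    refine ⟨by dsimp only; omega, fun h => by simp at h⟩

end CappedCG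

/-! ### Taylor estimates -/

section Taylor

variable {n : ℕ} {f : Vec n → ℝ} {U : Set (Vec n)} {x s : Vec n} {LH : ℝ}

theorem hasFDerivAt_gradient (hU : IsOpen U) (hf : ContDiffOn ℝ 2 f U) (hx : x ∈ U) :
    HasFDerivAt (gradient f) (hess f x) x := by
  have h1 : DifferentiableAt ℝ (fderiv ℝ f) x :=
    ((hf.contDiffAt (hU.mem_nhds hx)).fderiv_right (m := 1) (by norm_num)).differentiableAt
      (by norm_num)
  -- The inverse Riesz map is conjugate-linear; over ℝ its linearity is recovered by hand, so that
  -- the gradient is a linear image of the derivative.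
  have h2 : IsBoundedLinearMap ℝ (InnerProductSpace.toDual ℝ (Vec n)).symm :=
    IsLinearMap.with_bound ⟨fun a b => map_add _ a b, fun c a => by
      rw [LinearIsometryEquiv.map_smulₛₗ]; simp⟩ 1 fun a => by simp
  exact ((h2.differentiableAt).comp x h1).hasFDerivAt

theorem hasGradientAt_of_contDiffOn (hU : IsOpen U) (hf : ContDiffOn ℝ 2 f U) (hx : x ∈ U) :
    HasGradientAt f (gradient f x) x :=
  ((hf.contDiffAt (hU.mem_nhds hx)).differentiableAt (by norm_num)).hasGradientAt

theorem inner_hess (hU : IsOpen U) (hf : ContDiffOn ℝ 2 f U) (hx : x ∈ U) (v w : Vec n) :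
    ⟪hess f x v, w⟫ = fderiv ℝ (fderiv ℝ f) x v w := by
  have h1 := hasFDerivAt_gradient hU hf hx
  have h2 : fderiv ℝ f = fun y => innerSL ℝ (gradient f y) := by
    funext y; ext z
    simp
  have h3 := ((innerSL ℝ (E := Vec n)).hasFDerivAt (x := gradient f x)).comp x h1
  have h4 : fderiv ℝ (fderiv ℝ f) x = (innerSL ℝ).comp (hess f x) := by
    conv_lhs => rw [h2]
    exact h3.fderiv
  rw [h4]; rfl

theorem hess_isSymmetric (hU : IsOpen U) (hf : ContDiffOn ℝ 2 f U) (hx : x ∈ U) (v w : Vec n) :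
    ⟪hess f x v, w⟫ = ⟪v, hess f x w⟫ := by
  have h := (hf.contDiffAt (hU.mem_nhds hx)).isSymmSndFDerivAt (by simp)
  rw [inner_hess hU hf hx, h v w, ← inner_hess hU hf hx, real_inner_comm]

theorem add_smul_mem_of_segment_subset (hseg : segment ℝ x (x + s) ⊆ U) {t : ℝ}
    (ht : t ∈ Set.Icc (0 : ℝ) 1) : x + t • s ∈ U := by
  apply hseg
  rw [segment_eq_image']
  exact ⟨t, ht, by simp⟩

/-- The derivative in t of the left-hand vector is a Hessian difference applied to s, of norm at
most L_H t ‖s‖²; comparing derivatives on [0, 1] avoids integrals. -/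
theorem norm_gradient_sub_le (hU : IsOpen U) (hf : ContDiffOn ℝ 2 f U)
    (hL : ∀ x ∈ U, ∀ y ∈ U, ‖hess f x - hess f y‖ ≤ LH * ‖x - y‖)
    (hseg : segment ℝ x (x + s) ⊆ U) {t : ℝ} (ht : t ∈ Set.Icc (0 : ℝ) 1) :
    ‖gradient f (x + t • s) - gradient f x - t • hess f x s‖ ≤ LH * ‖s‖ ^ 2 / 2 * t ^ 2 := by
  have hx : x ∈ U := by simpa using add_smul_mem_of_segment_subset hseg (t := 0) (by simp)
  have hd : ∀ u ∈ Set.Icc (0 : ℝ) 1, HasDerivAt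
      (fun u : ℝ => gradient f (x + u • s) - gradient f x - u • hess f x s)
      (hess f (x + u • s) s - hess f x s) u := by
    intro u hu
    have h1 : HasDerivAt (fun u : ℝ => x + u • s) s u := by
      simpa using ((hasDerivAt_id u).smul_const s).const_add x
    have h2 := (hasFDerivAt_gradient hU hf
      (add_smul_mem_of_segment_subset hseg hu)).comp_hasDerivAt u h1
    have h3 : HasDerivAt (fun u : ℝ => u • hess f x s) (hess f x s) u := by
      simpa using (hasDerivAt_id u).smul_const (hess f x s)
    exact (h2.sub_const _).sub h3
  refine image_norm_le_of_norm_deriv_right_le_deriv_boundary'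
    (f := fun u : ℝ => gradient f (x + u • s) - gradient f x - u • hess f x s)
    (B := fun u => LH * ‖s‖ ^ 2 / 2 * u ^ 2) (B' := fun u => LH * ‖s‖ ^ 2 * u)
    (fun u hu => (hd u hu).continuousAt.continuousWithinAt)
    (fun u hu => (hd u ⟨hu.1, hu.2.le⟩).hasDerivWithinAt) (by simp) (by fun_prop)
    (fun u _ => ?_) (fun u hu => ?_) ht
  · exact (((hasDerivAt_pow 2 u).const_mul (LH * ‖s‖ ^ 2 / 2)).congr_deriv
      (by push_cast; ring)).hasDerivWithinAt
  · have hmem := add_smul_mem_of_segment_subset hseg ⟨hu.1, hu.2.le⟩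
    have h1 := hL _ hmem x hx
    rw [add_sub_cancel_left, norm_smul, Real.norm_eq_abs, abs_of_nonneg hu.1] at h1
    have h2 := (hess f (x + u • s) - hess f x).le_opNorm s
    rw [sub_apply] at h2
    calc _ ≤ _ := h2
      _ ≤ LH * (u * ‖s‖) * ‖s‖ := by gcongr
      _ = _ := by ring

/-- Both sides agree at t = 0, and `norm_gradient_sub_le` compares their derivatives. -/
theorem le_taylor_two (hU : IsOpen U) (hf : ContDiffOn ℝ 2 f U)
    (hL : ∀ x ∈ U, ∀ y ∈ U, ‖hess f x - hess f y‖ ≤ LH * ‖x - y‖)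
    (hseg : segment ℝ x (x + s) ⊆ U) {t : ℝ} (ht : t ∈ Set.Icc (0 : ℝ) 1) :
    f (x + t • s) ≤ f x + t * ⟪gradient f x, s⟫ + t ^ 2 / 2 * ⟪s, hess f x s⟫ +
      LH / 6 * t ^ 3 * ‖s‖ ^ 3 := by
  have hd : ∀ u ∈ Set.Icc (0 : ℝ) 1, HasDerivAt (fun u : ℝ => f (x + u • s))
      ⟪gradient f (x + u • s), s⟫ u := by
    intro u hu
    have h1 : HasDerivAt (fun u : ℝ => x + u • s) s u := by
      simpa using ((hasDerivAt_id u).smul_const s).const_add x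
    have h2 := (hasGradientAt_of_contDiffOn hU hf
      (add_smul_mem_of_segment_subset hseg hu)).hasFDerivAt.comp_hasDerivAt u h1
    rw [InnerProductSpace.toDual_apply_apply] at h2
    exact h2
  refine image_le_of_deriv_right_le_deriv_boundary
    (f := fun u : ℝ => f (x + u • s))
    (B := fun u => f x + u * ⟪gradient f x, s⟫ + u ^ 2 / 2 * ⟪s, hess f x s⟫ +
      LH / 6 * u ^ 3 * ‖s‖ ^ 3)
    (B' := fun u => ⟪gradient f x, s⟫ + u * ⟪s, hess f x s⟫ + LH / 2 * u ^ 2 * ‖s‖ ^ 3)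
    (fun u hu => (hd u hu).continuousAt.continuousWithinAt)
    (fun u hu => (hd u ⟨hu.1, hu.2.le⟩).hasDerivWithinAt) (by simp) (by fun_prop)
    (fun u _ => ?_) (fun u hu => ?_) ht
  · have h1 := ((hasDerivAt_id u).mul_const ⟪gradient f x, s⟫).const_add (f x)
    have h2 := ((hasDerivAt_pow 2 u).div_const 2).mul_const ⟪s, hess f x s⟫
    have h3 := ((hasDerivAt_pow 3 u).const_mul (LH / 6)).mul_const (‖s‖ ^ 3)
    exact (((h1.add h2).add h3).congr_deriv (by push_cast; ring)).hasDerivWithinAt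
  · have h1 := norm_gradient_sub_le hU hf hL hseg ⟨hu.1, hu.2.le⟩
    have h2 := real_inner_le_norm (gradient f (x + u • s) - gradient f x - u • hess f x s) s
    rw [inner_sub_left, inner_sub_left, real_inner_smul_left,
      real_inner_comm s (hess f x s)] at h2
    have h3 : ‖gradient f (x + u • s) - gradient f x - u • hess f x s‖ * ‖s‖ ≤
      LH * ‖s‖ ^ 2 / 2 * u ^ 2 * ‖s‖ := by gcongr
    nlinarith

end Taylor

/-- The remainder of the logarithm series after two terms is bounded by a geometric tail. -/
theorem neg_log_one_add_le {b s : ℝ} (hb : b < 1) (hs : |s| ≤ b) :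
    -Real.log (1 + s) ≤ -s + s ^ 2 / 2 + |s| ^ 3 / (1 - b) := by
  have h := Real.abs_log_sub_add_sum_range_le (x := -s) (by rw [abs_neg]; linarith) 2
  simp only [Finset.sum_range_succ, Finset.sum_range_zero, abs_neg, sub_neg_eq_add] at h
  have h1 := (abs_le.1 h).1
  have h2 : |s| ^ (2 + 1) / (1 - |s|) ≤ |s| ^ 3 / (1 - b) := by
    have : 0 < 1 - b := by linarith
    gcongr
  norm_num at h1 h2
  linarith

/-! ### The scaled model of the barrier function -/

theorem inner_eq_sum {n : ℕ} (u v : Vec n) : ⟪u, v⟫ = ∑ i, u i * v i := by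
  simp [PiLp.inner_apply, mul_comm]

theorem norm_sq_eq_sum {n : ℕ} (u : Vec n) : ‖u‖ ^ 2 = ∑ i, u i ^ 2 := by
  rw [EuclideanSpace.norm_sq_eq]; simp

section Model

variable {n : ℕ} {x : Vec n}

theorem xbar_pos (hx : ∀ i, 0 < x i) (i : Fin n) : 0 < xbar x i := lt_min (hx i) one_pos

theorem xbar_le_one (x : Vec n) (i : Fin n) : xbar x i ≤ 1 := min_le_right _ _

theorem ratio_pos (hx : ∀ i, 0 < x i) (i : Fin n) : 0 < xbar x i / x i :=
  div_pos (xbar_pos hx i) (hx i)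

theorem ratio_le_one (hx : ∀ i, 0 < x i) (i : Fin n) : xbar x i / x i ≤ 1 :=
  (div_le_one (hx i)).2 (min_le_left _ _)

theorem norm_le_of_abs_le {u v : Vec n} (h : ∀ i, |u i| ≤ |v i|) : ‖u‖ ≤ ‖v‖ := by
  rw [← sq_le_sq₀ (norm_nonneg _) (norm_nonneg _), norm_sq_eq_sum, norm_sq_eq_sum]
  exact Finset.sum_le_sum fun i _ => sq_le_sq.2 (h i)

theorem norm_diagMul_le {u v : Vec n} (hu : ∀ i, |u i| ≤ 1) : ‖diagMul u v‖ ≤ ‖v‖ := by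
  refine norm_le_of_abs_le fun i => ?_
  change |u i * v i| ≤ _
  rw [abs_mul]
  exact mul_le_of_le_one_left (abs_nonneg _) (hu i)

theorem abs_xbar_le_one (hx : ∀ i, 0 < x i) (i : Fin n) : |xbar x i| ≤ 1 := by
  rw [abs_of_pos (xbar_pos hx i)]; exact xbar_le_one x i

theorem abs_relScale_le (hx : ∀ i, 0 < x i) (v : Vec n) (i : Fin n) :
    |relScale x v i| ≤ |v i| := by
  change |xbar x i / x i * v i| ≤ _
  rw [abs_mul, abs_of_pos (ratio_pos hx i)]
  exact mul_le_of_le_one_left (abs_nonneg _) (ratio_le_one hx i)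

theorem supNorm_relScale_le (hx : ∀ i, 0 < x i) (v : Vec n) : supNorm (relScale x v) ≤ ‖v‖ :=
  (supNorm_le_norm _).trans (norm_le_of_abs_le (abs_relScale_le hx v))

theorem supNorm_nonneg (v : Vec n) : 0 ≤ supNorm v := norm_nonneg _

theorem supNorm_relScale_pos (hx : ∀ i, 0 < x i) {v : Vec n} (hv : v ≠ 0) :
    0 < supNorm (relScale x v) := by
  refine lt_of_le_of_ne (supNorm_nonneg _) fun h => hv ?_
  ext i
  have h1 := abs_le_supNorm (relScale x v) i
  rw [← h] at h1
  have h2 : xbar x i / x i * v i = 0 := abs_nonpos_iff.1 h1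
  exact (mul_eq_zero.1 h2).resolve_left (ratio_pos hx i).ne'

theorem supNorm_relScale_smul (c : ℝ) (v : Vec n) :
    supNorm (relScale x (c • v)) = |c| * supNorm (relScale x v) := by
  have : relScale x (c • v) = c • relScale x v := by
    ext i; change _ * (c * v i) = c * (_ * v i); ring
  rw [this]
  change ‖c • WithLp.ofLp (relScale x v)‖ = _
  rw [norm_smul, Real.norm_eq_abs]; rfl

theorem inner_diagMul (u v w : Vec n) : ⟪diagMul u v, w⟫ = ⟪v, diagMul u w⟫ := by
  simp only [inner_eq_sum, diagMul]
  exact Finset.sum_congr rfl fun i _ => by ring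

variable (f : Vec n → ℝ) (μ : ℝ)

/-- The scaled Hessian as a linear map. -/
noncomputable def scaledHessMap (x : Vec n) : Vec n →ₗ[ℝ] Vec n where
  toFun := scaledHess f μ x
  map_add' u v := by
    have : diagMul (xbar x) (u + v) = diagMul (xbar x) u + diagMul (xbar x) v := by
      ext i; simp [diagMul]; ring
    ext i
    simp only [scaledHess, scaled, this, barrierHess, map_add]
    simp only [diagMul, PiLp.add_apply]
    ring
  map_smul' c v := by
    have : diagMul (xbar x) (c • v) = c • diagMul (xbar x) v := by
      ext i; simp [diagMul]; ring
    ext i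
    simp only [scaledHess, scaled, this, barrierHess, map_smul]
    simp only [diagMul, PiLp.smul_apply, smul_eq_mul, RingHom.id_apply]
    ring

theorem coe_scaledHessMap (x : Vec n) : ⇑(scaledHessMap f μ x) = scaledHess f μ x := rfl

variable {f}

theorem inner_scaledHess (u v : Vec n) :
    ⟪u, scaledHess f μ x v⟫ = ⟪diagMul (xbar x) u, hess f x (diagMul (xbar x) v)⟫ +
      μ * ∑ i, relScale x u i * relScale x v i := by
  rw [scaledHess, scaled, ← inner_diagMul, inner_eq_sum, inner_eq_sum, Finset.mul_sum,
    ← Finset.sum_add_distrib]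
  refine Finset.sum_congr rfl fun i _ => ?_
  simp only [barrierHess, diagMul, relScale]
  ring

theorem inner_scaledGrad (v : Vec n) :
    ⟪scaledGrad f μ x, v⟫ = ⟪gradient f x, diagMul (xbar x) v⟫ - μ * ∑ i, relScale x v i := by
  rw [scaledGrad, inner_diagMul, inner_eq_sum, inner_eq_sum, Finset.mul_sum,
    ← Finset.sum_sub_distrib]
  refine Finset.sum_congr rfl fun i _ => ?_
  simp only [barrierGrad, diagMul, relScale]
  ring

theorem scaledHessMap_isSymmetric {U : Set (Vec n)} (hU : IsOpen U) (hf : ContDiffOn ℝ 2 f U)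
    (hx : x ∈ U) : (scaledHessMap f μ x).IsSymmetric := by
  intro u v
  rw [coe_scaledHessMap, real_inner_comm, inner_scaledHess, inner_scaledHess,
    real_inner_comm, hess_isSymmetric hU hf hx]
  simp only [mul_comm]

/-- A step multiplies each component by 1 + α tᵢ with t = X⁻¹X̄d, so ‖t‖_∞ ≤ β < 1 keeps the iterate
positive and the logarithms expandable. -/
theorem iterate_apply (hx : ∀ i, 0 < x i) (d : Vec n) (α : ℝ) (i : Fin n) :
    (x + α • diagMul (xbar x) d) i = x i * (1 + α * relScale x d i) := by
  have := (hx i).ne'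
  simp only [PiLp.add_apply, PiLp.smul_apply, smul_eq_mul, diagMul, relScale]
  field_simp

/-- The coefficient of the cubic term in the model. -/
noncomputable def cubicCoeff (LH β : ℝ) : ℝ := LH + (2 - β) / (1 - β) ^ 2

variable {μ} {U : Set (Vec n)} {LH β : ℝ} {d : Vec n}

theorem abs_mul_relScale_le (hdβ : supNorm (relScale x d) ≤ β) {α : ℝ}
    (hα : α ∈ Set.Icc (0 : ℝ) 1) (i : Fin n) : |α * relScale x d i| ≤ β := by
  rw [abs_mul, abs_of_nonneg hα.1]
  have h1 := (abs_le_supNorm (relScale x d) i).trans hdβ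
  nlinarith [hα.1, hα.2, abs_nonneg (relScale x d i)]

theorem iterate_pos (hx : ∀ i, 0 < x i) (hβ1 : β < 1) (hdβ : supNorm (relScale x d) ≤ β) {α : ℝ}
    (hα : α ∈ Set.Icc (0 : ℝ) 1) (i : Fin n) : 0 < (x + α • diagMul (xbar x) d) i := by
  rw [iterate_apply hx]
  have := (abs_le.1 (abs_mul_relScale_le hdβ hα i)).1
  exact mul_pos (hx i) (by linarith)

/-- The cubic Taylor bound for f is added to the expansions of log (1 + α tᵢ). Their remainders sum
to a multiple of ‖d‖³ because |tᵢ|³ ≤ |dᵢ|³ ≤ ‖d‖ dᵢ². -/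
theorem barrier_step_le (hU : IsOpen U) (hf : ContDiffOn ℝ 2 f U)
    (hL : ∀ x ∈ U, ∀ y ∈ U, ‖hess f x - hess f y‖ ≤ LH * ‖x - y‖) (hLH : 0 < LH)
    (hseg : segment ℝ x (x + diagMul (xbar x) d) ⊆ U) (hx : ∀ i, 0 < x i) (hμ0 : 0 ≤ μ)
    (hμ : μ ≤ 1 / 4) (hβ0 : 0 < β) (hβ1 : β < 1) (hdβ : supNorm (relScale x d) ≤ β) {α : ℝ}
    (hα : α ∈ Set.Icc (0 : ℝ) 1) :
    barrier f μ (x + α • diagMul (xbar x) d) ≤ barrier f μ x + α * ⟪scaledGrad f μ x, d⟫ +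
      α ^ 2 / 2 * ⟪d, scaledHess f μ x d⟫ + cubicCoeff LH β / 6 * α ^ 3 * ‖d‖ ^ 3 := by
  have h1 := le_taylor_two hU hf hL hseg hα
  have hn : ‖diagMul (xbar x) d‖ ≤ ‖d‖ := norm_diagMul_le (abs_xbar_le_one hx)
  have hα0 := hα.1
  have hlog : ∀ i, -Real.log ((x + α • diagMul (xbar x) d) i) ≤ -Real.log (x i) -
      α * relScale x d i + α ^ 2 / 2 * (relScale x d i * relScale x d i) +
      α ^ 3 * (‖d‖ * d i ^ 2) / (1 - β) := by
    intro i
    have hb := abs_mul_relScale_le hdβ hα i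
    have hb1 := (abs_le.1 hb).1
    rw [iterate_apply hx, Real.log_mul (hx i).ne' (by linarith)]
    have h2 := neg_log_one_add_le hβ1 hb
    have h3 : |α * relScale x d i| ^ 3 / (1 - β) ≤ α ^ 3 * (‖d‖ * d i ^ 2) / (1 - β) := by
      have : 0 < 1 - β := by linarith
      have h4 := abs_relScale_le hx d i
      have h5 : |d i| ≤ ‖d‖ := (abs_le_supNorm d i).trans (supNorm_le_norm d)
      have h6 : |relScale x d i| ^ 3 ≤ ‖d‖ * d i ^ 2 := by
        calc |relScale x d i| ^ 3 ≤ |d i| ^ 3 := by gcongr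
          _ = |d i| * d i ^ 2 := by rw [pow_succ', sq_abs]
          _ ≤ _ := by gcongr
      rw [abs_mul, mul_pow, abs_of_nonneg hα0]
      gcongr
    nlinarith
  have hsum := Finset.sum_le_sum fun i (_ : i ∈ Finset.univ) => hlog i
  simp only [Finset.sum_add_distrib, Finset.sum_sub_distrib, Finset.sum_neg_distrib,
    ← Finset.mul_sum, ← Finset.sum_div, ← norm_sq_eq_sum] at hsum
  have hsum' := mul_le_mul_of_nonneg_left hsum hμ0
  have hu : 0 < 1 - β := by linarith
  -- With μ ≤ 1/4 one has 6μ(1 - β) ≤ 2 - β, so the logarithmic remainder fits into the second part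
  -- of `cubicCoeff`.
  have hcub : μ * (α ^ 3 * (‖d‖ * ‖d‖ ^ 2) / (1 - β)) ≤
      (2 - β) / (1 - β) ^ 2 / 6 * α ^ 3 * ‖d‖ ^ 3 := by
    have e : μ * (α ^ 3 * (‖d‖ * ‖d‖ ^ 2) / (1 - β)) = μ / (1 - β) * (α ^ 3 * ‖d‖ ^ 3) := by
      field_simp
    rw [e, mul_assoc]
    refine mul_le_mul_of_nonneg_right ?_ (by positivity)
    rw [div_div, div_le_div_iff₀ hu (by positivity)]
    nlinarith
  have hcub2 : LH / 6 * α ^ 3 * ‖diagMul (xbar x) d‖ ^ 3 ≤ LH / 6 * α ^ 3 * ‖d‖ ^ 3 := by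
    gcongr
  rw [inner_scaledGrad, inner_scaledHess, barrier, barrier, cubicCoeff]
  nlinarith

end Model

/-! ### Constants -/

section Constants

variable {p : Params} {LH : ℝ}

theorem cubicCoeff_add_pos (hp : p.Valid) (hLH : 0 < LH) : 0 < cubicCoeff LH p.β + p.η := by
  have h1 := hp.β_mem.2
  have h2 := hp.η_mem.1
  have : 0 < 1 - p.β := by linarith
  have : 0 < 2 - p.β := by linarith
  unfold cubicCoeff
  positivity

theorem cubicCoeff_add_eq (hp : p.Valid) (LH : ℝ) :
    (LH + p.η) * (1 - p.β) ^ 2 + (2 - p.β) = (cubicCoeff LH p.β + p.η) * (1 - p.β) ^ 2 := by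
  have : 1 - p.β ≠ 0 := by linarith [hp.β_mem.2]
  unfold cubicCoeff
  field_simp
  ring

/-- Cancelling (1 - β)² exhibits the constants of the statement as line-search thresholds, with
denominator C + η for the cubic coefficient C. -/
theorem div_cubicCoeff (hp : p.Valid) (LH a : ℝ) (ha : 0 < cubicCoeff LH p.β + p.η) :
    a * (1 - p.β) ^ 2 / ((LH + p.η) * (1 - p.β) ^ 2 + (2 - p.β)) =
      a / (cubicCoeff LH p.β + p.η) := by
  have : 1 - p.β ≠ 0 := by linarith [hp.β_mem.2]
  rw [cubicCoeff_add_eq hp]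
  field_simp

theorem cNc_eq (hp : p.Valid) (hLH : 0 < LH) :
    cNc p LH = min 1 (3 * p.θ / (cubicCoeff LH p.β + p.η)) := by
  rw [cNc, ← div_cubicCoeff hp LH _ (cubicCoeff_add_pos hp hLH)]
  ring_nf

theorem cSol_eq (hp : p.Valid) (hLH : 0 < LH) :
    cSol p LH = min (cD p LH) (6 * p.θ ^ 2 / (cubicCoeff LH p.β + p.η)) := by
  rw [cSol, ← div_cubicCoeff hp LH _ (cubicCoeff_add_pos hp hLH)]
  ring_nf

theorem cD_pos (hp : p.Valid) (hLH : 0 < LH) : 0 < cD p LH := by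
  have h1 := hp.ζbar_mem.2
  have h2 := hp.ζr_mem.1
  have : 0 < 1 - p.ζbar := by linarith
  unfold cD
  refine lt_min (by positivity) (lt_min (by positivity) (by positivity))

theorem cAll_pos (hp : p.Valid) (hLH : 0 < LH) : 0 < cAll p LH := by
  have h1 := cubicCoeff_add_pos hp hLH
  have h2 := hp.θ_mem.1
  have h3 := cD_pos hp hLH
  rw [cAll, cNc_eq hp hLH, cSol_eq hp hLH]
  exact lt_min (lt_min h3 (by positivity)) (lt_min one_pos (by positivity))

theorem cAll_le_one : cAll p LH ≤ 1 := (min_le_right _ _).trans (min_le_left _ _)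

theorem cAll_le_cD : cAll p LH ≤ cD p LH := (min_le_left _ _).trans (min_le_left _ _)

theorem nine_mul_cD_le : 9 * cD p LH ≤ 1 - p.ζbar := by
  have : cD p LH ≤ (1 - p.ζbar) / 9 := min_le_left _ _
  linarith

theorem cD_mul_le (hp : p.Valid) (hLH : 0 < LH) : cD p LH * LH ≤ 1 / 2 := by
  have h1 : cD p LH ≤ 1 / (2 * (LH + 9 / 2 + p.ζr)) := (min_le_right _ _).trans (min_le_right _ _)
  have h2 := hp.ζr_mem.1
  rw [le_div_iff₀ (by positivity)] at h1
  nlinarith [cD_pos hp hLH]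

end Constants

/-! ### Directions of negative curvature -/

section Direction

variable {n : ℕ} {x : Vec n}

/-- The first entry of the minimum makes the curvature along d at most -‖d‖³, the second keeps the
step inside the orthant. Either choice leaves ‖d‖ ≥ m: one by the curvature bound, the other because
‖X⁻¹X̄v‖_∞ ≤ ‖v‖ and m ≤ β. -/
theorem negativeCurvature_direction (hx : ∀ i, 0 < x i) {H : Vec n →ₗ[ℝ] Vec n}
    {g v d : Vec n} {β σ m : ℝ} (hv : v ≠ 0) (hβ : 0 < β)
    (hσ : IsSign σ ⟪g, v⟫) (hm : 0 < m) (hmβ : m ≤ β) (hcurv : ⟪v, H v⟫ ≤ -(m * ‖v‖ ^ 2))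
    (hd : d = (-σ * min (|⟪v, H v⟫| / ‖v‖ ^ 3) (β / supNorm (relScale x v))) • v) :
    ⟪g, d⟫ ≤ 0 ∧ ⟪d, H d⟫ ≤ -‖d‖ ^ 3 ∧ supNorm (relScale x d) ≤ β ∧ m ≤ ‖d‖ := by
  have hvn : 0 < ‖v‖ := norm_pos_iff.2 hv
  have hrs := supNorm_relScale_pos hx hv
  have hlam : 0 < -⟪v, H v⟫ := by
    have : 0 < m * ‖v‖ ^ 2 := by positivity
    linarith
  have habs : |⟪v, H v⟫| = -⟪v, H v⟫ := abs_of_neg (by linarith)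
  rw [habs] at hd
  set c := min (-⟪v, H v⟫ / ‖v‖ ^ 3) (β / supNorm (relScale x v)) with hc
  have hc0 : 0 < c := lt_min (by positivity) (by positivity)
  have hσ2 : σ ^ 2 = 1 := by rcases hσ.1 with h | h <;> rw [h] <;> norm_num
  have hσa : |σ| = 1 := by rcases hσ.1 with h | h <;> rw [h] <;> norm_num
  have hca : |-σ * c| = c := by rw [abs_mul, abs_neg, hσa, one_mul, abs_of_pos hc0]
  have hdn : ‖d‖ = c * ‖v‖ := by rw [hd, norm_smul, Real.norm_eq_abs, hca]
  refine ⟨?_, ?_, ?_, ?_⟩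
  · rw [hd, real_inner_smul_right]
    have := hσ.2
    have h2 := abs_nonneg ⟪g, v⟫
    rw [← this] at h2
    nlinarith
  · have e : ⟪d, H d⟫ = c ^ 2 * ⟪v, H v⟫ := by
      rw [hd, map_smul, real_inner_smul_left, real_inner_smul_right]
      linear_combination c ^ 2 * ⟪v, H v⟫ * hσ2
    have h1 : c ≤ -⟪v, H v⟫ / ‖v‖ ^ 3 := min_le_left _ _
    rw [le_div_iff₀ (by positivity)] at h1
    rw [e, hdn, mul_pow]
    nlinarith [sq_nonneg c]
  · have h1 : c ≤ β / supNorm (relScale x v) := min_le_right _ _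
    rw [hd, supNorm_relScale_smul, hca]
    rwa [le_div_iff₀ hrs] at h1
  · rw [hdn, ← div_le_iff₀ hvn]
    refine le_min ?_ ?_
    · rw [div_le_div_iff₀ hvn (by positivity)]
      nlinarith
    · rw [div_le_div_iff₀ hvn hrs]
      have := supNorm_relScale_le hx v
      nlinarith

end Direction

/-! ### The line search -/

section LineSearch

variable {n : ℕ} {f : Vec n → ℝ} {μ η θ : ℝ} {x d : Vec n} {s : Status n}

/-- If the first trial step is rejected, the trial before the accepted one failed, so it was at
least α₀ and the accepted one is at least θ α₀. -/
theorem LineSearch.exists_step (h : LineSearch f μ η θ x d s) (hθ : θ ∈ Set.Ioo (0 : ℝ) 1) {α₀ : ℝ}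
    (hα₀ : 0 < α₀) (hs : ∀ α, 0 < α → α ≤ 1 → α < α₀ → SuffDecrease f μ η x d α) :
    ∃ α, 0 < α ∧ α ≤ 1 ∧ s = .active (x + α • diagMul (xbar x) d) ∧
      SuffDecrease f μ η x d α ∧ (α = 1 ∨ θ * α₀ ≤ α) := by
  have hpos : ∀ j : ℕ, 0 < θ ^ j := fun j => pow_pos hθ.1 j
  have hle : ∀ j : ℕ, θ ^ j ≤ 1 := fun j => pow_le_one₀ hθ.1.le hθ.2.le
  cases h with
  | @accept j hj =>
    refine ⟨θ ^ j, hpos j, hle j, rfl, hj.1, ?_⟩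
    cases j with
    | zero => left; simp
    | succ k =>
      right
      have : ¬ SuffDecrease f μ η x d (θ ^ k) := fun hk => absurd (hj.2 hk) (by omega)
      have h2 : α₀ ≤ θ ^ k := by
        by_contra! h3
        exact this (hs _ (hpos k) (hle k) h3)
      rw [pow_succ']
      exact mul_le_mul_of_nonneg_left h2 hθ.1.le
  | fail h =>
    obtain ⟨j, hj⟩ := exists_pow_lt_of_lt_one hα₀ hθ.2
    exact absurd (hs _ (hpos j) (hle j) hj) (h j)

variable {C a b : ℝ}

/-- The quadratic term -α²‖d‖³/2 beats the cubic terms (C + η) α³‖d‖³/6 exactly for α < 3/(C + η).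
-/
theorem LineSearch.step_of_negativeCurvature (h : LineSearch f μ η θ x d s)
    (hθ : θ ∈ Set.Ioo (0 : ℝ) 1) (hC : 0 < C + η) (hd : d ≠ 0) (ha : a ≤ 0) (hb : b ≤ -‖d‖ ^ 3)
    (hmodel : ∀ α ∈ Set.Icc (0 : ℝ) 1, barrier f μ (x + α • diagMul (xbar x) d) ≤
      barrier f μ x + α * a + α ^ 2 / 2 * b + C / 6 * α ^ 3 * ‖d‖ ^ 3) :
    ∃ α, 0 < α ∧ α ≤ 1 ∧ s = .active (x + α • diagMul (xbar x) d) ∧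
      SuffDecrease f μ η x d α ∧ min 1 (3 * θ / (C + η)) ≤ α := by
  have hs : ∀ α, 0 < α → α ≤ 1 → α < 3 / (C + η) → SuffDecrease f μ η x d α := by
    intro α h0 h1 h2
    rw [lt_div_iff₀ hC] at h2
    have hdn : 0 < ‖d‖ ^ 3 := pow_pos (norm_pos_iff.2 hd) 3
    have h3 := hmodel α ⟨h0.le, h1⟩
    have h4 : 0 < α ^ 2 * ‖d‖ ^ 3 := by positivity
    have h5 : α ^ 2 / 2 * b ≤ α ^ 2 / 2 * (-‖d‖ ^ 3) := by gcongr
    have h6 : α * a ≤ 0 := mul_nonpos_of_nonneg_of_nonpos h0.le ha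
    have h7 : α * (C + η) * (α ^ 2 * ‖d‖ ^ 3) < 3 * (α ^ 2 * ‖d‖ ^ 3) := by gcongr
    rw [SuffDecrease]
    nlinarith
  obtain ⟨α, h0, h1, h2, h3, h4⟩ := h.exists_step hθ (by positivity) hs
  refine ⟨α, h0, h1, h2, h3, ?_⟩
  rcases h4 with h4 | h4
  · exact (min_le_left _ _).trans h4.ge
  · refine (min_le_right _ _).trans (le_trans (le_of_eq ?_) h4)
    ring

/-- The decrease αε‖d‖²/2 beats the cubic terms as long as (C + η) α²‖d‖ < 3ε. -/
theorem LineSearch.step_of_solution (h : LineSearch f μ η θ x d s)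
    (hθ : θ ∈ Set.Ioo (0 : ℝ) 1) (hC : 0 < C + η) (hd : d ≠ 0) {ε : ℝ} (hε : 0 < ε)
    (hab : ∀ α ∈ Set.Icc (0 : ℝ) 1, a + α / 2 * b ≤ -(ε / 2 * ‖d‖ ^ 2))
    (hmodel : ∀ α ∈ Set.Icc (0 : ℝ) 1, barrier f μ (x + α • diagMul (xbar x) d) ≤
      barrier f μ x + α * a + α ^ 2 / 2 * b + C / 6 * α ^ 3 * ‖d‖ ^ 3) :
    ∃ α, 0 < α ∧ α ≤ 1 ∧ s = .active (x + α • diagMul (xbar x) d) ∧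
      SuffDecrease f μ η x d α ∧ (α = 1 ∨ 3 * θ ^ 2 / (C + η) * ε ≤ α * ‖d‖) := by
  have hdn : 0 < ‖d‖ := norm_pos_iff.2 hd
  have hq : 0 < 3 * ε / ((C + η) * ‖d‖) := by positivity
  have hs : ∀ α, 0 < α → α ≤ 1 → α < √(3 * ε / ((C + η) * ‖d‖)) →
      SuffDecrease f μ η x d α := by
    intro α h0 h1 h2
    rw [Real.lt_sqrt h0.le, lt_div_iff₀ (by positivity)] at h2
    have h3 := hmodel α ⟨h0.le, h1⟩
    have h4 := mul_le_mul_of_nonneg_left (hab α ⟨h0.le, h1⟩) h0.le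
    have h5 : 0 < α * ‖d‖ ^ 2 := by positivity
    have h6 : α ^ 2 * ((C + η) * ‖d‖) * (α * ‖d‖ ^ 2) < 3 * ε * (α * ‖d‖ ^ 2) := by gcongr
    rw [SuffDecrease]
    nlinarith
  obtain ⟨α, h0, h1, h2, h3, h4⟩ := h.exists_step hθ (Real.sqrt_pos.2 hq) hs
  refine ⟨α, h0, h1, h2, h3, h4.imp_right fun h4 => ?_⟩
  -- A bound for α²‖d‖ suffices, since α ≤ 1 makes it one for α‖d‖.
  have h5 : (θ * √(3 * ε / ((C + η) * ‖d‖))) ^ 2 ≤ α ^ 2 := by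
    have := hθ.1
    gcongr
  rw [mul_pow, Real.sq_sqrt hq.le] at h5
  calc 3 * θ ^ 2 / (C + η) * ε = θ ^ 2 * (3 * ε / ((C + η) * ‖d‖)) * ‖d‖ := by field_simp
    _ ≤ α ^ 2 * ‖d‖ := by gcongr
    _ ≤ α * ‖d‖ := by gcongr; nlinarith

end LineSearch

/-! ### Stationarity -/

section Stationarity

variable {n : ℕ} {f : Vec n → ℝ} {x d : Vec n} {εg : ℝ}

/-- At a critical point of φ_μ, ∇f = μX⁻¹e is positive and X̄∇f ≤ μe, so neither reason for calling
capped CG can hold. This excludes the degenerate right-hand side g = 0. -/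
theorem scaledGrad_ne_zero (hx : ∀ i, 0 < x i) (hε : 0 < εg) (h : NeedsCG f εg x) :
    scaledGrad f (εg / 4) x ≠ 0 := by
  intro h0
  have hG : ∀ i, gradient f x i = εg / 4 / x i := by
    intro i
    have h1 : xbar x i * (gradient f x i - εg / 4 / x i) = 0 := congrArg (fun v : Vec n => v i) h0
    have := (mul_eq_zero.1 h1).resolve_left (xbar_pos hx i).ne'
    linarith
  rcases h with ⟨i, hi⟩ | h
  · have h1 := hG i
    have : 0 < εg / 4 / x i := div_pos (by linarith) (hx i)
    linarith
  · have : supNorm (diagMul (xbar x) (gradient f x)) ≤ εg / 4 := by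
      refine supNorm_le (by linarith) fun i => ?_
      have e : diagMul (xbar x) (gradient f x) i = xbar x i / x i * (εg / 4) := by
        change xbar x i * gradient f x i = _
        rw [hG i]; ring
      have h1 := ratio_pos hx i
      have h2 := ratio_le_one hx i
      rw [e, abs_of_nonneg (by positivity)]
      nlinarith
    linarith

theorem firstOrder_of_not_needsCG (hx : ∀ i, 0 < x i) (h : ¬ NeedsCG f εg x) :
    FirstOrder f εg x := by
  simp only [NeedsCG, not_or, not_exists, not_le, not_lt] at h
  exact ⟨hx, fun i => (h.1 i).le, h.2⟩

/-- One component, with μ = ε²/4: G is the new and g the old derivative, q the Hessian term. For x ≥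
1 a bound on x̄G bounds G directly. For x < 1 the factor x̄ may be tiny, and the sharper bound -cμ
is obtained by keeping x̄ in the error term. -/
theorem scalar_stationarity {ε c ζ β x d g q G : ℝ} (hε : 0 < ε) (hε1 : ε < 1) (hβ1 : β < 1)
    (hc : 0 < c) (hcζ : 9 * c ≤ 1 - ζ) (hx : 0 < x)
    (hr : |min x 1 * (q + ε ^ 2 / 4 / x ^ 2 * (min x 1 * d)) + 2 * ε * d +
      min x 1 * (g - ε ^ 2 / 4 / x)| ≤ ζ * (ε ^ 2 / 4))
    (he : |G - g - q| ≤ c * (ε ^ 2 / 4)) (hd : |d| ≤ c * ε) (ht : |min x 1 / x * d| ≤ β) :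
    -(c * (ε ^ 2 / 4)) ≤ G ∧ -(ε ^ 2 / 4) ≤ min x 1 * G ∧ min x 1 * G ≤ 3 * (ε ^ 2 / 4) ∨
      -(ε ^ 2 / 4) ≤ G ∧ -(ε ^ 2 / 4) ≤ min x 1 * G ∧ min x 1 * G ≤ 3 * (ε ^ 2 / 4) := by
  have h8 : |2 * ε * d| ≤ 8 * c * (ε ^ 2 / 4) := by
    rw [abs_mul, abs_of_pos (by positivity : 0 < 2 * ε)]
    nlinarith
  have hdc : d ≤ c := by nlinarith [le_abs_self d]
  have hμ0 : 0 < ε ^ 2 / 4 := by positivity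
  set μ := ε ^ 2 / 4
  have hb0 : 0 < min x 1 := lt_min hx one_pos
  have hb1 : min x 1 ≤ 1 := min_le_right _ _
  have hρ0 : 0 < min x 1 / x := div_pos hb0 hx
  have hρ1 : min x 1 / x ≤ 1 := (div_le_one hx).2 (min_le_left _ _)
  set r := min x 1 * (q + μ / x ^ 2 * (min x 1 * d)) + 2 * ε * d + min x 1 * (g - μ / x) with hrdef
  set e := G - g - q with hedef
  set t := min x 1 / x * d with htdef
  -- The residual equation solved for x̄G, with ρ = x̄/x: the barrier contributes μρ(1 - t), which
  -- lies between 0 and 2μ.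
  have hid : min x 1 * G = r - μ * (min x 1 / x) * t - 2 * ε * d + μ * (min x 1 / x) +
      min x 1 * e := by
    rw [hrdef, hedef, htdef]
    field_simp
    ring
  obtain ⟨hr1, hr2⟩ := abs_le.1 hr
  obtain ⟨he1, he2⟩ := abs_le.1 he
  obtain ⟨ht1, ht2⟩ := abs_le.1 ht
  obtain ⟨h81, h82⟩ := abs_le.1 h8
  clear_value r e
  have hcμ : 0 < c * μ := mul_pos hc hμ0
  have hbe1 : min x 1 * e ≤ c * μ := by nlinarith
  have hbe2 : -(min x 1 * (c * μ)) ≤ min x 1 * e := by nlinarith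
  have hbe3 : -(c * μ) ≤ min x 1 * e := by nlinarith
  have hρt : 0 ≤ μ * (min x 1 / x) * (1 - t) := mul_nonneg (by positivity) (by linarith)
  have hρt2 : μ * (min x 1 / x) * (1 - t) ≤ 2 * μ := by
    have h1 : min x 1 / x * (1 - t) ≤ 1 * 2 :=
      mul_le_mul hρ1 (by linarith) (by linarith) zero_le_one
    nlinarith
  have h9 : 9 * c * μ ≤ (1 - ζ) * μ := by gcongr
  have hlow : -μ ≤ min x 1 * G := by linarith only [hid, hρt, hr1, h82, hbe3, h9]
  have hup : min x 1 * G ≤ 3 * μ := by linarith only [hid, hρt2, hr2, h81, hbe1, h9]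
  rcases le_or_gt 1 x with h1 | h1
  · right
    refine ⟨?_, hlow, hup⟩
    rwa [min_eq_right h1, one_mul] at hlow
  · left
    have hb : min x 1 = x := min_eq_left h1.le
    have hρ' : min x 1 / x = 1 := by rw [hb, div_self hx.ne']
    refine ⟨?_, hlow, hup⟩
    have h2 : μ * t ≤ c * μ := by
      rw [htdef, hρ', one_mul, mul_comm c]
      exact mul_le_mul_of_nonneg_left hdc hμ0.le
    rw [hρ'] at hid
    -- With ρ = 1 all terms but x̄e add up to at least μ(1 - ζ - 9c) ≥ 0; what remains is
    -- proportional to x̄, which can be cancelled.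
    have h3 : min x 1 * -(c * μ) ≤ min x 1 * G := by
      linarith only [hid, h2, hr1, h82, hbe2, h9]
    exact le_of_mul_le_mul_left h3 hb0

/-- After a short step towards an approximate minimizer of the damped model, the point is
approximately stationary. -/
theorem not_needsCG_of_short_step {U : Set (Vec n)} {LH ε c ζ β : ℝ} (hU : IsOpen U)
    (hf : ContDiffOn ℝ 2 f U)
    (hL : ∀ x ∈ U, ∀ y ∈ U, ‖hess f x - hess f y‖ ≤ LH * ‖x - y‖) (hLH : 0 < LH)
    (hseg : segment ℝ x (x + diagMul (xbar x) d) ⊆ U) (hx : ∀ i, 0 < x i) (hε : 0 < ε)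
    (hε1 : ε < 1) (hβ1 : β < 1) (hζ : 0 < ζ) (hc : 0 < c) (hcζ : 9 * c ≤ 1 - ζ)
    (hcL : c * LH ≤ 1 / 2)
    (hdβ : supNorm (relScale x d) ≤ β) (hdc : ‖d‖ ≤ c * ε)
    (hres : supNorm (damped (scaledHess f (ε ^ 2 / 4) x) ε d + scaledGrad f (ε ^ 2 / 4) x) ≤
      ζ * (ε ^ 2 / 4)) :
    ¬ NeedsCG f (ε ^ 2) (x + diagMul (xbar x) d) := by
  set μ := ε ^ 2 / 4 with hμ
  have hμ0 : 0 < μ := by positivity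
  set G := gradient f (x + diagMul (xbar x) d) with hG
  have hT := norm_gradient_sub_le hU hf hL hseg (t := 1) (by simp)
  rw [one_smul, one_smul, one_pow, mul_one] at hT
  set e := G - gradient f x - hess f x (diagMul (xbar x) d) with he
  -- The Taylor remainder L_H (cε)²/2 is at most cμ because c L_H ≤ 1/2.
  have hen : ‖e‖ ≤ c * μ := by
    have h1 : ‖diagMul (xbar x) d‖ ≤ c * ε :=
      (norm_diagMul_le (abs_xbar_le_one hx)).trans hdc
    calc ‖e‖ ≤ LH * ‖diagMul (xbar x) d‖ ^ 2 / 2 := hT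
      _ ≤ LH * (c * ε) ^ 2 / 2 := by gcongr
      _ = (c * LH) * (c * ε ^ 2 / 2) := by ring
      _ ≤ 1 / 2 * (c * ε ^ 2 / 2) := by gcongr
      _ = c * μ := by rw [hμ]; ring
  have key : ∀ i, -(c * μ) ≤ G i ∧ -μ ≤ xbar x i * G i ∧ xbar x i * G i ≤ 3 * μ ∨
      -μ ≤ G i ∧ -μ ≤ xbar x i * G i ∧ xbar x i * G i ≤ 3 * μ := by
    intro i
    have hr := (abs_le_supNorm _ i).trans hres
    have hei := ((abs_le_supNorm e i).trans (supNorm_le_norm e)).trans hen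
    have hdi := ((abs_le_supNorm d i).trans (supNorm_le_norm d)).trans hdc
    have hti := (abs_le_supNorm _ i).trans hdβ
    refine scalar_stationarity (x := x i) (d := d i) (g := gradient f x i)
      (q := hess f x (diagMul (xbar x) d) i) hε hε1 hβ1 hc hcζ (hx i) hr hei hdi hti
  have hc9 : c ≤ 1 / 9 := by linarith
  simp only [NeedsCG, not_or, not_exists, not_le, not_lt]
  constructor
  · intro i
    have h4 : ε ^ 2 = 4 * μ := by rw [hμ]; ring
    rw [h4]
    rcases key i with h | h
    · have := h.1
      nlinarith
    · linarith [h.1]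
  · refine supNorm_le (by positivity) fun i => ?_
    have h3 : |xbar x i * G i| ≤ 3 * μ := by
      rcases key i with h | h <;> exact abs_le.2 ⟨by linarith, by linarith⟩
    have hdi := ((abs_le_supNorm d i).trans (supNorm_le_norm d)).trans hdc
    have hx' : (x + diagMul (xbar x) d) i = x i + xbar x i * d i := rfl
    have hb0 := xbar_pos hx i
    have hb1 := xbar_le_one x i
    have hpos := iterate_pos hx hβ1 hdβ (α := 1) (by simp) i
    rw [one_smul] at hpos
    have hdc1 : |d i| ≤ c := by nlinarith
    -- The weights x̄ change with the point, by a factor of at most 1 + c ≤ 10/9, and 3μ · 10/9 is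
    -- still below 4μ = ε².
    have hbar : xbar (x + diagMul (xbar x) d) i ≤ xbar x i * (1 + c) := by
      have h2 := le_abs_self (d i)
      rcases le_or_gt 1 (x i) with h1 | h1
      · have hb : xbar x i = 1 := min_eq_right h1
        rw [hb]
        exact (min_le_right _ _).trans (by linarith)
      · have hb : xbar x i = x i := min_eq_left h1.le
        refine (min_le_left _ _).trans ?_
        rw [hx', hb]
        nlinarith [hx i]
    have hbar0 : 0 < xbar (x + diagMul (xbar x) d) i := lt_min hpos one_pos
    change |xbar (x + diagMul (xbar x) d) i * G i| ≤ ε ^ 2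
    rw [abs_mul, abs_of_pos hbar0]
    rw [abs_mul, abs_of_pos hb0] at h3
    calc _ ≤ xbar x i * (1 + c) * |G i| := by gcongr
      _ = (1 + c) * (xbar x i * |G i|) := by ring
      _ ≤ (1 + 1 / 9) * (3 * μ) := by gcongr
      _ ≤ ε ^ 2 := by rw [hμ]; nlinarith

end Stationarity

/-! ### One iteration -/

section OneIteration

variable {n : ℕ} {f : Vec n → ℝ} {p : Params} {εg Mhat LH : ℝ} {x : Vec n} {U : Set (Vec n)}
  {cg : Option (CGResult n)} {a : MeoAnswer n} {dir : Option (Vec n)} {s : Status n}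

theorem Iteration.exists_cgReturns (h : Iteration f p εg Mhat x cg a dir s) (hp : p.Valid)
    (hε : 0 < εg) (hM : 0 ≤ Mhat) (hU : IsOpen U) (hf : ContDiffOn ℝ 2 f U) (hxU : x ∈ U)
    (hx : ∀ i, 0 < x i) (hn : NeedsCG f εg x) :
    ∃ r d, cg = some r ∧ dir = some d ∧
      CGReturns (scaledHessMap f (εg / 4) x) (√εg) p.ζr (p.ζbar * (εg / 4))
        (scaledGrad f (εg / 4) x) (Mhat + εg / 4) (some r) ∧
      CGDirection f (εg / 4) p.β x r d ∧ LineSearch f (εg / 4) p.η p.θ x d s := by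
  cases h with
  | cgBreakdown h hc =>
    refine absurd hc (not_cgReturns_none (A := scaledHessMap f (εg / 4) x)
      (scaledHessMap_isSymmetric _ hU hf hxU) (Real.sqrt_pos.2 hε) (by linarith) hp.ζr_mem.1 ?_
      (scaledGrad_ne_zero hx hε hn))
    have := hp.ζbar_mem.1
    positivity
  | cgStep h hc hd hs => exact ⟨_, _, rfl, rfl, hc, hd, hs⟩
  | certified h ha => exact absurd hn h
  | meoStep h ha hd hs => exact absurd hn h

theorem Iteration.products_le (h : Iteration f p εg Mhat x cg a dir s) (hp : p.Valid)
    (hε : 0 < εg) (hM : 0 ≤ Mhat) (hU : IsOpen U) (hf : ContDiffOn ℝ 2 f U) (hxU : x ∈ U)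
    (hx : ∀ i, 0 < x i) (hn : NeedsCG f εg x) (hn0 : 0 < n) {B : ℝ} {J : ℕ}
    (hB : ∀ r, cg = some r → r.M ≤ B)
    (hJ : CapIneq B √εg p.ζr (p.ζbar * (εg / 4)) ‖scaledGrad f (εg / 4) x‖ J) :
    1 ≤ J ∧ cg.elim 0 CGResult.products ≤ 2 * min n J + 1 ∧
      ((∃ r, cg = some r ∧ r.isNC = false) → cg.elim 0 CGResult.products ≤ min n J + 1) := by
  obtain ⟨r, d, rfl, rfl, hc, hd, hs⟩ := h.exists_cgReturns hp hε hM hU hf hxU hx hn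
  have hg := scaledGrad_ne_zero hx hε hn
  have hε' := Real.sqrt_pos.2 hε
  have hc0 : 0 ≤ p.ζbar * (εg / 4) := by
    have := hp.ζbar_mem.1
    positivity
  have hM' : 0 ≤ Mhat + εg / 4 := by linarith
  have hBr := hB r rfl
  have hB0 : Mhat + εg / 4 ≤ r.M := by
    cases hc with
    | initial h₀ => exact le_rfl
    | curvY h₀ hj hy => exact le_cgState_M _ _ _ _ _
    | solved h₀ hj hy hs => exact le_cgState_M _ _ _ _ _
    | curvP h₀ hj hy hs hp => exact le_cgState_M _ _ _ _ _
    | slow h₀ hj hy hs hp hi hc => exact le_cgState_M _ _ _ _ _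
  have hJ1 : 1 ≤ J := by
    rcases Nat.eq_zero_or_pos J with rfl | h1
    · exact absurd hJ (not_capIneq_zero (by linarith) hε' hp.ζr_mem.2 (norm_pos_iff.2 hg))
    · exact h1
  have := hc.products_le (scaledHessMap_isSymmetric _ hU hf hxU) hε' hM' hp.ζr_mem.1 hc0 hg hn0
    hBr hJ1 hJ
  refine ⟨hJ1, this.1, ?_⟩
  rintro ⟨r', hr', hnc⟩
  cases hr'
  exact this.2 hnc

/-- The barrier adds at most μ to the curvature, because the entries of X⁻¹X̄ are at most 1. -/
theorem inner_scaledHess_le (hx : ∀ i, 0 < x i) {μ : ℝ} (hμ : 0 ≤ μ) (v : Vec n) :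
    ⟪v, scaledHess f μ x v⟫ ≤ ⟪v, scaled x (hess f x) v⟫ + μ * ‖v‖ ^ 2 := by
  rw [inner_scaledHess, scaled, ← inner_diagMul, norm_sq_eq_sum]
  have : ∑ i, relScale x v i * relScale x v i ≤ ∑ i, v i ^ 2 := by
    refine Finset.sum_le_sum fun i _ => ?_
    rw [← sq]
    exact sq_le_sq.2 (abs_relScale_le hx v i)
  have := mul_le_mul_of_nonneg_left this hμ
  linarith

set_option maxHeartbeats 1000000 in
/-- An iteration ends the run or makes a step, which is long unless it comes from a solution of the
model and leads to an approximately stationary point. -/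
theorem Iteration.outcome (h : Iteration f p εg Mhat x cg a dir s) (hp : p.Valid)
    (hLH : 0 < LH) (hε : 0 < εg) (hε1 : εg < 1) (hβ : √εg ≤ p.β) (hM : 0 ≤ Mhat)
    (hU : IsOpen U) (hf : ContDiffOn ℝ 2 f U)
    (hL : ∀ x ∈ U, ∀ y ∈ U, ‖hess f x - hess f y‖ ≤ LH * ‖x - y‖) (hxU : x ∈ U)
    (hx : ∀ i, 0 < x i) (hseg : ∀ d, dir = some d → segment ℝ x (x + diagMul (xbar x) d) ⊆ U)
    (hcurv : ¬ NeedsCG f εg x → ∀ v, a.dir = some v →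
      ‖v‖ = 1 ∧ ⟪v, scaled x (hess f x) v⟫ ≤ -(√εg / 2)) :
    (¬ NeedsCG f εg x ∧ s = .halted x ∧ a.dir = none) ∨
      ∃ d α, 0 < α ∧ α ≤ 1 ∧ supNorm (relScale x d) ≤ p.β ∧
        s = .active (x + α • diagMul (xbar x) d) ∧ SuffDecrease f (εg / 4) p.η x d α ∧
        (cAll p LH * √εg / 4 ≤ α * ‖d‖ ∨
          NeedsCG f εg x ∧ (∃ r, cg = some r ∧ r.isNC = false) ∧
            ¬ NeedsCG f εg (x + α • diagMul (xbar x) d)) := by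
  have hβ0 := hp.β_mem.1
  have hβ1 := hp.β_mem.2
  have hC := cubicCoeff_add_pos hp hLH
  have hc0 := cAll_pos hp hLH
  have hc1 : cAll p LH ≤ 1 := cAll_le_one
  set ε := √εg with hεdef
  have hε0 : 0 < ε := Real.sqrt_pos.2 hε
  have hsq : εg = ε ^ 2 := (Real.sq_sqrt hε.le).symm
  have hεlt : ε < 1 := by nlinarith
  have hmodel : ∀ d, dir = some d → supNorm (relScale x d) ≤ p.β → ∀ α ∈ Set.Icc (0 : ℝ) 1,
      barrier f (εg / 4) (x + α • diagMul (xbar x) d) ≤ barrier f (εg / 4) x +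
        α * ⟪scaledGrad f (εg / 4) x, d⟫ + α ^ 2 / 2 * ⟪d, scaledHess f (εg / 4) x d⟫ +
        cubicCoeff LH p.β / 6 * α ^ 3 * ‖d‖ ^ 3 := fun d hd hdβ α hα =>
    barrier_step_le hU hf hL hLH (hseg d hd) hx (by linarith) (by linarith) hβ0 hβ1 hdβ hα
  -- Treats both sources of negative curvature: m = ε for capped CG (curvature below ε after damping
  -- by 2ε), m = ε/4 for the oracle.
  have hnc : ∀ d, dir = some d → LineSearch f (εg / 4) p.η p.θ x d s → ∀ m, 0 < m →
      ε / 4 ≤ m →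
      (⟪scaledGrad f (εg / 4) x, d⟫ ≤ 0 ∧ ⟪d, scaledHess f (εg / 4) x d⟫ ≤ -‖d‖ ^ 3 ∧
        supNorm (relScale x d) ≤ p.β ∧ m ≤ ‖d‖) →
      ∃ d α, 0 < α ∧ α ≤ 1 ∧ supNorm (relScale x d) ≤ p.β ∧
        s = .active (x + α • diagMul (xbar x) d) ∧ SuffDecrease f (εg / 4) p.η x d α ∧
        cAll p LH * ε / 4 ≤ α * ‖d‖ := by
    intro d hd hs m hm hmε ⟨h1, h2, h3, h4⟩
    obtain ⟨α, hα0, hα1, hα2, hα3, hα4⟩ := hs.step_of_negativeCurvature hp.θ_mem hC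
      (norm_pos_iff.1 (hm.trans_le h4)) h1 h2 (hmodel d hd h3)
    refine ⟨d, α, hα0, hα1, h3, hα2, hα3, ?_⟩
    rw [← cNc_eq hp hLH] at hα4
    calc cAll p LH * ε / 4 = cAll p LH * (ε / 4) := by ring
      _ ≤ α * ‖d‖ := mul_le_mul ((min_le_right _ _).trans hα4) (hmε.trans h4) (by positivity)
        hα0.le
  by_cases hn : NeedsCG f εg x
  · right
    obtain ⟨r, d, rfl, rfl, hc, hd, hs⟩ := h.exists_cgReturns hp hε hM hU hf hxU hx hn
    have hg := scaledGrad_ne_zero hx hε hn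
    cases hr : r.isNC with
    | true =>
      obtain ⟨σ, hσ, hdeq⟩ := hd.1 hr
      have hlow := hc.lowCurv hr
      have hcv : ⟪r.dir, scaledHessMap f (εg / 4) x r.dir⟫ ≤ -(ε * ‖r.dir‖ ^ 2) := by
        rw [LowCurv, damped, inner_add_right, real_inner_smul_right,
          real_inner_self_eq_norm_sq] at hlow
        linarith
      obtain ⟨d', α, h1, h2, h3, h4, h5, h6⟩ := hnc d rfl hs ε hε0 (by linarith)
        (negativeCurvature_direction hx hlow.ne_zero hβ0 hσ hε0 hβ hcv hdeq)
      exact ⟨d', α, h1, h2, h3, h4, h5, Or.inl h6⟩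
    | false =>
      have hdeq := hd.2 hr
      have hcζ : 0 ≤ p.ζbar * (εg / 4) := by
        have := hp.ζbar_mem.1
        positivity
      obtain ⟨hy0, hy1, hy2, hy3⟩ := hc.solution (scaledHessMap_isSymmetric _ hU hf hxU) hε0
        (by linarith) hp.ζr_mem.1 hp.ζr_mem.2 hcζ hg hr
      rw [coe_scaledHessMap] at hy1 hy2 hy3
      set y := r.dir with hy
      have hyn : 0 < ‖y‖ := norm_pos_iff.2 hy0
      have hrs := supNorm_relScale_pos hx hy0
      set γ := min 1 (p.β / supNorm (relScale x y)) with hγ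
      have hγ0 : 0 < γ := lt_min one_pos (by positivity)
      have hγ1 : γ ≤ 1 := min_le_left _ _
      have hdn : ‖d‖ = γ * ‖y‖ := by rw [hdeq, norm_smul, Real.norm_eq_abs, abs_of_pos hγ0]
      have hdβ : supNorm (relScale x d) ≤ p.β := by
        have h1 : γ ≤ p.β / supNorm (relScale x y) := min_le_right _ _
        rw [hdeq, supNorm_relScale_smul, abs_of_pos hγ0]
        rwa [le_div_iff₀ hrs] at h1
      have hd0 : d ≠ 0 := by rw [hdeq]; exact smul_ne_zero hγ0.ne' hy0
      have hQ : ⟪y, damped (scaledHess f (εg / 4) x) ε y⟫ =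
          ⟪y, scaledHess f (εg / 4) x y⟫ + 2 * ε * ‖y‖ ^ 2 := by
        rw [damped, inner_add_right, real_inner_smul_right, real_inner_self_eq_norm_sq]
      have hgd : ⟪scaledGrad f (εg / 4) x, d⟫ =
          -(γ * ⟪y, damped (scaledHess f (εg / 4) x) ε y⟫) := by
        rw [inner_add_left, real_inner_comm] at hy2
        rw [hdeq, real_inner_smul_right]
        linear_combination γ * hy2
      have hdd : ⟪d, scaledHess f (εg / 4) x d⟫ = γ ^ 2 * ⟪y, scaledHess f (εg / 4) x y⟫ := by
        rw [hdeq, ← coe_scaledHessMap, map_smul, real_inner_smul_left, real_inner_smul_right]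
        ring
      -- Since the residual is orthogonal to y, the linear term is exactly -γQ. The quadratic one is
      -- at most γ²Q/2, and γ ≤ 1 leaves at most -γ²Q/2, where Q ≥ ε‖y‖².
      have hab : ∀ α ∈ Set.Icc (0 : ℝ) 1, ⟪scaledGrad f (εg / 4) x, d⟫ +
          α / 2 * ⟪d, scaledHess f (εg / 4) x d⟫ ≤ -(ε / 2 * ‖d‖ ^ 2) := by
        intro α hα
        rw [hgd, hdd, hdn]
        set Q := ⟪y, damped (scaledHess f (εg / 4) x) ε y⟫ with hQdef
        have hQ0 : 0 ≤ Q := le_trans (by positivity) hy1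
        have h1 : ⟪y, scaledHess f (εg / 4) x y⟫ ≤ Q := by
          have : 0 ≤ ε * ‖y‖ ^ 2 := by positivity
          linarith
        have h2 : α / 2 * (γ ^ 2 * ⟪y, scaledHess f (εg / 4) x y⟫) ≤ 1 / 2 * (γ ^ 2 * Q) := by
          calc _ ≤ α / 2 * (γ ^ 2 * Q) :=
                mul_le_mul_of_nonneg_left (mul_le_mul_of_nonneg_left h1 (sq_nonneg γ))
                  (by linarith [hα.1])
            _ ≤ 1 / 2 * (γ ^ 2 * Q) := mul_le_mul_of_nonneg_right (by linarith [hα.2])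
                  (by positivity)
        have h3 : γ ^ 2 * Q ≤ γ * Q := by
          have : γ ^ 2 ≤ γ := by nlinarith
          gcongr
        have h4 : γ ^ 2 * (ε * ‖y‖ ^ 2) ≤ γ ^ 2 * Q := by gcongr
        nlinarith
      obtain ⟨α, hα0, hα1, hα2, hα3, hα4⟩ := hs.step_of_solution hp.θ_mem hC hd0 hε0 hab
        (hmodel d rfl hdβ)
      refine ⟨d, α, hα0, hα1, hdβ, hα2, hα3, ?_⟩
      rcases hα4 with rfl | h4
      · rw [one_mul, one_smul]
        by_contra hcon
        rw [not_or, not_le] at hcon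
        obtain ⟨hshort, hcon⟩ := hcon
        -- A truncated direction has ‖X⁻¹X̄d‖_∞ = β, hence ‖d‖ ≥ β ≥ ε, which is not short.
        have hγeq : γ = 1 := by
          rcases min_choice 1 (p.β / supNorm (relScale x y)) with h1 | h1
          · exact h1
          · exfalso
            have h2 : supNorm (relScale x d) = p.β := by
              rw [hdeq, supNorm_relScale_smul, abs_of_pos hγ0, hγ, h1]
              field_simp
            have h3 := supNorm_relScale_le hx d
            have : cAll p LH * ε ≤ 1 * ε := by gcongr
            linarith
        have hdy : d = y := by rw [hdeq, hγeq, one_smul]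
        refine hcon ⟨hn, ⟨r, rfl, hr⟩, ?_⟩
        rw [hsq] at hy3 ⊢
        refine not_needsCG_of_short_step hU hf hL hLH (hseg d rfl) hx hε0 hεlt hβ1
          hp.ζbar_mem.1 (cD_pos hp hLH) nine_mul_cD_le (cD_mul_le hp hLH) hdβ ?_
          (by rw [hdy]; exact hy3)
        have : cAll p LH * ε ≤ cD p LH * ε := mul_le_mul_of_nonneg_right cAll_le_cD hε0.le
        have : 0 < cAll p LH * ε := by positivity
        linarith
      · left
        have h5 : cAll p LH ≤ 6 * p.θ ^ 2 / (cubicCoeff LH p.β + p.η) := by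
          refine (min_le_left _ _).trans ?_
          rw [cSol_eq hp hLH]
          exact min_le_right _ _
        have h6 : 3 * p.θ ^ 2 / (cubicCoeff LH p.β + p.η) * ε =
            6 * p.θ ^ 2 / (cubicCoeff LH p.β + p.η) * ε / 2 := by ring
        have h7 : cAll p LH * ε ≤ 6 * p.θ ^ 2 / (cubicCoeff LH p.β + p.η) * ε := by gcongr
        have : 0 < cAll p LH * ε := by positivity
        linarith
  · cases h with
    | cgBreakdown h hc => exact absurd h hn
    | cgStep h hc hd hs => exact absurd h hn
    | certified h ha => exact Or.inl ⟨hn, rfl, ha⟩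
    | @meoStep _ v d _ h ha hd hs =>
      right
      obtain ⟨hv1, hv2⟩ := hcurv hn v ha
      obtain ⟨σ, hσ, hdeq⟩ := hd
      have hv0 : v ≠ 0 := by
        rintro rfl
        simp at hv1
      -- The oracle guarantees -ε/2 for f, and the barrier adds at most μ = ε²/4 ≤ ε/4.
      have hcv : ⟪v, scaledHessMap f (εg / 4) x v⟫ ≤ -(ε / 4 * ‖v‖ ^ 2) := by
        have h1 := inner_scaledHess_le (f := f) hx (μ := εg / 4) (by linarith) v
        rw [hv1] at h1 ⊢
        rw [coe_scaledHessMap]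
        nlinarith
      obtain ⟨d', α, h1, h2, h3, h4, h5, h6⟩ := hnc d rfl hs (ε / 4) (by positivity) le_rfl
        (negativeCurvature_direction hx hv0 hβ0 (g := scaledGrad f (εg / 4) x) (σ := σ)
          (by rwa [real_inner_comm]) (by positivity) (by linarith) hcv
          (by rw [hv1, one_pow, div_one]; exact hdeq))
      exact ⟨d', α, h1, h2, h3, h4, h5, Or.inl h6⟩

end OneIteration

/-! ### Runs of the algorithm -/

/-- Tangent-line bound for the logarithm at (xᵢ/W)² = 1, summed over i. -/
theorem sum_log_le {n : ℕ} {x : Vec n} {W : ℝ} (hx : ∀ i, 0 < x i) (hW : 0 < W)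
    (h : ‖x‖ ≤ √n * W) : ∑ i, Real.log (x i) ≤ n * Real.log W := by
  have h1 : ∀ i, Real.log (x i) ≤ Real.log W + (x i ^ 2 / W ^ 2 - 1) / 2 := by
    intro i
    have := Real.log_le_sub_one_of_pos (x := (x i / W) ^ 2) (pow_pos (div_pos (hx i) hW) 2)
    rw [Real.log_pow, Real.log_div (hx i).ne' hW.ne', div_pow] at this
    push_cast at this
    linarith
  have h2 := Finset.sum_le_sum fun i (_ : i ∈ Finset.univ) => h1 i
  simp only [Finset.sum_add_distrib, ← Finset.sum_div, Finset.sum_sub_distrib, ← norm_sq_eq_sum,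
    Finset.sum_const, Finset.card_univ, Fintype.card_fin, nsmul_eq_mul, mul_one] at h2
  have h3 : ‖x‖ ^ 2 / W ^ 2 ≤ n := by
    rw [div_le_iff₀ (by positivity)]
    calc ‖x‖ ^ 2 ≤ (√n * W) ^ 2 := by gcongr
      _ = n * W ^ 2 := by rw [mul_pow, Real.sq_sqrt (Nat.cast_nonneg n)]
  linarith

theorem norm_le_sqrt_mul_supNorm {n : ℕ} (x : Vec n) : ‖x‖ ≤ √n * supNorm x := by
  have h0 := supNorm_nonneg x
  refine le_of_sq_le_sq ?_ (by positivity)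
  rw [mul_pow, Real.sq_sqrt (Nat.cast_nonneg n), norm_sq_eq_sum]
  calc ∑ i, x i ^ 2 ≤ ∑ _i : Fin n, supNorm x ^ 2 :=
        Finset.sum_le_sum fun i _ => by
          rw [← sq_abs (x i)]
          have := abs_le_supNorm x i
          gcongr
    _ = n * supNorm x ^ 2 := by simp

/-- The quantity `f(x₀) - f_low + μ n (log ω₂ - min log x₀)`. -/
noncomputable def barrierGap {n : ℕ} (p : Params) (LH εg gap : ℝ) (x₀ : Vec n) : ℝ :=
  gap + εg / 4 * n * (Real.log (omega2 p LH x₀) - ⨅ i, Real.log (x₀ i))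

/-! ### Boundedness of the decrease in spite of an unbounded barrier -/

section Potential

variable {n : ℕ} {f : Vec n → ℝ} {p : Params} {εg LH flow : ℝ} {x₀ x : Vec n}

theorem omega2_pos (hp : p.Valid) (hLH : 0 < LH) (hn : 0 < n) (x₀ : Vec n) :
    0 < omega2 p LH x₀ := by
  have h1 := cAll_pos hp hLH
  have h2 := hp.η_mem.1
  exact lt_max_of_lt_left (by positivity)

theorem log_omega2_sub_nonneg (hn : 0 < n)
    (hx₀ : ∀ i, 0 < x₀ i) : 0 ≤ Real.log (omega2 p LH x₀) - ⨅ i, Real.log (x₀ i) := by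
  have h1 : ⨅ i, Real.log (x₀ i) ≤ Real.log (x₀ ⟨0, hn⟩) := ciInf_le (Set.finite_range _).bddBelow _
  have h2 : Real.log (x₀ ⟨0, hn⟩) ≤ Real.log (omega2 p LH x₀) :=
    Real.log_le_log (hx₀ _) (((le_abs_self _).trans (abs_le_supNorm x₀ _)).trans (le_max_right _ _))
  linarith

theorem barrierGap_nonneg (hn : 0 < n) (hε : 0 < εg) {gap : ℝ}
    (hgap : 0 ≤ gap) (hx₀ : ∀ i, 0 < x₀ i) : 0 ≤ barrierGap p LH εg gap x₀ := by
  have := log_omega2_sub_nonneg (p := p) (LH := LH) hn hx₀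
  unfold barrierGap
  positivity

/-- The norm bound controls ∑ log xᵢ by n log (ω₂ + δ) with δ = 2S/(a²√n), and log (ω₂ + δ) ≤ log ω₂
+ δ/ω₂. The last term eats half of the decrease η S/6. -/
theorem potential_le (hp : p.Valid) (hLH : 0 < LH) (hn : 0 < n) (hε : 0 < εg)
    (hlow : ∀ x : Vec n, (∀ i, 0 < x i) → flow ≤ f x) (hx : ∀ i, 0 < x i) {S : ℝ} (hS : 0 ≤ S)
    (hnorm : ‖x‖ ≤ √n * supNorm x₀ + 2 * S / (cAll p LH * √εg / 4) ^ 2)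
    (hdec : barrier f (εg / 4) x ≤ barrier f (εg / 4) x₀ - p.η * S / 6) :
    p.η * S / 12 ≤ barrierGap p LH εg (f x₀ - flow) x₀ := by
  have hc := cAll_pos hp hLH
  have hη := hp.η_mem.1
  have hω := omega2_pos hp hLH hn x₀
  have hn' : (0 : ℝ) < n := Nat.cast_pos.2 hn
  have hsn : 0 < √(n : ℝ) := Real.sqrt_pos.2 hn'
  have hsn2 : √(n : ℝ) ^ 2 = n := Real.sq_sqrt hn'.le
  have ha : (cAll p LH * √εg / 4) ^ 2 = cAll p LH ^ 2 * εg / 16 := by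
    rw [div_pow, mul_pow, Real.sq_sqrt hε.le]; norm_num
  rw [ha] at hnorm
  set c := cAll p LH
  set ω := omega2 p LH x₀ with hωdef
  set δ := 2 * S / (c ^ 2 * εg / 16) / √n with hδ
  have hδ0 : 0 ≤ δ := by positivity
  have hω1 : supNorm x₀ ≤ ω := le_max_right _ _
  have hω2 : 96 * √n / (p.η * c ^ 2) ≤ ω := le_max_left _ _
  have h1 : ‖x‖ ≤ √n * (ω + δ) := by
    have e : √n * δ = 2 * S / (c ^ 2 * εg / 16) := by rw [hδ]; field_simp
    rw [mul_add, e]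
    refine hnorm.trans ?_
    gcongr
  have h2 := sum_log_le hx (by positivity) h1
  have h3 : Real.log (ω + δ) ≤ Real.log ω + δ / ω := by
    have h4 : ω + δ = ω * (1 + δ / ω) := by field_simp
    rw [h4, Real.log_mul hω.ne' (by positivity)]
    have := Real.log_le_sub_one_of_pos (x := 1 + δ / ω) (by positivity)
    linarith
  -- The entry 96√n/(η c_all²) of ω₂ is chosen to make this exactly η S/12.
  have h5 : εg / 4 * n * (δ / ω) ≤ p.η * S / 12 := by
    have h6 : δ / ω ≤ δ / (96 * √n / (p.η * c ^ 2)) := by gcongr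
    calc εg / 4 * n * (δ / ω) ≤ εg / 4 * n * (δ / (96 * √n / (p.η * c ^ 2))) := by gcongr
      _ = p.η * S / 12 * (n / √n ^ 2) := by rw [hδ]; field_simp; ring
      _ = p.η * S / 12 := by rw [hsn2, div_self hn'.ne', mul_one]
  have h7 : ∑ i, Real.log (x₀ i) ≥ n * ⨅ i, Real.log (x₀ i) := by
    have := Finset.card_nsmul_le_sum Finset.univ (fun i => Real.log (x₀ i))
      (⨅ i, Real.log (x₀ i)) fun i _ => ciInf_le (Set.finite_range _).bddBelow i
    simpa using this
  have h8 := hlow x hx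
  unfold barrier at hdec
  unfold barrierGap
  have hμ : 0 < εg / 4 := by linarith
  have h9 : εg / 4 * ∑ i, Real.log (x i) ≤ εg / 4 * (n * (Real.log ω + δ / ω)) := by
    refine mul_le_mul_of_nonneg_left (h2.trans ?_) hμ.le
    gcongr
  have h10 : εg / 4 * (n * ⨅ i, Real.log (x₀ i)) ≤ εg / 4 * ∑ i, Real.log (x₀ i) := by gcongr
  rw [← hωdef]
  nlinarith

theorem rpow_neg_three_halves (hε : 0 < εg) : εg ^ (-(3 / 2) : ℝ) = (√εg ^ 3)⁻¹ := by
  rw [Real.rpow_neg hε.le, Real.sqrt_eq_rpow, ← Real.rpow_natCast, ← Real.rpow_mul hε.le]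
  norm_num

/-- The constant is 1536 = 2 · 12 · 4³: two iterations per long step, the factor 12 of the potential
bound and the cube of the 4 in a. The summand 2 covers a last short step and the halting iteration.
-/
theorem two_mul_add_two_le_Kbar2 (hp : p.Valid) (hLH : 0 < LH) (hε : 0 < εg) {gap S : ℝ} {G : ℕ}
    (hG : G * (cAll p LH * √εg / 4) ^ 3 ≤ S)
    (hS : p.η * S / 12 ≤ barrierGap p LH εg gap x₀) : 2 * G + 2 ≤ Kbar2 p LH εg gap x₀ := by
  have hc := cAll_pos hp hLH
  have hη := hp.η_mem.1
  have hs := Real.sqrt_pos.2 hε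
  unfold Kbar2
  change _ ≤ ⌈1536 * barrierGap p LH εg gap x₀ / _ * _⌉₊ + 2
  rw [rpow_neg_three_halves hε]
  have h1 : ((2 * G : ℕ) : ℝ) ≤
      1536 * barrierGap p LH εg gap x₀ / (p.η * cAll p LH ^ 3) * (√εg ^ 3)⁻¹ := by
    rw [← div_eq_mul_inv, div_div, le_div_iff₀ (by positivity)]
    push_cast
    have h2 : p.η * (G * (cAll p LH * √εg / 4) ^ 3) ≤ p.η * S := by gcongr
    nlinarith
  have h2 := h1.trans (Nat.le_ceil _)
  have h3 : 2 * G ≤ ⌈1536 * barrierGap p LH εg gap x₀ / (p.η * cAll p LH ^ 3) * (√εg ^ 3)⁻¹⌉₊ := by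
    exact_mod_cast h2
  omega

end Potential

/-! ### Counting iterations and operations along a run -/

section Run

variable {n : ℕ} {f : Vec n → ℝ} {p : Params} {εg Mhat Lg LH flow : ℝ} {x₀ : Vec n} {t : Trace n}

theorem iterOps_of_active {k : ℕ} {x : Vec n} (h : t.status k = .active x) :
    (NeedsCG f εg x → iterOps f εg t k = 1 + (t.cg k).elim 0 CGResult.products) ∧
      (¬ NeedsCG f εg x → iterOps f εg t k = 1 + (t.meo k).products) := by
  constructor <;> intro hn <;> simp [iterOps, h, hn]

theorem iterOps_of_halted {k : ℕ} {x : Vec n} (h : t.status k = .halted x) :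
    iterOps f εg t k = 0 := by
  simp [iterOps, h]

/-- The standing assumptions on a single run. -/
structure RunAssumptions (f : Vec n → ℝ) (p : Params) (εg Mhat Lg LH flow : ℝ) (x₀ : Vec n)
    (t : Trace n) : Prop where
  valid : p.Valid
  LH_pos : 0 < LH
  dim_pos : 0 < n
  εg_pos : 0 < εg
  εg_lt_one : εg < 1
  sqrt_le_β : √εg ≤ p.β
  Mhat_nonneg : 0 ≤ Mhat
  x₀_pos : ∀ i, 0 < x₀ i
  low : ∀ x : Vec n, (∀ i, 0 < x i) → flow ≤ f x
  exec : IsExecution f p εg Mhat x₀ t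
  smooth : SmoothAlong f Lg LH t
  curvature : ∀ k x v, t.status k = .active x → ¬ NeedsCG f εg x → (t.meo k).dir = some v →
    ‖v‖ = 1 ∧ ⟪v, scaled x (hess f x) v⟫ ≤ -(√εg / 2)

/-- What an iteration does to the state. -/
theorem RunAssumptions.step (h : RunAssumptions f p εg Mhat Lg LH flow x₀ t) {k : ℕ} {x : Vec n}
    (hk : t.status k = .active x) (hx : ∀ i, 0 < x i) :
    (¬ NeedsCG f εg x ∧ t.status (k + 1) = .halted x ∧ (t.meo k).dir = none) ∨
      ∃ d α, 0 < α ∧ α ≤ 1 ∧ supNorm (relScale x d) ≤ p.β ∧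
        t.status (k + 1) = .active (x + α • diagMul (xbar x) d) ∧
        SuffDecrease f (εg / 4) p.η x d α ∧
        (cAll p LH * √εg / 4 ≤ α * ‖d‖ ∨
          NeedsCG f εg x ∧ (∃ r, t.cg k = some r ∧ r.isNC = false) ∧
            ¬ NeedsCG f εg (x + α • diagMul (xbar x) d)) := by
  obtain ⟨U, hU, hxU, hseg, hf, -, hL⟩ := h.smooth
  exact (h.exec.active k x hk).outcome h.valid h.LH_pos h.εg_pos h.εg_lt_one h.sqrt_le_β
    h.Mhat_nonneg hU hf hL (hxU k x hk) hx (fun d hd => hseg k x d hk hd)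
    (fun hn v hv => h.curvature k x v hk hn hv)

/-- Up to any index, a run is active at a positive point, or it has halted at one. -/
theorem RunAssumptions.status_cases (h : RunAssumptions f p εg Mhat Lg LH flow x₀ t) (m : ℕ) :
    (∃ x, t.status m = .active x ∧ ∀ i, 0 < x i) ∨
      ∃ k < m, ∃ x, t.status k = .active x ∧ (∀ i, 0 < x i) ∧ ¬ NeedsCG f εg x ∧
        (t.meo k).dir = none ∧ ∀ j, k < j → j ≤ m → t.status j = .halted x := by
  induction m with
  | zero => exact Or.inl ⟨x₀, h.exec.init, h.x₀_pos⟩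
  | succ m ih =>
    rcases ih with ⟨x, hm, hx⟩ | ⟨k, hk, x, h1, h2, h3, h4, h5⟩
    · rcases h.step hm hx with ⟨h1, h2, h3⟩ | ⟨d, α, h1, h2, h3, h4, -⟩
      · refine Or.inr ⟨m, m.lt_succ_self, x, hm, hx, h1, h3, fun j hj1 hj2 => ?_⟩
        have : j = m + 1 := by omega
        rw [this, h2]
      · exact Or.inl ⟨_, h4, iterate_pos hx h.valid.β_mem.2 h3 ⟨h1.le, h2⟩⟩
    · refine Or.inr ⟨k, by omega, x, h1, h2, h3, h4, fun j hj1 hj2 => ?_⟩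
      rcases hj2.lt_or_eq with hj | rfl
      · exact h5 j hj1 (by omega)
      · exact h.exec.halted m x (h5 m hk le_rfl)

theorem RunAssumptions.pos_of_active (h : RunAssumptions f p εg Mhat Lg LH flow x₀ t) {k : ℕ}
    {x : Vec n} (hk : t.status k = .active x) (i : Fin n) : 0 < x i := by
  rcases h.status_cases k with ⟨y, hy, hpos⟩ | ⟨j, hj, y, -, -, -, -, hy⟩
  · rw [hk] at hy
    cases hy
    exact hpos i
  · rw [hy k hj le_rfl] at hk
    cases hk

theorem norm_step_le {x d : Vec n} (hx : ∀ i, 0 < x i) {α : ℝ} (hα : 0 < α) :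
    ‖x + α • diagMul (xbar x) d‖ ≤ ‖x‖ + α * ‖d‖ := by
  refine (norm_add_le _ _).trans ?_
  rw [norm_smul, Real.norm_eq_abs, abs_of_pos hα]
  have := norm_diagMul_le (v := d) (abs_xbar_le_one hx)
  gcongr

/-- The invariant of a run: `G` counts the long steps and `S` is the sum of the cubes of their
lengths; `b = 1` if the last step was short. The number `L` bounds the operations per iteration up
to one. -/
theorem RunAssumptions.invariant (h : RunAssumptions f p εg Mhat Lg LH flow x₀ t) {L : ℕ}
    (hL2 : 2 ≤ L)
    (hcg : ∀ k x, t.status k = .active x → NeedsCG f εg x → iterOps f εg t k ≤ L ∧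
      ((∃ r, t.cg k = some r ∧ r.isNC = false) → iterOps f εg t k + 1 ≤ L)) :
    ∀ k x, t.status k = .active x → ∃ (G b : ℕ) (S : ℝ), b ≤ 1 ∧ 0 ≤ S ∧
      G * (cAll p LH * √εg / 4) ^ 3 ≤ S ∧
      p.η * S / 12 ≤ barrierGap p LH εg (f x₀ - flow) x₀ ∧ k ≤ 2 * G + b ∧
      ‖x‖ ≤ √n * supNorm x₀ + 2 * S / (cAll p LH * √εg / 4) ^ 2 + b * (cAll p LH * √εg / 4) ∧
      barrier f (εg / 4) x ≤ barrier f (εg / 4) x₀ - p.η * S / 6 ∧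
      (b = 1 → ¬ NeedsCG f εg x) ∧
      ((∀ k x, t.status k = .active x → ¬ NeedsCG f εg x → iterOps f εg t k ≤ L + 1) →
        totalOps f εg t k ≤ 2 * G * L + b * (L - 1)) := by
  have hc := cAll_pos h.valid h.LH_pos
  have hη := h.valid.η_mem.1
  have ha : 0 < cAll p LH * √εg / 4 := by
    have := Real.sqrt_pos.2 h.εg_pos
    positivity
  intro k
  induction k with
  | zero =>
    intro x hx
    rw [h.exec.init] at hx
    cases hx
    refine ⟨0, 0, 0, by norm_num, le_rfl, by simp, ?_, by norm_num, ?_, by simp, by simp,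
      by simp [totalOps]⟩
    · rw [mul_zero, zero_div]
      exact barrierGap_nonneg h.dim_pos h.εg_pos
        (sub_nonneg.2 (h.low x₀ h.x₀_pos)) h.x₀_pos
    · simpa using norm_le_sqrt_mul_supNorm x₀
  | succ k ih =>
    intro x' hx'
    obtain ⟨x, hk⟩ : ∃ x, t.status k = .active x := by
      cases hs : t.status k with
      | active x => exact ⟨x, rfl⟩
      | halted x => rw [h.exec.halted k x hs] at hx'; cases hx'
      | failed => rw [h.exec.failed k hs] at hx'; cases hx'
    have hx := h.pos_of_active hk
    obtain ⟨G, b, S, hb, hS, hGS, hSB, hkG, hnorm, hdec, hbn, hops⟩ := ih x hk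
    rcases h.step hk hx with ⟨-, h2, -⟩ | ⟨d, α, hα0, hα1, hdβ, hact, hsuff, hcase⟩
    · rw [h2] at hx'; cases hx'
    rw [hact] at hx'
    cases hx'
    set a := cAll p LH * √εg / 4 with hadef
    have hstep := norm_step_le (d := d) hx hα0
    have hpos := iterate_pos hx h.valid.β_mem.2 hdβ ⟨hα0.le, hα1⟩
    rw [SuffDecrease] at hsuff
    set s := α * ‖d‖ with hsdef
    have hs0 : 0 ≤ s := by positivity
    have hs3 : p.η / 6 * α ^ 3 * ‖d‖ ^ 3 = p.η / 6 * s ^ 3 := by rw [hsdef]; ring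
    rw [hs3] at hsuff
    have hsum : totalOps f εg t (k + 1) = totalOps f εg t k + iterOps f εg t k :=
      Finset.sum_range_succ _ _
    rcases le_or_gt a s with hgood | hbad
    · have hs_cube : a ^ 3 ≤ s ^ 3 := by gcongr
      -- A pending short step, of length below a, is charged to this long step; hence the factor 2
      -- in front of S/a².
      have hba : (b : ℝ) * a ≤ s := by
        have : (b : ℝ) ≤ 1 := by exact_mod_cast hb
        nlinarith
      have hs_le : s ≤ s ^ 3 / a ^ 2 := by
        rw [le_div_iff₀ (by positivity), pow_succ' s 2]
        gcongr
      have hnorm' : ‖x + α • diagMul (xbar x) d‖ ≤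
          √n * supNorm x₀ + 2 * (S + s ^ 3) / a ^ 2 := by
        have e : 2 * (S + s ^ 3) / a ^ 2 = 2 * S / a ^ 2 + 2 * (s ^ 3 / a ^ 2) := by ring
        rw [e]
        linarith
      have hdec' : barrier f (εg / 4) (x + α • diagMul (xbar x) d) ≤
          barrier f (εg / 4) x₀ - p.η * (S + s ^ 3) / 6 := by linarith
      have hS' : 0 ≤ S + s ^ 3 := by positivity
      refine ⟨G + 1, 0, S + s ^ 3, by norm_num, hS', ?_, ?_, by omega, by simpa using hnorm',
        hdec', by norm_num, fun hmeo => ?_⟩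
      · push_cast
        linarith
      · exact potential_le h.valid h.LH_pos h.dim_pos h.εg_pos h.low hpos hS' hnorm' hdec'
      -- The new credit 2L covers at most L + 1 for this step and L - 1 for a pending short one.
      · have h1 := hops hmeo
        have h2 : iterOps f εg t k ≤ L + 1 := by
          by_cases hn : NeedsCG f εg x
          · have := (hcg k x hk hn).1
            omega
          · exact hmeo k x hk hn
        have h3 : b * (L - 1) ≤ 1 * (L - 1) := Nat.mul_le_mul_right _ hb
        have h4 : 2 * (G + 1) * L = 2 * G * L + 2 * L := by ring
        rw [hsum, h4]
        omega
    · rcases hcase with hcase | ⟨hn, hsol, hn'⟩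
      · exact absurd hcase (not_le.2 hbad)
      -- A short step comes from capped CG, which is not called right after a short step. Its
      -- decrease of φ_μ is simply discarded.
      have hb0 : b = 0 := by
        by_contra hne
        exact hbn (by omega) hn
      subst hb0
      refine ⟨G, 1, S, le_rfl, hS, hGS, hSB, by omega, ?_, ?_, fun _ => hn', fun hmeo => ?_⟩
      · push_cast at hnorm ⊢
        linarith
      · have : 0 ≤ p.η / 6 * s ^ 3 := by positivity
        linarith
      · have h1 := hops hmeo
        have h2 := (hcg k x hk hn).2 hsol
        rw [hsum]
        omega

theorem totalOps_eq_of_halted {k m : ℕ} {x : Vec n} (hkm : k < m)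
    (h : ∀ j, k < j → j ≤ m → t.status j = .halted x) :
    totalOps f εg t m = totalOps f εg t (k + 1) := by
  induction m with
  | zero => omega
  | succ m ih =>
    rcases Nat.lt_succ_iff_lt_or_eq.1 hkm with h1 | rfl
    · have h2 : totalOps f εg t (m + 1) = totalOps f εg t m + iterOps f εg t m :=
        Finset.sum_range_succ _ _
      rw [h2, iterOps_of_halted (h m h1 (by omega)), add_zero,
        ih h1 fun j hj1 hj2 => h j hj1 (by omega)]
    · rfl

/-- Every run halts within `Kbar2` iterations, at an approximate first-order point. -/
theorem RunAssumptions.halts (h : RunAssumptions f p εg Mhat Lg LH flow x₀ t) {L : ℕ}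
    (hL2 : 2 ≤ L)
    (hcg : ∀ k x, t.status k = .active x → NeedsCG f εg x → iterOps f εg t k ≤ L ∧
      ((∃ r, t.cg k = some r ∧ r.isNC = false) → iterOps f εg t k + 1 ≤ L)) :
    ∃ k < Kbar2 p LH εg (f x₀ - flow) x₀, ∃ x, t.status k = .active x ∧ ¬ NeedsCG f εg x ∧
      (t.meo k).dir = none ∧ t.status (Kbar2 p LH εg (f x₀ - flow) x₀) = .halted x ∧
      FirstOrder f εg x ∧
      ((∀ k x, t.status k = .active x → ¬ NeedsCG f εg x → iterOps f εg t k ≤ L + 1) →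
        totalOps f εg t (Kbar2 p LH εg (f x₀ - flow) x₀) ≤
          L * Kbar2 p LH εg (f x₀ - flow) x₀) := by
  set K := Kbar2 p LH εg (f x₀ - flow) x₀ with hK
  rcases h.status_cases K with ⟨x, hx, -⟩ | ⟨k, hk, x, h1, h2, h3, h4, h5⟩
  -- A run still active at K would give K ≤ 2G + 1 < 2G + 2 ≤ K.
  · obtain ⟨G, b, S, hb, hS, hGS, hSB, hkG, -⟩ := h.invariant hL2 hcg K x hx
    have := two_mul_add_two_le_Kbar2 h.valid h.LH_pos h.εg_pos hGS hSB
    omega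
  · refine ⟨k, hk, x, h1, h3, h4, h5 K hk le_rfl, firstOrder_of_not_needsCG h2 h3, fun hmeo => ?_⟩
    obtain ⟨G, b, S, hb, hS, hGS, hSB, hkG, -, -, -, hops⟩ := h.invariant hL2 hcg k x h1
    have hK2 := two_mul_add_two_le_Kbar2 h.valid h.LH_pos h.εg_pos hGS hSB
    have h6 := hops hmeo
    have h7 := hmeo k x h1 h3
    have h8 : b * (L - 1) ≤ 1 * (L - 1) := Nat.mul_le_mul_right _ hb
    have h9 : totalOps f εg t (k + 1) = totalOps f εg t k + iterOps f εg t k :=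
      Finset.sum_range_succ _ _
    rw [totalOps_eq_of_halted hk h5, h9]
    -- The halting oracle call costs up to L + 1, a short step before it L - 1; together they use up
    -- the last 2L.
    calc totalOps f εg t k + iterOps f εg t k ≤ L * (2 * G + 2) := by
          have : L * (2 * G + 2) = 2 * G * L + 2 * L := by ring
          omega
      _ ≤ L * K := Nat.mul_le_mul_left _ hK2

end Run

/-! ### The cap on the number of conjugate gradient iterations -/

/-- From log τ ≤ τ - 1 = -1/(√κ + 1), the factor τ^{j/2} is at most 1/X, where X dominates both
ratios that have to be beaten. -/
theorem capIneq_of_log_le {M ε ζr c ρ X : ℝ} {j : ℕ} (hM : 0 ≤ M) (hε : 0 < ε) (hζ : 0 < ζr)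
    (hc : 0 < c) (hρ : 0 < ρ) (hX1 : √(cgT M ε) / cgZeta M ε ζr ≤ X)
    (hX2 : √(cgT M ε) * ρ / c ≤ X)
    (hj : 2 * (√(cgKappa M ε) + 1) * Real.log X ≤ j) : CapIneq M ε ζr c ρ j := by
  have hτ := cgTau_pos hM hε
  have hT := Real.sqrt_pos.2 (cgT_pos hM hε)
  have hz := cgZeta_pos hM hε hζ
  have hX : 0 < X := lt_of_lt_of_le (by positivity) hX1
  have hs := Real.sqrt_nonneg (cgKappa M ε)
  have h1 : cgTau M ε ^ ((j : ℝ) / 2) ≤ X⁻¹ := by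
    rw [← Real.exp_log (inv_pos.2 hX), Real.log_inv, Real.rpow_def_of_pos hτ, Real.exp_le_exp]
    have h2 := Real.log_le_sub_one_of_pos hτ
    have h3 := one_sub_cgTau M ε
    have h4 : Real.log (cgTau M ε) ≤ -(1 / (√(cgKappa M ε) + 1)) := by linarith
    calc Real.log (cgTau M ε) * ((j : ℝ) / 2) ≤ -(1 / (√(cgKappa M ε) + 1)) * ((j : ℝ) / 2) := by
          gcongr
      _ = -(j / (2 * (√(cgKappa M ε) + 1))) := by field_simp
      _ ≤ -Real.log X := by
          rw [neg_le_neg_iff, le_div_iff₀ (by positivity)]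
          linarith
  rw [CapIneq]
  have h5 : √(cgT M ε) * cgTau M ε ^ ((j : ℝ) / 2) * ρ ≤ √(cgT M ε) * X⁻¹ * ρ := by gcongr
  refine h5.trans (le_min ?_ ?_)
  · rw [div_le_iff₀ hz] at hX1
    rw [← div_eq_mul_inv]
    gcongr
    rw [div_le_iff₀ hX]
    linarith
  · rw [div_le_iff₀ hc] at hX2
    rw [← div_eq_mul_inv, div_mul_eq_mul_div, div_le_iff₀ hX]
    linarith

theorem exists_capIneq {M ε ζr c ρ : ℝ} (hM : 0 ≤ M) (hε : 0 < ε) (hζ : 0 < ζr) (hc : 0 < c)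
    (hρ : 0 < ρ) : ∃ j, CapIneq M ε ζr c ρ j := by
  obtain ⟨j, hj⟩ := exists_nat_ge (2 * (√(cgKappa M ε) + 1) *
    Real.log (max (√(cgT M ε) / cgZeta M ε ζr) (√(cgT M ε) * ρ / c)))
  exact ⟨j, capIneq_of_log_le hM hε hζ hc hρ (le_max_left _ _) (le_max_right _ _) hj⟩

/-- The first half of the inequality is homogeneous in ρ, the second monotone. Hence the cap for U_g
+ μ√n serves every call, and J ≤ J̄. -/
theorem CapIneq.anti {M ε ζr c ρ ρ' : ℝ} {j : ℕ} (h : CapIneq M ε ζr c ρ' j) (hM : 0 ≤ M)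
    (hε : 0 < ε) (hρ : 0 < ρ) (hle : ρ ≤ ρ') : CapIneq M ε ζr c ρ j := by
  have hτ := cgTau_pos hM hε
  have h1 := le_of_mul_le_mul_right (h.trans (min_le_left _ _)) (hρ.trans_le hle)
  have h2 : √(cgT M ε) * cgTau M ε ^ ((j : ℝ) / 2) * ρ' ≤ c := h.trans (min_le_right _ _)
  refine le_min (by gcongr) (le_trans ?_ h2)
  gcongr

theorem norm_scaledGrad_le {n : ℕ} {f : Vec n → ℝ} {x : Vec n} {μ : ℝ} (hx : ∀ i, 0 < x i)
    (hμ : 0 ≤ μ) : ‖scaledGrad f μ x‖ ≤ ‖gradient f x‖ + μ * √n := by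
  set v : Vec n := WithLp.toLp 2 fun i => xbar x i / x i with hv
  have e : scaledGrad f μ x = diagMul (xbar x) (gradient f x) - μ • v := by
    ext i
    change xbar x i * (gradient f x i - μ / x i) = xbar x i * gradient f x i -
      μ * (xbar x i / x i)
    ring
  have h1 : ‖v‖ ≤ √n := by
    refine (norm_le_sqrt_mul_supNorm v).trans (mul_le_of_le_one_right (Real.sqrt_nonneg _) ?_)
    refine supNorm_le zero_le_one fun i => ?_
    change |xbar x i / x i| ≤ 1
    rw [abs_of_pos (ratio_pos hx i)]
    exact ratio_le_one hx i
  rw [e]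
  refine (norm_sub_le _ _).trans ?_
  rw [norm_smul, Real.norm_eq_abs, abs_of_nonneg hμ]
  have := norm_diagMul_le (v := gradient f x) (abs_xbar_le_one hx)
  gcongr

section Run

variable {n : ℕ} {f : Vec n → ℝ} {p : Params} {εg Mhat Lg LH Ug UH flow : ℝ} {x₀ : Vec n}
  {t : Trace n}

theorem RunAssumptions.runJ_spec (h : RunAssumptions f p εg Mhat Lg LH flow x₀ t)
    (hUg : 0 < Ug) (hUH : 0 < UH) (hb : BoundedAlong f Ug UH t) :
    (∀ k x, t.status k = .active x → NeedsCG f εg x →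
      CapIneq (UH + εg / 4) √εg p.ζr (p.ζbar * (εg / 4)) ‖scaledGrad f (εg / 4) x‖
        (runJ f εg (UH + εg / 4) √εg p.ζr (p.ζbar * (εg / 4)) t)) ∧
      runJ f εg (UH + εg / 4) √εg p.ζr (p.ζbar * (εg / 4)) t ≤
        capJ (UH + εg / 4) √εg p.ζr (p.ζbar * (εg / 4)) (Ug + εg / 4 * √n) := by
  have hε := h.εg_pos
  have hM : 0 ≤ UH + εg / 4 := by linarith
  have hs := Real.sqrt_pos.2 hε
  have hζb := h.valid.ζbar_mem.1
  have hcap : CapIneq (UH + εg / 4) √εg p.ζr (p.ζbar * (εg / 4)) (Ug + εg / 4 * √n)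
      (capJ (UH + εg / 4) √εg p.ζr (p.ζbar * (εg / 4)) (Ug + εg / 4 * √n)) :=
    Nat.sInf_mem (s := {j | CapIneq (UH + εg / 4) √εg p.ζr (p.ζbar * (εg / 4))
      (Ug + εg / 4 * √n) j})
      (exists_capIneq hM hs h.valid.ζr_mem.1 (by positivity) (by positivity))
  have hmem : capJ (UH + εg / 4) √εg p.ζr (p.ζbar * (εg / 4)) (Ug + εg / 4 * √n) ∈
      {j | ∀ k x, t.status k = .active x → NeedsCG f εg x →
        CapIneq (UH + εg / 4) √εg p.ζr (p.ζbar * (εg / 4)) ‖scaledGrad f (εg / 4) x‖ j} := by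
    intro k x hk hn
    have hx := h.pos_of_active hk
    refine hcap.anti hM hs (norm_pos_iff.2 (scaledGrad_ne_zero hx hε hn)) ?_
    refine (norm_scaledGrad_le hx (by linarith)).trans ?_
    have := (hb k x hk).1
    gcongr
  exact ⟨Nat.sInf_mem ⟨_, hmem⟩, Nat.sInf_le hmem⟩

theorem RunAssumptions.conclusion (h : RunAssumptions f p εg Mhat Lg LH flow x₀ t)
    (hUg : 0 < Ug) (hUH : 0 < UH) (hb : BoundedAlong f Ug UH t)
    (hcgM : CGBoundLe (UH + εg / 4) t) (N : ℕ) :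
    ∃ k < Kbar2 p LH εg (f x₀ - flow) x₀, ∃ x, t.status k = .active x ∧ ¬ NeedsCG f εg x ∧
      (t.meo k).dir = none ∧ t.status (Kbar2 p LH εg (f x₀ - flow) x₀) = .halted x ∧
      FirstOrder f εg x ∧
      ((∀ k, k < Kbar2 p LH εg (f x₀ - flow) x₀ → MeoCalled f εg t k →
          (t.meo k).products ≤ N) →
        totalOps f εg t (Kbar2 p LH εg (f x₀ - flow) x₀) ≤
          opBound n (runJ f εg (UH + εg / 4) √εg p.ζr (p.ζbar * (εg / 4)) t) N
            (Kbar2 p LH εg (f x₀ - flow) x₀)) := by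
  set J := runJ f εg (UH + εg / 4) √εg p.ζr (p.ζbar * (εg / 4)) t with hJ
  set K := Kbar2 p LH εg (f x₀ - flow) x₀ with hK
  have hspec := (h.runJ_spec hUg hUH hb).1
  obtain ⟨U, hU, hxU, -, hf, -⟩ := h.smooth
  have hcg : ∀ k x, t.status k = .active x → NeedsCG f εg x →
      iterOps f εg t k ≤ max (2 * min n J + 2) N ∧
      ((∃ r, t.cg k = some r ∧ r.isNC = false) →
        iterOps f εg t k + 1 ≤ max (2 * min n J + 2) N) := by
    intro k x hk hn
    obtain ⟨h1, h2, h3⟩ := (h.exec.active k x hk).products_le h.valid h.εg_pos h.Mhat_nonneg hU hf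
      (hxU k x hk) (h.pos_of_active hk) hn h.dim_pos (fun r hr => hcgM k x r hk hr)
      (hspec k x hk hn)
    rw [(iterOps_of_active hk).1 hn]
    have h4 : 1 ≤ min n J := le_min h.dim_pos h1
    have h5 := le_max_left (2 * min n J + 2) N
    refine ⟨by omega, fun hr => ?_⟩
    have := h3 hr
    omega
  have hL2 : 2 ≤ max (2 * min n J + 2) N := le_trans (by omega) (le_max_left _ _)
  obtain ⟨k, hk, x, h1, h2, h3, h4, h5, h6⟩ := h.halts hL2 hcg
  refine ⟨k, hk, x, h1, h2, h3, h4, h5, fun hmeo => h6 fun j y hj hy => ?_⟩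
  -- The oracle budget is assumed for indices below K only; from K on the run stays halted.
  have hjK : j < K := by
    by_contra! hle
    have : ∀ i, K ≤ i → t.status i = .halted x := by
      intro i hi
      induction i, hi using Nat.le_induction with
      | base => exact h4
      | succ i hi ih => exact h.exec.halted i x ih
    rw [this j hle] at hj
    cases hj
  rw [(iterOps_of_active hj).2 hy]
  have h7 := hmeo j hjK ⟨y, hj, hy⟩
  have h8 := le_max_right (2 * min n J + 2) N
  omega

end Run

/-! ### The probability of success -/

/-- Induction on K. The event of no failure so far belongs to ℱ K. On its part where the oracle is
called, a conditional share of at least 1 - δ survives; on the rest everything does. -/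
theorem pow_le_measureReal_forall_lt {Ω : Type*} {mΩ : MeasurableSpace Ω} (P : Measure Ω)
    [IsProbabilityMeasure P] (ℱ : Filtration ℕ mΩ) {C G : ℕ → Set Ω} {δ : ℝ} (hδ : δ ≤ 1)
    (hδ0 : 0 ≤ δ) (hC : ∀ k, MeasurableSet[ℱ k] (C k)) (hG : ∀ k, MeasurableSet[ℱ (k + 1)] (G k))
    (h : ∀ k, ∀ᵐ ω ∂P, ω ∈ C k → 1 - δ ≤ (P⟦G k | ℱ k⟧) ω) (K : ℕ) :
    MeasurableSet[ℱ K] {ω | ∀ k < K, ω ∈ C k → ω ∈ G k} ∧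
      (1 - δ) ^ K ≤ P.real {ω | ∀ k < K, ω ∈ C k → ω ∈ G k} := by
  induction K with
  | zero => simp
  | succ K ih =>
    obtain ⟨hm, hP⟩ := ih
    set S := {ω | ∀ k < K, ω ∈ C k → ω ∈ G k} with hS
    have e : {ω | ∀ k < K + 1, ω ∈ C k → ω ∈ G k} = S ∩ ((C K)ᶜ ∪ G K) := by
      ext ω
      simp only [hS, Set.mem_ofPred_eq, Set.mem_inter_iff, Set.mem_union, Set.mem_compl_iff,
        Nat.lt_succ_iff_lt_or_eq]
      constructor
      · intro h1
        exact ⟨fun k hk => h1 k (Or.inl hk), by have := h1 K (Or.inr rfl); tauto⟩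
      · rintro ⟨h1, h2⟩ k (hk | rfl) hc
        · exact h1 k hk hc
        · tauto
    have hle : ℱ K ≤ ℱ (K + 1) := ℱ.mono (Nat.le_succ K)
    have hSm := ℱ.le K _ hm
    have hCm := ℱ.le K _ (hC K)
    have hGm := ℱ.le (K + 1) _ (hG K)
    rw [e]
    refine ⟨(hle _ hm).inter ((hle _ (hC K).compl).union (hG K)), ?_⟩
    have h1 : P.real S = P.real (S ∩ C K) + P.real (S \ C K) :=
      (measureReal_inter_add_sdiff hCm).symm
    have h2 : P.real (S ∩ ((C K)ᶜ ∪ G K)) = P.real (S ∩ C K ∩ G K) + P.real (S \ C K) := by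
      rw [← measureReal_inter_add_sdiff (s := S ∩ ((C K)ᶜ ∪ G K)) hCm]
      congr 2 <;> ext ω <;> simp only [Set.mem_inter_iff, Set.mem_union, Set.mem_compl_iff,
        Set.mem_sdiff] <;> tauto
    -- As S ∩ C K is ℱ K-measurable, the conditional probability integrates over it to the true one.
    have h3 : P.real (S ∩ C K ∩ G K) = ∫ ω in S ∩ C K, (P⟦G K | ℱ K⟧) ω ∂P := by
      rw [setIntegral_condExp (ℱ.le K) ((integrable_const (1 : ℝ)).indicator hGm)
        (hm.inter (hC K)), integral_indicator hGm, setIntegral_const, smul_eq_mul, mul_one,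
        measureReal_restrict_apply hGm, Set.inter_comm]
    have h4 : (1 - δ) * P.real (S ∩ C K) ≤ ∫ ω in S ∩ C K, (P⟦G K | ℱ K⟧) ω ∂P := by
      have : ∫ _ω in S ∩ C K, (1 - δ) ∂P ≤ ∫ ω in S ∩ C K, (P⟦G K | ℱ K⟧) ω ∂P := by
        refine setIntegral_mono_ae_restrict (integrable_const _).integrableOn
          integrable_condExp.integrableOn ?_
        rw [Filter.EventuallyLE, ae_restrict_iff' (hSm.inter hCm)]
        filter_upwards [h K] with ω hω hmem using hω hmem.2
      rwa [setIntegral_const, smul_eq_mul, mul_comm] at this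
    rw [h2, h3]
    have h5 : (1 - δ) * (1 - δ) ^ K ≤ (1 - δ) * P.real S :=
      mul_le_mul_of_nonneg_left hP (by linarith)
    have h6 : 0 ≤ δ * P.real (S \ C K) := mul_nonneg hδ0 measureReal_nonneg
    rw [pow_succ']
    rw [h1] at h5
    linarith

/-! ### Rates -/

theorem log_terms_nonneg {n : ℕ} {εg δ : ℝ} (hn : 0 < n) (hε : 0 < εg) (hε1 : εg < 1)
    (hδ : 0 ≤ δ) (hδ1 : δ < 1) : 0 ≤ Real.log n ∧ 0 ≤ Real.log (1 / εg) ∧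
      0 ≤ Real.log (1 / δ) := by
  refine ⟨Real.log_nonneg (by exact_mod_cast hn), Real.log_nonneg ?_, ?_⟩
  · rw [le_div_iff₀ hε]; linarith
  -- For δ = 0 the conventions 1/0 = 0 and log 0 = 0 make the last term vanish.
  · rcases hδ.eq_or_lt with rfl | h
    · simp
    · refine Real.log_nonneg ?_
      rw [le_div_iff₀ h]; linarith

/-- Because 1 - √τ ≥ (1 - τ)/2 = 1/(2(√κ + 1)) ≥ 1/(4κ). Only the logarithm of T enters the rate, so
a crude power suffices. -/
theorem sqrt_cgT_le {M ε : ℝ} (hM : 0 ≤ M) (hε : 0 < ε) : √(cgT M ε) ≤ 8 * cgKappa M ε ^ 3 := by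
  have hκ := two_le_cgKappa hM hε
  have hτ := cgTau_pos hM hε
  have h1 := one_sub_sqrt_cgTau_pos M ε
  have h2 := one_sub_cgTau M ε
  have h3 : √(cgTau M ε) ^ 2 = cgTau M ε := Real.sq_sqrt hτ.le
  have h4 := Real.sqrt_nonneg (cgTau M ε)
  have h5 : √(cgKappa M ε) ^ 2 = cgKappa M ε := Real.sq_sqrt (by linarith)
  have h6 := Real.sqrt_nonneg (cgKappa M ε)
  set κ := cgKappa M ε
  have h7 : √κ + 1 ≤ 2 * κ := by nlinarith
  have h8 : 1 / (4 * κ) ≤ 1 - √(cgTau M ε) := by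
    have h9 : 1 / (2 * κ) ≤ 1 - cgTau M ε := by
      rw [h2]
      gcongr
    have h10 : 1 / (4 * κ) = 1 / (2 * κ) / 2 := by field_simp; norm_num
    nlinarith
  rw [Real.sqrt_le_left (by positivity), cgT, div_le_iff₀ (by positivity)]
  have h11 : (1 / (4 * κ)) ^ 2 ≤ (1 - √(cgTau M ε)) ^ 2 := by gcongr
  calc 4 * κ ^ 4 = (8 * κ ^ 3) ^ 2 * (1 / (4 * κ)) ^ 2 := by field_simp; norm_num
    _ ≤ _ := by gcongr

/-- The bound on the number of conjugate gradient iterations, with `u = ε_g ^ (-1/4)`. -/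
theorem capJ_le {n : ℕ} (hn : 0 < n) {u UH Ug ζr ζ ℓ : ℝ} (hu : 1 ≤ u) (hUH : 0 < UH)
    (hUg : 0 < Ug) (hζr : 0 < ζr) (hζr1 : ζr < 1) (hζ : 0 < ζ) (hℓ1 : 1 ≤ ℓ)
    (hℓ : Real.log n + Real.log (u ^ 4) ≤ ℓ) (hn0 : 0 ≤ Real.log n) :
    (capJ (UH + (u ^ 4)⁻¹ / 4) (u ^ 2)⁻¹ ζr (ζ * ((u ^ 4)⁻¹ / 4)) (Ug + (u ^ 4)⁻¹ / 4 * √n) : ℝ) ≤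
      (2 * (√(UH + 3) + 1) *
        (Real.log (24 * (UH + 3) ^ 4 / ζr + 32 * (UH + 3) ^ 3 * (Ug + 1) / ζ) + 3) + 1) * ℓ * u := by
  have hu0 : 0 < u := by linarith
  set D := 24 * (UH + 3) ^ 4 / ζr + 32 * (UH + 3) ^ 3 * (Ug + 1) / ζ with hD
  set M := UH + (u ^ 4)⁻¹ / 4 with hMdef
  set ε := (u ^ 2)⁻¹ with hεdef
  have hε : 0 < ε := by positivity
  have hM : 0 ≤ M := by positivity
  have hu4 : (u ^ 4)⁻¹ ≤ 1 := inv_le_one_of_one_le₀ (one_le_pow₀ hu)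
  have hu2 : (u ^ 2)⁻¹ ≤ 1 := inv_le_one_of_one_le₀ (one_le_pow₀ hu)
  have hn1 : (1 : ℝ) ≤ n := by exact_mod_cast hn
  have hκ2 := two_le_cgKappa hM hε
  -- Here M + 2ε ≤ U_H + 1/4 + 2. So √κ is of order u, and this factor of the cap gives its rate
  -- ε_g^{-1/4}; the rest is logarithmic.
  have hκ : cgKappa M ε ≤ (UH + 3) * u ^ 2 := by
    rw [cgKappa, hεdef, div_inv_eq_mul]
    exact mul_le_mul_of_nonneg_right (by linarith) (by positivity)
  have hsκ : √(cgKappa M ε) ≤ √(UH + 3) * u := by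
    refine (Real.sqrt_le_sqrt hκ).trans_eq ?_
    rw [Real.sqrt_mul (by linarith), Real.sqrt_sq hu0.le]
  have hT := sqrt_cgT_le hM hε
  have hz : cgZeta M ε ζr = ζr / (3 * cgKappa M ε) := rfl
  have hD1 : 1 ≤ D := by
    have h1 : (1 : ℝ) ≤ (UH + 3) ^ 4 := one_le_pow₀ (by linarith)
    have h2 : 1 ≤ 24 * (UH + 3) ^ 4 / ζr := by rw [le_div_iff₀ hζr]; linarith
    have h3 : 0 ≤ 32 * (UH + 3) ^ 3 * (Ug + 1) / ζ := by positivity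
    linarith
  have hκ0 : 0 < cgKappa M ε := by linarith
  have hX1 : √(cgT M ε) / cgZeta M ε ζr ≤ D * n * u ^ 12 := by
    calc √(cgT M ε) / cgZeta M ε ζr ≤ 8 * cgKappa M ε ^ 3 / (ζr / (3 * cgKappa M ε)) := by
          rw [hz]; gcongr
      _ = 24 * cgKappa M ε ^ 4 / ζr * 1 * 1 := by field_simp; norm_num
      _ ≤ 24 * ((UH + 3) * u ^ 2) ^ 4 / ζr * n * u ^ 4 := by
          gcongr
          exact one_le_pow₀ hu
      _ = 24 * (UH + 3) ^ 4 / ζr * n * u ^ 12 := by ring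
      _ ≤ D * n * u ^ 12 := by
          gcongr
          have h3 : 0 ≤ 32 * (UH + 3) ^ 3 * (Ug + 1) / ζ := by positivity
          linarith
  have hsn : √(n : ℝ) ≤ n := by
    rw [Real.sqrt_le_left (by linarith)]
    nlinarith
  have hX2 : √(cgT M ε) * (Ug + (u ^ 4)⁻¹ / 4 * √n) / (ζ * ((u ^ 4)⁻¹ / 4)) ≤ D * n * u ^ 12 := by
    have h1 : Ug + (u ^ 4)⁻¹ / 4 * √n ≤ (Ug + 1) * n := by
      have : (u ^ 4)⁻¹ / 4 * √n ≤ 1 * n := mul_le_mul (by linarith) hsn (by positivity) (by norm_num)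
      nlinarith
    calc _ ≤ 8 * ((UH + 3) * u ^ 2) ^ 3 * ((Ug + 1) * n) / (ζ * ((u ^ 4)⁻¹ / 4)) := by
          gcongr
          refine hT.trans ?_
          gcongr
      _ = 32 * (UH + 3) ^ 3 * (Ug + 1) / ζ * n * u ^ 10 := by field_simp; norm_num
      _ ≤ D * n * u ^ 12 := by
          gcongr
          · have h3 : 0 ≤ 24 * (UH + 3) ^ 4 / ζr := by positivity
            linarith
          · norm_num
  have hlog : Real.log (D * n * u ^ 12) ≤ (Real.log D + 3) * ℓ := by
    have h1 : u ^ 12 = (u ^ 4) ^ 3 := by ring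
    rw [Real.log_mul (by positivity) (by positivity), Real.log_mul (by positivity) (by positivity),
      h1, Real.log_pow]
    have := Real.log_nonneg hD1
    push_cast
    nlinarith
  have hlog0 : 0 ≤ (Real.log D + 3) * ℓ := by
    have := Real.log_nonneg hD1
    positivity
  set Z := 2 * (√(UH + 3) + 1) * (Real.log D + 3) * ℓ * u with hZ
  have hZ0 : 0 ≤ Z := by
    have := Real.log_nonneg hD1
    positivity
  have hcap : CapIneq M ε ζr (ζ * ((u ^ 4)⁻¹ / 4)) (Ug + (u ^ 4)⁻¹ / 4 * √n) ⌈Z⌉₊ := by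
    refine capIneq_of_log_le hM hε hζr (by positivity) (by positivity) hX1 hX2
      (le_trans ?_ (Nat.le_ceil Z))
    calc 2 * (√(cgKappa M ε) + 1) * Real.log (D * n * u ^ 12)
        ≤ 2 * (√(cgKappa M ε) + 1) * ((Real.log D + 3) * ℓ) := by gcongr
      _ ≤ 2 * (√(UH + 3) * u + 1 * u) * ((Real.log D + 3) * ℓ) := by
          gcongr
          linarith
      _ = Z := by rw [hZ]; ring
  have h1 : capJ M ε ζr (ζ * ((u ^ 4)⁻¹ / 4)) (Ug + (u ^ 4)⁻¹ / 4 * √n) ≤ ⌈Z⌉₊ := Nat.sInf_le hcap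
  have h2 : (⌈Z⌉₊ : ℝ) ≤ Z + 1 := (Nat.ceil_lt_add_one hZ0).le
  have h3 : (1 : ℝ) ≤ ℓ * u := by nlinarith
  calc _ ≤ (⌈Z⌉₊ : ℝ) := by exact_mod_cast h1
    _ ≤ Z + ℓ * u := by linarith
    _ = _ := by rw [hZ]; ring

/-- Since ω₂ is at most a constant times n, its logarithm is absorbed by ℓ. The barrier term carries
μn = n u⁻⁴/4, which times u⁶ gives the summand n u². -/
theorem Kbar2_le {n : ℕ} (hn : 0 < n) {p : Params} (hp : p.Valid) {LH u gap Δ a b ℓ : ℝ}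
    (hLH : 0 < LH) {x₀ : Vec n} (hu : 1 ≤ u) (ha : 0 < a) (hx₀ : ∀ i, a ≤ x₀ i ∧ x₀ i ≤ b)
    (hgap : gap ≤ Δ) (hℓ1 : 1 + Real.log n ≤ ℓ)
    (hpow : ((u ^ 4)⁻¹) ^ (-(3 / 2) : ℝ) = u ^ 6) :
    (Kbar2 p LH (u ^ 4)⁻¹ gap x₀ : ℝ) ≤ (1536 * (|Δ| +
      (Real.log (96 / (p.η * cAll p LH ^ 2) + |b| + 1) + 1 + |Real.log a|)) /
        (p.η * cAll p LH ^ 3) + 3) * ℓ * (u ^ 6 + n * u ^ 2) := by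
  have hc := cAll_pos hp hLH
  have hη := hp.η_mem.1
  have hu0 : 0 < u := by linarith
  have hn1 : (1 : ℝ) ≤ n := by exact_mod_cast hn
  have hn0 : 0 ≤ Real.log n := Real.log_nonneg hn1
  have hω := omega2_pos hp hLH hn x₀
  have hx₀0 : ∀ i, 0 < x₀ i := fun i => ha.trans_le (hx₀ i).1
  set Q := 96 / (p.η * cAll p LH ^ 2) with hQ
  have hQ0 : 0 < Q := by positivity
  have hsn : √(n : ℝ) ≤ n := by
    rw [Real.sqrt_le_left (by linarith)]
    nlinarith
  have hω2 : omega2 p LH x₀ ≤ (Q + |b| + 1) * n := by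
    refine max_le ?_ ?_
    · calc 96 * √n / (p.η * cAll p LH ^ 2) = Q * √n := by rw [hQ]; ring
        _ ≤ (Q + |b| + 1) * n := by
          gcongr
          linarith [abs_nonneg b]
    · refine supNorm_le (by positivity) fun i => ?_
      rw [abs_of_pos (hx₀0 i)]
      have h1 := (hx₀ i).2.trans (le_abs_self b)
      have h2 := abs_nonneg b
      nlinarith
  set E := Real.log (Q + |b| + 1) + 1 + |Real.log a| with hE
  have hE0 : 0 ≤ Real.log (Q + |b| + 1) := Real.log_nonneg (by linarith [abs_nonneg b])
  have hbr : Real.log (omega2 p LH x₀) - ⨅ i, Real.log (x₀ i) ≤ E * ℓ := by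
    have h1 := Real.log_le_log hω hω2
    rw [Real.log_mul (by positivity) (by positivity)] at h1
    have : Nonempty (Fin n) := ⟨⟨0, hn⟩⟩
    have h2 : Real.log a ≤ ⨅ i, Real.log (x₀ i) :=
      le_ciInf fun i => Real.log_le_log ha (hx₀ i).1
    have h3 := neg_abs_le (Real.log a)
    have h4 : |Real.log a| * 1 ≤ |Real.log a| * ℓ := by gcongr; linarith
    have h5 : Real.log (Q + |b| + 1) * 1 ≤ Real.log (Q + |b| + 1) * ℓ := by gcongr; linarith
    rw [hE]
    linarith
  have hE1 : 0 ≤ E := by positivity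
  have hℓ : 1 ≤ ℓ := by linarith
  have hgap' : gap ≤ |Δ| * ℓ := by
    have := abs_nonneg Δ
    have h := hgap.trans (le_abs_self Δ)
    nlinarith
  have hmain : gap + (u ^ 4)⁻¹ / 4 * n * (Real.log (omega2 p LH x₀) - ⨅ i, Real.log (x₀ i)) ≤
      (|Δ| + E) * ℓ * (1 + n * (u ^ 4)⁻¹) := by
    have h1 : (u ^ 4)⁻¹ / 4 * n * (Real.log (omega2 p LH x₀) - ⨅ i, Real.log (x₀ i)) ≤
        (u ^ 4)⁻¹ / 4 * n * (E * ℓ) := by gcongr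
    have h2 : 0 ≤ |Δ| * ℓ * (n * (u ^ 4)⁻¹) := by positivity
    have h3 : 0 ≤ E * ℓ := by positivity
    have h4 : 0 ≤ E * ℓ * (n * (u ^ 4)⁻¹) := by positivity
    linarith
  unfold Kbar2
  rw [hpow]
  push_cast
  set Y := 1536 * (gap + (u ^ 4)⁻¹ / 4 * n * (Real.log (omega2 p LH x₀) -
    ⨅ i, Real.log (x₀ i))) / (p.η * cAll p LH ^ 3) * u ^ 6 with hY
  have hYle : Y ≤ 1536 * (|Δ| + E) / (p.η * cAll p LH ^ 3) * ℓ * (u ^ 6 + n * u ^ 2) := by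
    calc Y ≤ 1536 * ((|Δ| + E) * ℓ * (1 + n * (u ^ 4)⁻¹)) / (p.η * cAll p LH ^ 3) * u ^ 6 := by
          rw [hY]; gcongr
      _ = _ := by field_simp
  have hu6 : 1 ≤ u ^ 6 := one_le_pow₀ hu
  have h3 : 1 ≤ ℓ * (u ^ 6 + n * u ^ 2) := by
    have : 0 ≤ n * u ^ 2 := by positivity
    nlinarith
  -- No sign of `gap` is assumed here, so Y may be negative and the natural ceiling then is 0.
  have hceil : (⌈Y⌉₊ : ℝ) ≤ max Y 0 + 1 := by
    rcases le_or_gt 0 Y with h | h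
    · rw [max_eq_left h]; exact (Nat.ceil_lt_add_one h).le
    · rw [Nat.ceil_eq_zero.2 h.le, max_eq_right h.le]; norm_num
  have h4 : max Y 0 ≤ 1536 * (|Δ| + E) / (p.η * cAll p LH ^ 3) * ℓ * (u ^ 6 + n * u ^ 2) :=
    max_le hYle (by positivity)
  linarith

/-- For large n the cost per iteration is O(ℓu). If n ≤ J it is at most 4n, and n ≤ C_J ℓ u also
makes the summand n u² of K negligible against u⁶. -/
theorem opBound_le {n J N K : ℕ} {u ℓ CJ CN CK : ℝ} (hn : 0 < n) (hu1 : 1 ≤ u) (hℓ1 : 1 ≤ ℓ)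
    (hCJ : 0 ≤ CJ) (hCN : 0 ≤ CN) (hCK : 0 ≤ CK) (hJ : (J : ℝ) ≤ CJ * ℓ * u)
    (hN : (N : ℝ) ≤ CN * ℓ * u) (hNn : N ≤ n) (hK : (K : ℝ) ≤ CK * ℓ * (u ^ 6 + n * u ^ 2)) :
    (opBound n J N K : ℝ) ≤
        ((2 * CJ + 2 + CN) * CK + 4 * CK * (1 + CJ)) * ℓ ^ 2 * (u ^ 7 + n * u ^ 3) ∧
      (n ≤ J → (opBound n J N K : ℝ) ≤
        ((2 * CJ + 2 + CN) * CK + 4 * CK * (1 + CJ)) * ℓ ^ 2 * (n * u ^ 6)) := by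
  have hn1 : (1 : ℝ) ≤ n := by exact_mod_cast hn
  have hu0 : 0 < u := by linarith
  rw [opBound, Nat.cast_mul]
  constructor
  · have hmax : ((max (2 * min n J + 2) N : ℕ) : ℝ) ≤ (2 * CJ + 2 + CN) * ℓ * u := by
      have h5 : 1 ≤ ℓ * u := by nlinarith
      have h6 : 0 ≤ CJ * ℓ * u := by positivity
      have h7 : 0 ≤ CN * ℓ * u := by positivity
      rw [Nat.cast_max]
      refine max_le ?_ (hN.trans ?_)
      · have : ((2 * min n J + 2 : ℕ) : ℝ) ≤ 2 * J + 2 := by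
          exact_mod_cast (by omega : 2 * min n J + 2 ≤ 2 * J + 2)
        refine this.trans ?_
        linarith
      · linarith
    calc _ ≤ ((2 * CJ + 2 + CN) * ℓ * u) * (CK * ℓ * (u ^ 6 + n * u ^ 2)) := by gcongr
      _ = ((2 * CJ + 2 + CN) * CK) * ℓ ^ 2 * (u ^ 7 + n * u ^ 3) := by ring
      _ ≤ _ := by
        refine mul_le_mul_of_nonneg_right (mul_le_mul_of_nonneg_right ?_ (by positivity))
          (by positivity)
        have : 0 ≤ 4 * CK * (1 + CJ) := by positivity
        linarith
  · intro hnJ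
    have hmax : ((max (2 * min n J + 2) N : ℕ) : ℝ) ≤ 4 * n := by
      have : max (2 * min n J + 2) N ≤ 4 * n := max_le (by omega) (by omega)
      exact_mod_cast this
    have hnu : (n : ℝ) ≤ CJ * ℓ * u := le_trans (by exact_mod_cast hnJ) hJ
    have hu3 : u ^ 3 ≤ u ^ 6 := pow_le_pow_right₀ hu1 (by norm_num)
    have h1 : u ^ 6 + n * u ^ 2 ≤ (1 + CJ) * ℓ * u ^ 6 := by
      calc u ^ 6 + n * u ^ 2 ≤ u ^ 6 + CJ * ℓ * u * u ^ 2 := by gcongr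
        _ = 1 * u ^ 6 + CJ * ℓ * u ^ 3 := by ring
        _ ≤ ℓ * u ^ 6 + CJ * ℓ * u ^ 6 := by gcongr
        _ = _ := by ring
    calc _ ≤ (4 * n) * (CK * ℓ * ((1 + CJ) * ℓ * u ^ 6)) := by
          refine mul_le_mul hmax (hK.trans ?_) (by positivity) (by positivity)
          gcongr
      _ = (4 * CK * (1 + CJ)) * ℓ ^ 2 * (n * u ^ 6) := by ring
      _ ≤ _ := by
        refine mul_le_mul_of_nonneg_right (mul_le_mul_of_nonneg_right ?_ (by positivity))
          (by positivity)
        have : 0 ≤ (2 * CJ + 2 + CN) * CK := by positivity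
        linarith

theorem rate_bound {p : Params} (hp : p.Valid) {LH Ug UH : ℝ} (hLH : 0 < LH) (hUg : 0 < Ug)
    (hUH : 0 < UH) (Δ a b c₁ : ℝ) (ha : 0 < a) : ∃ (C : ℝ) (q : ℕ), 0 < C ∧
      ∀ (n : ℕ), 0 < n → ∀ (εg δ Cmeo gap : ℝ) (x₀ : Vec n) (J : ℕ),
        0 < εg → εg < 1 → 0 ≤ δ → δ < 1 →
        0 ≤ Cmeo → Cmeo ≤ c₁ * logFactor n εg δ → gap ≤ Δ →
        (∀ i, a ≤ x₀ i ∧ x₀ i ≤ b) →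
        J ≤ capJ (UH + εg / 4) √εg p.ζr (p.ζbar * (εg / 4)) (Ug + εg / 4 * √n) →
        (opBound n J (Nmeo n Cmeo √εg) (Kbar2 p LH εg gap x₀) : ℝ) ≤
          C * logFactor n εg δ ^ q * (εg ^ (-(7 / 4) : ℝ) + n * εg ^ (-(3 / 4) : ℝ)) ∧
        (n ≤ J → (opBound n J (Nmeo n Cmeo √εg) (Kbar2 p LH εg gap x₀) : ℝ) ≤
          C * logFactor n εg δ ^ q * (n * εg ^ (-(3 / 2) : ℝ))) := by
  have hc := cAll_pos hp hLH
  have hη := hp.η_mem.1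
  obtain ⟨CJ, hCJ⟩ : ∃ z, z = 2 * (√(UH + 3) + 1) * (Real.log (24 * (UH + 3) ^ 4 / p.ζr +
    32 * (UH + 3) ^ 3 * (Ug + 1) / p.ζbar) + 3) + 1 := ⟨_, rfl⟩
  obtain ⟨CK, hCK⟩ : ∃ z, z = 1536 * (|Δ| + (Real.log (96 / (p.η * cAll p LH ^ 2) + |b| + 1) + 1 + |Real.log a|)) /
    (p.η * cAll p LH ^ 3) + 3 := ⟨_, rfl⟩
  have hCJ0 : 0 ≤ CJ := by
    have h1 := hp.ζr_mem
    have h2 := hp.ζbar_mem.1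
    have : 1 ≤ 24 * (UH + 3) ^ 4 / p.ζr + 32 * (UH + 3) ^ 3 * (Ug + 1) / p.ζbar := by
      have h3 : (1 : ℝ) ≤ (UH + 3) ^ 4 := one_le_pow₀ (by linarith)
      have h4 : 1 ≤ 24 * (UH + 3) ^ 4 / p.ζr := by rw [le_div_iff₀ h1.1]; linarith [h1.2]
      have h5 : 0 ≤ 32 * (UH + 3) ^ 3 * (Ug + 1) / p.ζbar := by positivity
      linarith
    have := Real.log_nonneg this
    rw [hCJ]
    positivity
  have hCK0 : 0 < CK := by
    have : 0 ≤ Real.log (96 / (p.η * cAll p LH ^ 2) + |b| + 1) := by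
      refine Real.log_nonneg ?_
      have : 0 < 96 / (p.η * cAll p LH ^ 2) := by positivity
      linarith [abs_nonneg b]
    rw [hCK]
    positivity
  refine ⟨(2 * CJ + 2 + (2 + |c₁|)) * CK + 4 * CK * (1 + CJ), 2, by positivity, ?_⟩
  intro n hn εg δ Cmeo gap x₀ J hε hε1 hδ hδ1 hC0 hC1 hgap hx₀ hJ
  obtain ⟨hl1, hl2, hl3⟩ := log_terms_nonneg hn hε hε1 hδ hδ1
  set ℓ := logFactor n εg δ with hℓ
  have hℓeq : ℓ = 1 + Real.log n + Real.log (1 / εg) + Real.log (1 / δ) := rfl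
  have hℓ1 : 1 ≤ ℓ := by linarith
  -- In terms of u all exponents become natural numbers: ε_g = u⁻⁴ and ε_H = u⁻².
  set u := εg ^ (-(1 / 4) : ℝ) with hu
  have hu0 : 0 < u := Real.rpow_pos_of_pos hε _
  have hu1 : 1 ≤ u := Real.one_le_rpow_of_pos_of_le_one_of_nonpos hε hε1.le (by norm_num)
  have hup : ∀ k : ℕ, u ^ k = εg ^ (-(k / 4) : ℝ) := by
    intro k
    rw [hu, ← Real.rpow_natCast, ← Real.rpow_mul hε.le]
    congr 1; ring
  have hε4 : εg = (u ^ 4)⁻¹ := by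
    rw [hup, ← Real.rpow_neg hε.le]; norm_num
  have hs2 : √εg = (u ^ 2)⁻¹ := by
    rw [hup, ← Real.rpow_neg hε.le, Real.sqrt_eq_rpow]; norm_num
  have e7 : εg ^ (-(7 / 4) : ℝ) = u ^ 7 := by rw [hup]; norm_num
  have e3 : εg ^ (-(3 / 4) : ℝ) = u ^ 3 := by rw [hup]; norm_num
  have e6 : εg ^ (-(3 / 2) : ℝ) = u ^ 6 := by rw [hup]; norm_num
  have es : √εg ^ (-(1 / 2) : ℝ) = u := by
    rw [hu, Real.sqrt_eq_rpow, ← Real.rpow_mul hε.le]; norm_num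
  have hlogu : Real.log (u ^ 4) = Real.log (1 / εg) := by rw [hε4]; simp
  have hN : (Nmeo n Cmeo √εg : ℝ) ≤ (2 + |c₁|) * ℓ * u := by
    have h1 : Nmeo n Cmeo √εg ≤ 1 + ⌈Cmeo * u⌉₊ := by rw [Nmeo, es]; exact min_le_right _ _
    have h2 : (⌈Cmeo * u⌉₊ : ℝ) ≤ Cmeo * u + 1 := (Nat.ceil_lt_add_one (by positivity)).le
    have h3 : Cmeo ≤ |c₁| * ℓ := hC1.trans (by gcongr; exact le_abs_self _)
    have h4 : Cmeo * u ≤ |c₁| * ℓ * u := by gcongr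
    have h5 : 1 ≤ ℓ * u := by nlinarith
    have h6 : (Nmeo n Cmeo √εg : ℝ) ≤ 1 + ⌈Cmeo * u⌉₊ := by exact_mod_cast h1
    linarith
  have hNn : Nmeo n Cmeo √εg ≤ n := min_le_left _ _
  have hJle : (J : ℝ) ≤ CJ * ℓ * u := by
    have h1 := capJ_le hn hu1 hUH hUg hp.ζr_mem.1 hp.ζr_mem.2 hp.ζbar_mem.1 hℓ1
      (by rw [hlogu]; linarith) hl1
    rw [← hε4, ← hs2, ← hCJ] at h1
    exact le_trans (by exact_mod_cast hJ) h1
  have hK : (Kbar2 p LH εg gap x₀ : ℝ) ≤ CK * ℓ * (u ^ 6 + n * u ^ 2) := by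
    have h1 := Kbar2_le hn hp (gap := gap) (ℓ := ℓ) hLH hu1 ha hx₀ hgap (by linarith)
      (by rw [← hε4]; exact e6)
    rwa [← hε4, ← hCK] at h1
  rw [e7, e3, e6]
  exact opBound_le hn hu1 hℓ1 hCJ0 (by positivity) hCK0.le hJle hN hNn hK

end LogBarrier

/-! ### The main theorem -/

open LogBarrier in
theorem corollary4p10 (p : Params) (hp : p.Valid) (LH Ug UH : ℝ)
    (hLH : 0 < LH) (hUg : 0 < Ug) (hUH : 0 < UH) :
    -- termination, correctness and operation bound
    (∀ (n : ℕ), 0 < n → ∀ (f : Vec n → ℝ) (flow Lg εg δ Cmeo Mhat : ℝ) (x₀ : Vec n),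
      0 < εg → εg < 1 → √εg ≤ p.β → 0 ≤ δ → δ < 1 → 0 ≤ Cmeo → 0 ≤ Mhat →
      (∀ i, 0 < x₀ i) →
      (∀ x : Vec n, (∀ i, 0 < x i) → flow ≤ f x) →
      ∀ {Ω : Type*} {mΩ : MeasurableSpace Ω} (P : Measure Ω) [IsProbabilityMeasure P]
        (ℱ : Filtration ℕ mΩ) (t : Ω → Trace n),
        (∀ ω, IsExecution f p εg Mhat x₀ (t ω)) →
        (∀ ω, SmoothAlong f Lg LH (t ω)) →
        (∀ ω, BoundedAlong f Ug UH (t ω)) →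
        (∀ ω, CGBoundLe (UH + εg / 4) (t ω)) →
        MeoAssumption P ℱ f εg δ (Nmeo n Cmeo √εg) t →
        ∀ (K : ℕ) (J : Ω → ℕ) (Jbar : ℕ),
          K = Kbar2 p LH εg (f x₀ - flow) x₀ →
          (∀ ω, J ω = runJ f εg (UH + εg / 4) √εg p.ζr (p.ζbar * (εg / 4)) (t ω)) →
          Jbar = capJ (UH + εg / 4) √εg p.ζr (p.ζbar * (εg / 4)) (Ug + εg / 4 * √n) →
          -- every run ends within `K` iterations at a first-order point, within the operation
          -- bound if no call of the oracle exceeds its budget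
          (∀ ω, J ω ≤ Jbar ∧ ∃ x, (t ω).status K = .halted x ∧ FirstOrder f εg x ∧
            ((∀ k, MeoCalled f εg (t ω) k → ((t ω).meo k).products ≤ Nmeo n Cmeo √εg) →
              totalOps f εg (t ω) K ≤ opBound n (J ω) (Nmeo n Cmeo √εg) K)) ∧
          -- with probability at least `(1 - δ) ^ K` it is a second-order point as well, and the
          -- operation bound holds
          (∃ S : Set Ω, MeasurableSet S ∧ ENNReal.ofReal ((1 - δ) ^ K) ≤ P S ∧
            ∀ ω ∈ S, ∃ x, (t ω).status K = .halted x ∧ FirstOrder f εg x ∧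
              SecondOrder f √εg x ∧
              totalOps f εg (t ω) K ≤ opBound n (J ω) (Nmeo n Cmeo √εg) K) ∧
          -- the termination is incorrect with probability at most `1 - (1 - δ) ^ K`
          P {ω | ∃ x, (t ω).status K = .halted x ∧ FirstOrder f εg x ∧ ¬ SecondOrder f √εg x}
            ≤ ENNReal.ofReal (1 - (1 - δ) ^ K)) ∧
    -- rates of the operation bound, up to logarithmic factors
    (∀ Δ a b c₁ : ℝ, 0 < a → ∃ (C : ℝ) (q : ℕ), 0 < C ∧
      ∀ (n : ℕ), 0 < n → ∀ (εg δ Cmeo gap : ℝ) (x₀ : Vec n) (J : ℕ),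
        0 < εg → εg < 1 → √εg ≤ p.β → 0 ≤ δ → δ < 1 →
        0 ≤ Cmeo → Cmeo ≤ c₁ * logFactor n εg δ → 0 ≤ gap → gap ≤ Δ →
        (∀ i, a ≤ x₀ i ∧ x₀ i ≤ b) →
        J ≤ capJ (UH + εg / 4) √εg p.ζr (p.ζbar * (εg / 4)) (Ug + εg / 4 * √n) →
        (opBound n J (Nmeo n Cmeo √εg) (Kbar2 p LH εg gap x₀) : ℝ) ≤
          C * logFactor n εg δ ^ q * (εg ^ (-(7 / 4) : ℝ) + n * εg ^ (-(3 / 4) : ℝ)) ∧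
        (n ≤ J → (opBound n J (Nmeo n Cmeo √εg) (Kbar2 p LH εg gap x₀) : ℝ) ≤
          C * logFactor n εg δ ^ q * (n * εg ^ (-(3 / 2) : ℝ)))) := by
  refine ⟨?_, fun Δ a b c₁ ha => ?_⟩
  · intro n hn f flow Lg εg δ Cmeo Mhat x₀ hε hε1 hβ hδ hδ1 hC hMhat hx₀ hlow Ω mΩ P _ ℱ t hexec
      hsmooth hbdd hcgM hmeo K J Jbar hK hJ hJbar
    have hrun : ∀ ω, RunAssumptions f p εg Mhat Lg LH flow x₀ (t ω) := fun ω =>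
      ⟨hp, hLH, hn, hε, hε1, hβ, hMhat, hx₀, hlow, hexec ω, hsmooth ω, hmeo.curvature ω⟩
    have hmain := fun ω => (hrun ω).conclusion hUg hUH (hbdd ω) (hcgM ω) (Nmeo n Cmeo √εg)
    simp only [← hJ, ← hK] at hmain
    obtain ⟨hSm, hSP⟩ := pow_le_measureReal_forall_lt P ℱ hδ1.le hδ hmeo.measurable_called
      hmeo.measurable_good hmeo.prob_good K
    set S := {ω | ∀ k < K, ω ∈ {ω | MeoCalled f εg (t ω) k} →
      ω ∈ {ω | MeoGood f εg (Nmeo n Cmeo √εg) (t ω) k}} with hS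
    have hSm' : MeasurableSet S := ℱ.le K _ hSm
    have hgood : ∀ ω ∈ S, ∃ x, (t ω).status K = .halted x ∧ FirstOrder f εg x ∧
        SecondOrder f √εg x ∧ totalOps f εg (t ω) K ≤ opBound n (J ω) (Nmeo n Cmeo √εg) K := by
      intro ω hω
      obtain ⟨k, hk, x, h1, h2, h3, h4, h5, h6⟩ := hmain ω
      refine ⟨x, h4, h5, ?_, h6 fun j hj hcalled => ?_⟩
      -- The halting iteration is itself an oracle call before K, so on S its certificate is
      -- correct.
      · obtain ⟨y, hy, -, -, hso⟩ := hω k hk ⟨x, h1, h2⟩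
        rw [h1] at hy
        cases hy
        exact hso h3
      · obtain ⟨y, -, -, hprod, -⟩ := hω j hj hcalled
        exact hprod
    refine ⟨fun ω => ⟨?_, ?_⟩, ⟨S, hSm', ?_, hgood⟩, ?_⟩
    · rw [hJ, hJbar]
      exact ((hrun ω).runJ_spec hUg hUH (hbdd ω)).2
    · obtain ⟨k, hk, x, h1, h2, h3, h4, h5, h6⟩ := hmain ω
      exact ⟨x, h4, h5, fun hb => h6 fun j _ => hb j⟩
    · rw [← ofReal_measureReal]
      exact ENNReal.ofReal_le_ofReal hSP
    -- The set of incorrect runs need not be measurable; it is bounded through the complement of S.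
    · have hsub : {ω | ∃ x, (t ω).status K = .halted x ∧ FirstOrder f εg x ∧
          ¬ SecondOrder f √εg x} ⊆ Sᶜ := by
        rintro ω ⟨x, h1, -, h2⟩ hω
        obtain ⟨y, h3, -, h4, -⟩ := hgood ω hω
        rw [h1] at h3
        cases h3
        exact h2 h4
      refine (measure_mono hsub).trans ?_
      rw [← ofReal_measureReal, probReal_compl_eq_one_sub hSm']
      exact ENNReal.ofReal_le_ofReal (by linarith)
  · obtain ⟨C, q, hC, h⟩ := rate_bound hp hLH hUg hUH Δ a b c₁ ha
    exact ⟨C, q, hC, fun n hn εg δ Cmeo gap x₀ J h1 h2 _ h3 h4 h5 h6 _ h7 h8 h9 =>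
      h n hn εg δ Cmeo gap x₀ J h1 h2 h3 h4 h5 h6 h7 h8 h9⟩
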